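/- Let $X$ be a finite connected CW complex with universal covering $\widetilde X$, let $G=\pi_1(X)$, let $R$ be an integral domain and let $\rho:G\to \mathrm{GL}(l,R)$ be a representation. Let $n=\mathrm{rk}\,H_1(X,\mathbb Z)$, let $\phi:G\to H_1(X,\mathbb Z)/\mathrm{Tors}\cong\mathbb Z^n$ be the projection, and let $C_*(\widetilde X)$ be the cellular chain complex of $\widetilde X$, regarded as a complex of right $\mathbb Z[G]$-modules. For a homomorphism $p:G\to A$ to an abelian group let $\rho\otimes p:G\to\mathrm{GL}(l,R[A])$ be the representation $g\mapsto \rho(g)\,[p(g)]$. Let $Q$ be the fraction field of $R[\mathbb Z^n]$ and put $$b_k^\circ(X,\rho)=\dim_{Q} H_k\big(C_*(\widetilde X)\otimes_{\rho\otimes\phi} Q^l\big).$$ For a homomorphism $\xi:G\to\mathbb R$ let $A=\xi(G)\subset\mathbb R$, a free abelian group of finite rank, let $p:G\to A$ be the epimorphism defined by $\xi$, and let $\widehat L_\xi$ be the Novikov ring of all formal series $\sum_{a\in A} r_a[a]$ with $r_a\in R$ such that for every $C\in\mathbb R$ the set $\{a\in A : r_a\neq 0,\ a\ge C\}$ is finite.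 Let $$\widehat b_k^\rho(X,\xi)=\mathrm{rk}_{\widehat L_\xi}\, H_k\big(C_*(\widetilde X)\otimes_{\rho\otimes p} \widehat L_\xi^{\,l}\big)$$ be the $k$-th twisted Novikov Betti number. A subgroup of $\mathrm{Hom}(\mathbb Z^n,\mathbb Z)$ is called full if it is a direct summand. Let $k\ge 0$ and $q>0$ be integers. Then there is a finite (possibly empty) family of proper full subgroups $G_i\subset \mathrm{Hom}(\mathbb Z^n,\mathbb Z)$ such that for every homomorphism $\xi:G\to\mathbb R$, regarded through $\phi$ as an element of $\mathrm{Hom}(\mathbb Z^n,\mathbb R)=\mathrm{Hom}(\mathbb Z^n,\mathbb Z)\otimes\mathbb R$, $$\widehat b_k^\rho(X,\xi)\ \ge\ b_k^\circ(X,\rho)+q \iff \xi\in\bigcup_i G_i\otimes\mathbb R .$$ -/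

import Mathlib

open CategoryTheory AlgebraicTopology TensorProduct

universe u v w

noncomputable section

namespace TwistedNovikov

/-! ### Cellular chains of a filtered space -/

section Cellular

variable {E : Type v} [TopologicalSpace E]

/-- The integral singular chain complex of a space. -/
abbrev singChains (E : Type v) [TopologicalSpace E] : ChainComplex AddCommGrpCat.{v} ℕ :=
  ((singularChainComplexFunctor AddCommGrpCat.{v}).obj (AddCommGrpCat.of (ULift.{v} ℤ))).obj
    (TopCat.of E)

/-- The map of singular chain complexes induced by a continuous map. -/
abbrev singMap {E E' : Type v} [TopologicalSpace E] [TopologicalSpace E'] (f : C(E, E')) :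
    singChains E ⟶ singChains E' :=
  ((singularChainComplexFunctor AddCommGrpCat.{v}).obj (AddCommGrpCat.of (ULift.{v} ℤ))).map
    (TopCat.ofHom f)

/-- The boundary of singular chains as a homomorphism of abelian groups. -/
abbrev bd (E : Type v) [TopologicalSpace E] (i j : ℕ) :
    (singChains E).X i →+ (singChains E).X j :=
  ((singChains E).d i j).hom

/-- The push-forward of singular chains as a homomorphism of abelian groups. -/
abbrev push {E E' : Type v} [TopologicalSpace E] [TopologicalSpace E'] (f : C(E, E')) (k : ℕ) :
    (singChains E).X k →+ (singChains E').X k :=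
  ((singMap f).f k).hom

/-- The inclusion of a subspace. -/
def incl (A : Set E) : C(A, E) := ⟨Subtype.val, continuous_subtype_val⟩

/-- The singular `k`-chains of `E` that lie in the subspace `A`. -/
def chainsIn (A : Set E) (k : ℕ) : AddSubgroup ((singChains E).X k) :=
  (push (incl A) k).range

theorem push_comp {E₁ E₂ E₃ : Type v} [TopologicalSpace E₁] [TopologicalSpace E₂]
    [TopologicalSpace E₃] (f : C(E₁, E₂)) (g : C(E₂, E₃)) (k : ℕ) (c : (singChains E₁).X k) :
    push (g.comp f) k c = push g k (push f k c) := by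
  have e : singMap (g.comp f) = singMap f ≫ singMap g := by
    rw [← Functor.map_comp]
    rfl
  simp [push, e]

theorem bd_push {E₁ E₂ : Type v} [TopologicalSpace E₁] [TopologicalSpace E₂] (f : C(E₁, E₂))
    (i j : ℕ) (c : (singChains E₁).X i) :
    bd E₂ i j (push f i c) = push f j (bd E₁ i j c) := by
  have := congrArg (fun m => m.hom c) ((singMap f).comm i j)
  exact this

theorem bd_bd (i j k : ℕ) (c : (singChains E).X i) : bd E j k (bd E i j c) = 0 := by
  have := congrArg (fun m => m.hom c) ((singChains E).d_comp_d i j k)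
  exact this

theorem push_mem_chainsIn {T : C(E, E)} {A B : Set E} (h : Set.MapsTo T A B) {k : ℕ}
    {c : (singChains E).X k} (hc : c ∈ chainsIn A k) : push T k c ∈ chainsIn B k := by
  obtain ⟨y, rfl⟩ := hc
  let T' : C(A, B) := ⟨h.restrict, T.continuous.continuousOn.mapsToRestrict h⟩
  refine ⟨push T' k y, ?_⟩
  rw [← push_comp, ← push_comp]
  rfl

/-- Relative cycles of a filtration `∅ = F 0 ⊆ F 1 ⊆ ...`, where `F (k + 1)` is to be thought of as
the `k`-skeleton: the `k`-chains of `F (k + 1)` whose boundary lies in `F k`. -/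
def relCycles (F : ℕ → Set E) (k : ℕ) : AddSubgroup ((singChains E).X k) :=
  chainsIn (F (k + 1)) k ⊓ ⨅ j, (chainsIn (F k) j).comap (bd E k j)

/-- Relative boundaries: boundaries of chains of `F (k + 1)`, plus chains of `F k`. -/
def relBoundaries (F : ℕ → Set E) (k : ℕ) : AddSubgroup ((singChains E).X k) :=
  (chainsIn (F (k + 1)) (k + 1)).map (bd E (k + 1) k) ⊔ chainsIn (F k) k

/-- The group of cellular `k`-chains: the relative singular homology group
`H_k(F (k + 1), F k; ℤ)`, that is, `H_k` of the `k`-skeleton modulo the `(k - 1)`-skeleton. -/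
abbrev CellChains (F : ℕ → Set E) (k : ℕ) : Type v :=
  relCycles F k ⧸ (relBoundaries F k).addSubgroupOf (relCycles F k)

theorem mem_relCycles {F : ℕ → Set E} {k : ℕ} {c : (singChains E).X k} :
    c ∈ relCycles F k ↔ c ∈ chainsIn (F (k + 1)) k ∧ ∀ j, bd E k j c ∈ chainsIn (F k) j := by
  simp only [relCycles, AddSubgroup.mem_inf, AddSubgroup.mem_iInf, AddSubgroup.mem_comap]

theorem bd_mem_relCycles {F : ℕ → Set E} {k : ℕ} {c : (singChains E).X (k + 1)}
    (hc : c ∈ relCycles F (k + 1)) : bd E (k + 1) k c ∈ relCycles F k := by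
  rw [mem_relCycles] at hc ⊢
  refine ⟨hc.2 k, fun j => ?_⟩
  rw [bd_bd]
  exact zero_mem _

theorem bd_mem_relBoundaries {F : ℕ → Set E} {k : ℕ} {c : (singChains E).X (k + 1)}
    (hc : c ∈ relBoundaries F (k + 1)) : bd E (k + 1) k c ∈ relBoundaries F k := by
  obtain ⟨_, ⟨e, -, rfl⟩, s, hs, rfl⟩ := AddSubgroup.mem_sup.1 hc
  rw [map_add, bd_bd, zero_add]
  exact AddSubgroup.mem_sup_left ⟨s, hs, rfl⟩

/-- The differential of the cellular chain complex, `[c] ↦ [∂c]`; it is the connecting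
homomorphism of the triple `(F (k + 2), F (k + 1), F k)`. -/
def cellD (F : ℕ → Set E) (k : ℕ) : CellChains F (k + 1) →+ CellChains F k :=
  QuotientAddGroup.map _ _
    (((bd E (k + 1) k).comp (relCycles F (k + 1)).subtype).codRestrict (relCycles F k)
      (fun c => bd_mem_relCycles c.2))
    (fun _ hc => bd_mem_relBoundaries hc)

theorem cellD_cellD (F : ℕ → Set E) (k : ℕ) (x : CellChains F (k + 2)) :
    cellD F k (cellD F (k + 1) x) = 0 := by
  obtain ⟨c, rfl⟩ := QuotientAddGroup.mk_surjective x
  refine (QuotientAddGroup.eq_zero_iff _).2 ?_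
  change bd E (k + 1) k (bd E (k + 2) (k + 1) c.1) ∈ relBoundaries F k
  rw [bd_bd]
  exact zero_mem _

theorem push_mem_relCycles {F : ℕ → Set E} {T : C(E, E)}
    (hT : ∀ j, Set.MapsTo T (F j) (F j)) {k : ℕ} {c : (singChains E).X k}
    (hc : c ∈ relCycles F k) : push T k c ∈ relCycles F k := by
  rw [mem_relCycles] at hc ⊢
  refine ⟨push_mem_chainsIn (hT _) hc.1, fun j => ?_⟩
  rw [bd_push]
  exact push_mem_chainsIn (hT _) (hc.2 j)

theorem push_mem_relBoundaries {F : ℕ → Set E} {T : C(E, E)}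
    (hT : ∀ j, Set.MapsTo T (F j) (F j)) {k : ℕ} {c : (singChains E).X k}
    (hc : c ∈ relBoundaries F k) : push T k c ∈ relBoundaries F k := by
  obtain ⟨_, ⟨e, he, rfl⟩, s, hs, rfl⟩ := AddSubgroup.mem_sup.1 hc
  rw [map_add, ← bd_push]
  exact AddSubgroup.add_mem_sup ⟨_, push_mem_chainsIn (hT _) he, rfl⟩
    (push_mem_chainsIn (hT _) hs)

/-- The map of cellular chains induced by a filtration preserving map. -/
def cellMap {F : ℕ → Set E} (T : C(E, E)) (hT : ∀ j, Set.MapsTo T (F j) (F j)) (k : ℕ) :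
    CellChains F k →+ CellChains F k :=
  QuotientAddGroup.map _ _
    (((push T k).comp (relCycles F k).subtype).codRestrict (relCycles F k)
      (fun c => push_mem_relCycles hT c.2))
    (fun _ hc => push_mem_relBoundaries hT hc)

theorem cellD_cellMap {F : ℕ → Set E} (T : C(E, E)) (hT : ∀ j, Set.MapsTo T (F j) (F j)) (k : ℕ)
    (x : CellChains F (k + 1)) :
    cellD F k (cellMap T hT (k + 1) x) = cellMap T hT k (cellD F k x) := by
  obtain ⟨c, rfl⟩ := QuotientAddGroup.mk_surjective x
  exact congrArg (QuotientAddGroup.mk (s := (relBoundaries F k).addSubgroupOf (relCycles F k)))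
    (Subtype.ext (bd_push T (k + 1) k c.1))

end Cellular

/-! ### Homology of a CW complex with twisted coefficients -/

section Twisted

variable {X : Type u} [TopologicalSpace X] {E : Type v} [TopologicalSpace E]

/-- `T` is the deck transformation of the universal covering `π : E → X` that corresponds to the
class `g` in the fundamental group: it is a map over `X` which sends the base point `e₀` to the
end point of a path from `e₀` that lifts a loop of class `g`.

In Mathlib's fundamental group `g * h` is the class of a loop of class `h` followed by a loop
of class `g`. Hence the deck transformation of `g * h` is that of `h` composed with
that of `g`, the one of `g` being applied first: this is a right action on `E`. -/
def IsDeck (π : C(E, X)) (e₀ : E) (g : FundamentalGroup X (π e₀)) (T : C(E, E)) : Prop :=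
  (∀ e, π (T e) = π e) ∧ ∃ (h : π (T e₀) = π e₀) (Γ : Path e₀ (T e₀)),
    g = FundamentalGroup.fromPath
      (Path.Homotopic.Quotient.mk ((Γ.map π.continuous).cast rfl h.symm))

variable [T2Space X] [Topology.CWComplex (Set.univ : Set X)]

/-- The filtration of a covering of `X` by the preimages of the skeleta of `X`:
`liftedSkeleta π (k + 1)` is the preimage of the `k`-skeleton, `liftedSkeleta π 0 = ∅`. -/
def liftedSkeleta (π : C(E, X)) (j : ℕ) : Set E :=
  π ⁻¹' (Topology.CWComplex.skeletonLT (Set.univ : Set X) (j : ℕ∞) : Set X)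

theorem IsDeck.mapsTo {π : C(E, X)} {e₀ : E} {g : FundamentalGroup X (π e₀)} {T : C(E, E)}
    (h : IsDeck π e₀ g T) (j : ℕ) : Set.MapsTo T (liftedSkeleta π j) (liftedSkeleta π j) := by
  intro e he
  simpa only [liftedSkeleta, Set.mem_preimage, h.1 e] using he

variable {K : Type w} [CommRing K] {l : ℕ}

/-- The relations `(c · g) ⊗ v = c ⊗ σ(g) v` that define the tensor product over the group ring of
`π₁(X)` inside the tensor product over `ℤ` of the cellular chains of the universal covering
with `K ^ l`; the factor `K ^ l` is written on the left. -/
def twistedRel (π : C(E, X)) (e₀ : E)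
    (σ : FundamentalGroup X (π e₀) →* Matrix.GeneralLinearGroup (Fin l) K) (k : ℕ) :
    Submodule K ((Fin l → K) ⊗[ℤ] CellChains (liftedSkeleta π) k) :=
  Submodule.span K {x | ∃ (g : FundamentalGroup X (π e₀)) (T : C(E, E)) (hT : IsDeck π e₀ g T)
    (v : Fin l → K) (c : CellChains (liftedSkeleta π) k),
    x = v ⊗ₜ[ℤ] cellMap T hT.mapsTo k c - ((σ g : Matrix (Fin l) (Fin l) K).mulVec v) ⊗ₜ[ℤ] c}

/-- The module of twisted cellular `k`-chains `C_k(E) ⊗_σ K ^ l`. -/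
abbrev TwistedChains (π : C(E, X)) (e₀ : E)
    (σ : FundamentalGroup X (π e₀) →* Matrix.GeneralLinearGroup (Fin l) K) (k : ℕ) :
    Type (max v w) :=
  ((Fin l → K) ⊗[ℤ] CellChains (liftedSkeleta π) k) ⧸ twistedRel π e₀ σ k

/-- `id ⊗ ∂` before passing to the quotient. -/
def tensorD (π : C(E, X)) (K : Type w) [CommRing K] (l k : ℕ) :
    ((Fin l → K) ⊗[ℤ] CellChains (liftedSkeleta π) (k + 1)) →ₗ[K]
      ((Fin l → K) ⊗[ℤ] CellChains (liftedSkeleta π) k) :=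
  TensorProduct.AlgebraTensorModule.map LinearMap.id (cellD (liftedSkeleta π) k).toIntLinearMap

theorem twistedRel_le (π : C(E, X)) (e₀ : E)
    (σ : FundamentalGroup X (π e₀) →* Matrix.GeneralLinearGroup (Fin l) K) (k : ℕ) :
    twistedRel π e₀ σ (k + 1) ≤ (twistedRel π e₀ σ k).comap (tensorD π K l k) := by
  refine Submodule.span_le.2 ?_
  rintro _ ⟨g, T, hT, v, c, rfl⟩
  refine Submodule.subset_span ⟨g, T, hT, v, cellD _ k c, ?_⟩
  rw [← cellD_cellMap, map_sub]
  rfl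

/-- The differential `id ⊗ ∂` of the twisted cellular chain complex. -/
def twistedD (π : C(E, X)) (e₀ : E)
    (σ : FundamentalGroup X (π e₀) →* Matrix.GeneralLinearGroup (Fin l) K) (k : ℕ) :
    TwistedChains π e₀ σ (k + 1) →ₗ[K] TwistedChains π e₀ σ k :=
  Submodule.mapQ _ _ (tensorD π K l k) (twistedRel_le π e₀ σ k)

theorem tensorD_tensorD (π : C(E, X)) (K : Type w) [CommRing K] (l k : ℕ) :
    tensorD π K l k ∘ₗ tensorD π K l (k + 1) = 0 := by
  refine TensorProduct.AlgebraTensorModule.ext fun v c => ?_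
  change v ⊗ₜ[ℤ] cellD _ k (cellD _ (k + 1) c) = 0
  rw [cellD_cellD, TensorProduct.tmul_zero]

theorem twistedD_twistedD (π : C(E, X)) (e₀ : E)
    (σ : FundamentalGroup X (π e₀) →* Matrix.GeneralLinearGroup (Fin l) K) (k : ℕ) :
    twistedD π e₀ σ k ∘ₗ twistedD π e₀ σ (k + 1) = 0 := by
  refine LinearMap.ext fun x => ?_
  obtain ⟨c, rfl⟩ := Submodule.Quotient.mk_surjective _ x
  have := LinearMap.congr_fun (tensorD_tensorD π K l k) c
  exact congrArg (Submodule.Quotient.mk (p := twistedRel π e₀ σ k)) this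

/-- The complex of `K`-modules `C_*(E) ⊗_σ K ^ l`. -/
def twistedComplex (π : C(E, X)) (e₀ : E)
    (σ : FundamentalGroup X (π e₀) →* Matrix.GeneralLinearGroup (Fin l) K) :
    ChainComplex (ModuleCat.{max v w} K) ℕ :=
  ChainComplex.of (fun k => ModuleCat.of K (TwistedChains π e₀ σ k))
    (fun k => ModuleCat.ofHom (twistedD π e₀ σ k))
    (fun k => by
      rw [← ModuleCat.ofHom_comp, twistedD_twistedD]
      rfl)

/-- The rank over `K` of `H_k(C_*(E) ⊗_σ K ^ l)`. -/
def twistedRank (π : C(E, X)) (e₀ : E)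
    (σ : FundamentalGroup X (π e₀) →* Matrix.GeneralLinearGroup (Fin l) K) (k : ℕ) : ℕ :=
  Module.finrank K ((twistedComplex π e₀ σ).homology k)

end Twisted

/-! ### Twisting a representation, and the Novikov ring -/

section Novikov

/-- The tensor product `g ↦ ρ(g) · [p(g)]` of a representation `ρ` over `R` with a
homomorphism `p` to an abelian group `A`, a representation over the group ring `R[A]`. -/
def twistRep {G : Type u} [Group G] {R : Type w} [CommRing R] {A : Type v} [AddCommGroup A] {l : ℕ}
    (ρ : G →* Matrix.GeneralLinearGroup (Fin l) R) (p : Additive G →+ A) :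
    G →* Matrix.GeneralLinearGroup (Fin l) (AddMonoidAlgebra R A) :=
  MonoidHom.toHomUnits
    { toFun := fun g => Matrix.of fun i j =>
        AddMonoidAlgebra.single (p (Additive.ofMul g)) ((ρ g : Matrix (Fin l) (Fin l) R) i j)
      map_one' := by
        ext1 i j
        by_cases h : i = j
        · subst h
          simp [AddMonoidAlgebra.one_def]
        · simp [Matrix.one_apply_ne h]
      map_mul' := fun g h => by
        ext1 i j
        have e : (ρ (g * h) : Matrix (Fin l) (Fin l) R) i j =
            ∑ m, (ρ g : Matrix (Fin l) (Fin l) R) i m * (ρ h : Matrix (Fin l) (Fin l) R) m j := by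
          rw [map_mul, Units.val_mul, Matrix.mul_apply]
        simp only [ofMul_mul, map_add, Matrix.mul_apply, Matrix.of_apply,
          AddMonoidAlgebra.single_mul_single, e]
        exact map_sum (AddMonoidAlgebra.singleAddHom (R := R) _) _ _ }

/-- The finiteness condition in the definition of the Novikov completion: for every real `C` only
finitely many exponents `a ≥ C` occur in the series. -/
def IsNovikov {R : Type w} [CommRing R] {A : AddSubgroup ℝ} (x : HahnSeries Aᵒᵈ R) : Prop :=
  ∀ C : ℝ, {a : A | x.coeff (OrderDual.toDual a) ≠ 0 ∧ C ≤ (a : ℝ)}.Finite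

theorem isNovikov_single {R : Type w} [CommRing R] {A : AddSubgroup ℝ} (a : A) (r : R) :
    IsNovikov (HahnSeries.single (OrderDual.toDual a) r : HahnSeries Aᵒᵈ R) := by
  intro C
  refine (Set.finite_singleton a).subset fun b hb => ?_
  by_contra h
  exact hb.1 (HahnSeries.coeff_single_of_ne (fun e => h (OrderDual.toDual.injective e)))

theorem IsNovikov.add {R : Type w} [CommRing R] {A : AddSubgroup ℝ} {x y : HahnSeries Aᵒᵈ R}
    (hx : IsNovikov x) (hy : IsNovikov y) : IsNovikov (x + y) := by
  intro C
  refine ((hx C).union (hy C)).subset fun a ha => ?_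
  by_contra h
  simp only [Set.mem_union, Set.mem_ofPred_eq, ha.2, and_true, not_or, not_not] at h
  exact ha.1 (by rw [HahnSeries.coeff_add, h.1, h.2, add_zero])

theorem IsNovikov.exists_bound {R : Type w} [CommRing R] {A : AddSubgroup ℝ}
    {x : HahnSeries Aᵒᵈ R} (hx : IsNovikov x) :
    ∃ M : ℝ, ∀ a : A, x.coeff (OrderDual.toDual a) ≠ 0 → (a : ℝ) ≤ M := by
  obtain ⟨M, hM⟩ := ((hx 0).image (fun a : A => (a : ℝ))).bddAbove
  refine ⟨max M 0, fun a ha => ?_⟩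
  rcases le_total 0 (a : ℝ) with h | h
  · exact (hM ⟨a, ⟨ha, h⟩, rfl⟩).trans (le_max_left _ _)
  · exact h.trans (le_max_right _ _)

theorem IsNovikov.mul {R : Type w} [CommRing R] {A : AddSubgroup ℝ} {x y : HahnSeries Aᵒᵈ R}
    (hx : IsNovikov x) (hy : IsNovikov y) : IsNovikov (x * y) := by
  intro C
  obtain ⟨M, hM⟩ := hx.exists_bound
  obtain ⟨N, hN⟩ := hy.exists_bound
  refine (((hx (C - N)).prod (hy (C - M))).image (fun p : A × A => p.1 + p.2)).subset
    fun a ha => ?_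
  obtain ⟨b, hb, c, hc, hbc⟩ := HahnSeries.support_mul_subset (x := x) (y := y) ha.1
  have e : OrderDual.ofDual b + OrderDual.ofDual c = a := hbc
  have e' : ((OrderDual.ofDual b : A) : ℝ) + ((OrderDual.ofDual c : A) : ℝ) = a := by
    rw [← e]
    rfl
  have h1 := hM (OrderDual.ofDual b) hb
  have h2 := hN (OrderDual.ofDual c) hc
  have h3 : C ≤ (a : ℝ) := ha.2
  exact ⟨(OrderDual.ofDual b, OrderDual.ofDual c),
    ⟨⟨hb, show C - N ≤ ((OrderDual.ofDual b : A) : ℝ) by linarith⟩,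
      ⟨hc, show C - M ≤ ((OrderDual.ofDual c : A) : ℝ) by linarith⟩⟩, e⟩

/-- The Novikov completion of the group ring `R[A]` of a subgroup `A` of `ℝ`: the formal series
`∑ r_a [a]` over `a ∈ A` such that for every real `C` only finitely many `a ≥ C` have
`r_a ≠ 0`, with the convolution product. They are realised inside the Hahn series over `A` with
the reversed order, in which every support of this kind is well-ordered. -/
def NovikovRing (R : Type w) [CommRing R] (A : AddSubgroup ℝ) :
    Subalgebra R (HahnSeries Aᵒᵈ R) where
  carrier := {x | IsNovikov x}
  add_mem' hx hy := hx.add hy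
  mul_mem' hx hy := hx.mul hy
  algebraMap_mem' r := by
    have e : algebraMap R (HahnSeries Aᵒᵈ R) r =
        HahnSeries.single (OrderDual.toDual (0 : A)) r := rfl
    rw [e]
    exact isNovikov_single 0 r

/-- The inclusion of the group ring in its Novikov completion. -/
def toNovikov (R : Type w) [CommRing R] (A : AddSubgroup ℝ) :
    AddMonoidAlgebra R A →ₐ[R] NovikovRing R A :=
  AddMonoidAlgebra.lift R (NovikovRing R A) A
    { toFun := fun a =>
        ⟨HahnSeries.single (OrderDual.toDual (Multiplicative.toAdd a)) 1, isNovikov_single _ _⟩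
      map_one' := rfl
      map_mul' := fun a b => Subtype.ext (by
        simp [HahnSeries.single_mul_single]) }

end Novikov

/-! ### The Betti numbers and the jump loci -/

section Betti

variable {X : Type u} [TopologicalSpace X] [T2Space X] [Topology.CWComplex (Set.univ : Set X)]
  {E : Type v} [TopologicalSpace E] {R : Type w} [CommRing R] {l : ℕ}

/-- The Betti number of the maximal free abelian covering with `ρ`-twisted coefficients: with
`φ : π₁(X) → ℤ ^ n` the projection to `H₁(X)` modulo torsion, the dimension over the fraction
field `Q` of the Laurent polynomial ring `R[ℤ ^ n]` of `H_k(C_*(E) ⊗ Q ^ l)`, where `π₁(X)` acts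
on `Q ^ l` by `ρ ⊗ φ`. -/
def genericBetti (π : C(E, X)) (e₀ : E)
    (ρ : FundamentalGroup X (π e₀) →* Matrix.GeneralLinearGroup (Fin l) R) {n : ℕ}
    (φ : Additive (FundamentalGroup X (π e₀)) →+ (Fin n → ℤ)) (k : ℕ) : ℕ :=
  twistedRank (K := FractionRing (AddMonoidAlgebra R (Fin n → ℤ))) π e₀
    ((Matrix.GeneralLinearGroup.map (algebraMap (AddMonoidAlgebra R (Fin n → ℤ)) _)).comp
      (twistRep ρ φ)) k

/-- The twisted Novikov Betti number of `X` with respect to `ξ : π₁(X) → ℝ`. The homomorphism `ξ`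
is factored as the epimorphism `p` to its image, a free abelian group, followed by the inclusion
of the image in `ℝ`. The number is the rank of `H_k(C_*(E) ⊗ L ^ l)` over the Novikov completion
`L` of the group ring of the image, where `π₁(X)` acts on `L ^ l` by `ρ ⊗ p`. -/
def novikovBetti (π : C(E, X)) (e₀ : E)
    (ρ : FundamentalGroup X (π e₀) →* Matrix.GeneralLinearGroup (Fin l) R)
    (ξ : Additive (FundamentalGroup X (π e₀)) →+ ℝ) (k : ℕ) : ℕ :=
  twistedRank (K := NovikovRing R ξ.range) π e₀
    ((Matrix.GeneralLinearGroup.map (toNovikov R ξ.range).toRingHom).comp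
      (twistRep ρ ξ.rangeRestrict)) k

end Betti

/-- A full subgroup: a direct summand. -/
def IsFull {M : Type u} [AddCommGroup M] (H : AddSubgroup M) : Prop :=
  ∃ H' : AddSubgroup M, IsCompl H H'

/-- For a subgroup `H` of `Hom(ℤ ^ n, ℤ)`, the real subspace `H ⊗ ℝ` of
`Hom(ℤ ^ n, ℝ) = Hom(ℤ ^ n, ℤ) ⊗ ℝ`. -/
def realSpan {n : ℕ} (H : AddSubgroup ((Fin n → ℤ) →+ ℤ)) : Submodule ℝ ((Fin n → ℤ) →+ ℝ) :=
  Submodule.span ℝ ((fun h => (Int.castAddHom ℝ).comp h) '' (H : Set ((Fin n → ℤ) →+ ℤ)))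

end TwistedNovikov

end

/-! Both Betti numbers are ranks of homology of one complex after a change of coefficients, and such
ranks are governed by the vanishing of minors. Let `F` be the fraction field of `R` and `S = F[ℤ ^
n]`. Over `S` the twisted cellular chains form a complex of finitely generated free modules. Both
numbers are obtained from it by base change to a field `K`: for the generic number the map `S → K`
is injective, and for the Novikov number it factors as `F[ℤ ^ n] → F[A] → K` with the second arrow
injective and `K` the fraction field of the Novikov ring (`genericBetti_eq`, `novikovBetti_eq`). A
Betti number over a field is the rank of the chains minus the ranks of two differentials, so it can
only grow when more minors vanish (`exists_twistedRank_le`).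

A minor is a Laurent polynomial, and whether it dies in `F[A]` depends only on which of its
exponents have equal values under `ξ`. Let `T` be the finite set of exponents of all minors. The
condition "the Novikov number is at least the generic one plus `q`" then depends only on the
coincidences `ξ a = ξ b` with `a, b ∈ T`, and persists when coincidences are added. For injective
`ξ` no nonzero minor dies, so there the Novikov number is at most the generic one and the condition
fails, because `q > 0`. Each of the finitely many patterns of coincidences realised by a solution
cuts out a rational linear subspace, namely the real span of the annihilator of the differences `a -
b`. This annihilator is a direct summand, and it is proper because injective classes are excluded
(`exists_full_subgroups`).

The remaining work is to show that the cellular chains, defined as relative singular homology of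
skeleta, are finitely generated and free enough. Subdivision, excision and a deformation of the
skeleta identify them with a direct sum, over cells and elements of the fundamental group, of copies
of the homology of an open ball relative to a collar (`exists_cellChains_basis`). That group is
never computed. It is shown to be finitely generated by replacing simplices with affine ones whose
vertices lie in a finite net, and freeness after twisting is automatic because the coefficients
contain the field `F`. -/

noncomputable section

namespace TwistedNovikov

/-! ### Singular chains as free abelian groups on simplices -/

/-- Singular simplices. -/
abbrev Sx (n : ℕ) (E : Type v) [TopologicalSpace E] : Type v := C(stdSimplex ℝ (Fin (n + 1)), E)

/-- Singular chains as finitely supported functions on singular simplices. -/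
abbrev SC (n : ℕ) (E : Type v) [TopologicalSpace E] : Type v := Sx n E →₀ ℤ

/-- The `i`-th face inclusion of the standard simplex. -/
def faceMap (n : ℕ) (i : Fin (n + 2)) :
    C(stdSimplex ℝ (Fin (n + 1)), stdSimplex ℝ (Fin (n + 2))) :=
  ⟨stdSimplex.map i.succAbove, stdSimplex.continuous_map _⟩

section
variable {E : Type v} [TopologicalSpace E]

/-- The boundary of singular chains. -/
def sbd (n : ℕ) : SC (n + 1) E →ₗ[ℤ] SC n E :=
  Finsupp.linearCombination ℤ fun σ => ∑ i : Fin (n + 2), (-1 : ℤ) ^ (i : ℕ) •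
    Finsupp.single (σ.comp (faceMap n i)) 1

theorem sbd_single (n : ℕ) (σ : Sx (n + 1) E) : sbd n (Finsupp.single σ 1) =
    ∑ i : Fin (n + 2), (-1 : ℤ) ^ (i : ℕ) • Finsupp.single (σ.comp (faceMap n i)) 1 := by
  simp [sbd]

/-- Push-forward of singular chains. -/
def spush {E' : Type w} [TopologicalSpace E'] (f : C(E, E')) (n : ℕ) : SC n E →ₗ[ℤ] SC n E' :=
  Finsupp.lmapDomain ℤ ℤ fun σ => f.comp σ

theorem spush_single {E' : Type w} [TopologicalSpace E'] (f : C(E, E')) (n : ℕ) (σ : Sx n E)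
    (a : ℤ) : spush f n (Finsupp.single σ a) = Finsupp.single (f.comp σ) a := by
  simp [spush]

/-- Singular simplices in the sense of simplicial sets. -/
def sxEquiv (n : ℕ) (E : Type v) [TopologicalSpace E] :
    (TopCat.toSSet.obj (TopCat.of E)).obj (Opposite.op (SimplexCategory.mk n)) ≃ Sx n E :=
  TopCat.toSSetObjEquiv (TopCat.of E) _

abbrev Zv : AddCommGrpCat.{v} := AddCommGrpCat.of (ULift.{v} ℤ)

def chainFwd (n : ℕ) (E : Type v) [TopologicalSpace E] :
    (singChains E).X n ⟶ AddCommGrpCat.of (SC n E) :=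
  ((TopCat.toSSet.obj (TopCat.of E)).isColimitChainComplexXCofan Zv n).desc
    (Limits.Cofan.mk _ fun x => AddCommGrpCat.ofHom
      ((Finsupp.singleAddHom (sxEquiv n E x)).comp AddEquiv.ulift.toAddMonoidHom))

abbrev iotaS {n : ℕ}
    (x : (TopCat.toSSet.obj (TopCat.of E)).obj (Opposite.op (SimplexCategory.mk n))) :
    Zv ⟶ (singChains E).X n := (TopCat.toSSet.obj (TopCat.of E)).ιChainComplex x

theorem iota_chainFwd {n : ℕ} (x) : iotaS (E := E) (n := n) x ≫ chainFwd n E = AddCommGrpCat.ofHom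
      ((Finsupp.singleAddHom (sxEquiv n E x)).comp AddEquiv.ulift.toAddMonoidHom) :=
  ((TopCat.toSSet.obj (TopCat.of E)).isColimitChainComplexXCofan Zv n).fac _ ⟨x⟩

def sgen {n : ℕ} (σ : Sx n E) : (singChains E).X n :=
  (iotaS ((sxEquiv n E).symm σ)).hom (ULift.up 1)

theorem chainFwd_sgen {n : ℕ} (σ : Sx n E) : (chainFwd n E).hom (sgen σ) = Finsupp.single σ 1 := by
  refine (congrArg (fun m => m.hom (ULift.up 1)) (iota_chainFwd ((sxEquiv n E).symm σ))).trans ?_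
  change Finsupp.single ((sxEquiv n E) ((sxEquiv n E).symm σ)) (1 : ℤ) = _
  rw [Equiv.apply_symm_apply]

def chainBwd (n : ℕ) (E : Type v) [TopologicalSpace E] : SC n E →+ (singChains E).X n :=
  (Finsupp.lift ((singChains E).X n) ℤ (Sx n E) sgen).toAddMonoidHom

theorem chainBwd_single {n : ℕ} (σ : Sx n E) : chainBwd n E (Finsupp.single σ 1) = sgen σ := by
  simp [chainBwd]

/-- The chain group is a coproduct of copies of `ULift ℤ` indexed by simplices, and each copy is
generated by `1`. Comparisons with the concrete operators therefore reduce to single simplices. -/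
theorem hom_ext_sgen {n : ℕ} {A : Type v} [AddCommGroup A] {f g : (singChains E).X n →+ A}
    (h : ∀ σ : Sx n E, f (sgen σ) = g (sgen σ)) : f = g := by
  have : AddCommGrpCat.ofHom f = AddCommGrpCat.ofHom g := by
    refine SSet.chainComplex_hom_ext (fun x => ?_)
    refine AddCommGrpCat.hom_ext ?_
    have h1 := h (sxEquiv n E x)
    rw [sgen, Equiv.symm_apply_apply] at h1
    refine DFunLike.ext _ _ fun y => ?_
    have e : y = ULift.down y • (ULift.up 1 : ULift.{v} ℤ) := ULift.ext _ _ (by simp)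
    rw [e, map_zsmul, map_zsmul]
    exact congrArg _ h1
  exact congrArg (fun m => m.hom) this

/-- Singular chains as finitely supported functions. -/
def chainEquiv (n : ℕ) (E : Type v) [TopologicalSpace E] : (singChains E).X n ≃+ SC n E :=
  AddMonoidHom.toAddEquiv (chainFwd n E).hom (chainBwd n E)
    (hom_ext_sgen fun σ =>
      (congrArg (chainBwd n E) (chainFwd_sgen σ)).trans (chainBwd_single σ))
    (Finsupp.addHom_ext' fun σ => AddMonoidHom.ext_int
      ((congrArg (chainFwd n E).hom (chainBwd_single σ)).trans (chainFwd_sgen σ)))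

@[simp] theorem chainEquiv_sgen {n : ℕ} (σ : Sx n E) :
    chainEquiv n E (sgen σ) = Finsupp.single σ 1 := chainFwd_sgen σ

theorem bd_sgen {n : ℕ} (σ : Sx (n + 1) E) :
    bd E (n + 1) n (sgen σ) =
      ∑ i : Fin (n + 2), (-1 : ℤ) ^ (i : ℕ) • sgen (σ.comp (faceMap n i)) := by
  have := congrArg (fun m => m.hom (ULift.up 1)) (SSet.ιChainComplex_d (R := Zv)
    (X := TopCat.toSSet.obj (TopCat.of E)) ((sxEquiv _ E).symm σ))
  have h2 : ∀ i : Fin (n+2), (TopCat.toSSet.obj (TopCat.of E)).δ i ((sxEquiv _ E).symm σ) =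
    (sxEquiv _ E).symm (σ.comp (faceMap n i)) := fun i => rfl
  refine this.trans ?_
  simp only [h2]
  have h3 : ∀ (s : Finset (Fin (n + 2))) (f : Fin (n + 2) → (Zv ⟶ (singChains E).X n)),
      (∑ i ∈ s, f i).hom (ULift.up 1) = ∑ i ∈ s, (f i).hom (ULift.up 1) := fun s f =>
    map_sum (((AddMonoidHom.eval (ULift.up 1)).comp
      (AddCommGrpCat.homAddEquiv (M := Zv) (N := (singChains E).X n)).toAddMonoidHom)) f s
  exact h3 _ _

theorem push_sgen {E' : Type v} [TopologicalSpace E'] (f : C(E, E')) {n : ℕ} (σ : Sx n E) :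
    push f n (sgen σ) = sgen (f.comp σ) := by
  exact congrArg (fun m : Zv ⟶ (singChains E').X n => m.hom (ULift.up 1))
    (SSet.ι_chainComplexMap_f (R := Zv) _ _ (TopCat.toSSet.map (TopCat.ofHom f))
      ((sxEquiv _ E).symm σ))

theorem chainEquiv_bd (n : ℕ) (c : (singChains E).X (n + 1)) :
    chainEquiv n E (bd E (n + 1) n c) = sbd n (chainEquiv (n + 1) E c) := by
  have : ((chainEquiv n E).toAddMonoidHom.comp (bd E (n + 1) n)) =
      (sbd n).toAddMonoidHom.comp (chainEquiv (n + 1) E).toAddMonoidHom :=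
    hom_ext_sgen fun σ => by simp [bd_sgen, sbd]
  exact DFunLike.congr_fun this c

theorem chainEquiv_push {E' : Type v} [TopologicalSpace E'] (f : C(E, E')) (n : ℕ)
    (c : (singChains E).X n) :
    chainEquiv n E' (push f n c) = spush f n (chainEquiv n E c) := by
  have : ((chainEquiv n E').toAddMonoidHom.comp (push f n)) =
      (spush f n).toAddMonoidHom.comp (chainEquiv n E).toAddMonoidHom :=
    hom_ext_sgen fun σ => by simp [push_sgen, spush]
  exact DFunLike.congr_fun this c

end

theorem linearMap_ext_single {α M : Type*} [AddCommGroup M] {f g : (α →₀ ℤ) →ₗ[ℤ] M}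
    (h : ∀ a, f (Finsupp.single a 1) = g (Finsupp.single a 1)) : f = g :=
  Finsupp.lhom_ext' fun a => LinearMap.ext_ring (h a)

/-- The pointwise form lets an identity between chain operators be proved by naming both sides as
linear maps and checking one generator. -/
theorem linear_ext_single {α M : Type*} [AddCommGroup M] (f g : (α →₀ ℤ) →ₗ[ℤ] M)
    (h : ∀ a, f (Finsupp.single a 1) = g (Finsupp.single a 1)) (c : α →₀ ℤ) : f c = g c := by
  rw [linearMap_ext_single h]

section SingularNat

variable {E : Type u} {E' : Type v} {E'' : Type w} [TopologicalSpace E] [TopologicalSpace E']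
  [TopologicalSpace E'']

theorem spush_comp (f : C(E, E')) (g : C(E', E'')) (n : ℕ) (c : SC n E) :
    spush (g.comp f) n c = spush g n (spush f n c) :=
  linear_ext_single (spush (g.comp f) n) (spush g n ∘ₗ spush f n)
    (fun σ => by simp [spush_single, ContinuousMap.comp_assoc]) c

theorem spush_id (n : ℕ) (c : SC n E) : spush (ContinuousMap.id E) n c = c :=
  linear_ext_single (spush (ContinuousMap.id E) n) LinearMap.id
    (fun σ => by simp [spush_single]) c

theorem sbd_spush (f : C(E, E')) (n : ℕ) (c : SC (n + 1) E) :
    sbd n (spush f (n + 1) c) = spush f n (sbd n c) :=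
  linear_ext_single (sbd n ∘ₗ spush f (n + 1)) (spush f n ∘ₗ sbd n)
    (fun σ => by simp [spush_single, sbd_single, ContinuousMap.comp_assoc]) c

end SingularNat

/-! ### Chains of ordered tuples -/

section Tuples

/-- Chains of ordered tuples of points of `Y`. -/
abbrev LC (n : ℕ) (Y : Type v) : Type v := (Fin (n + 1) → Y) →₀ ℤ

variable {Y : Type u} {Z : Type v}

def lbd (n : ℕ) : LC (n + 1) Y →ₗ[ℤ] LC n Y :=
  Finsupp.linearCombination ℤ fun p => ∑ i : Fin (n + 2), (-1 : ℤ) ^ (i : ℕ) •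
    Finsupp.single (p ∘ i.succAbove) 1

theorem lbd_single (n : ℕ) (p : Fin (n + 2) → Y) : lbd n (Finsupp.single p 1) =
    ∑ i : Fin (n + 2), (-1 : ℤ) ^ (i : ℕ) • Finsupp.single (p ∘ i.succAbove) 1 := by
  simp [lbd]

/-- The map of chains of tuples induced by a map of sets. -/
def lmap (f : Y → Z) (n : ℕ) : LC n Y →ₗ[ℤ] LC n Z := Finsupp.lmapDomain ℤ ℤ fun p => f ∘ p

theorem lmap_single (f : Y → Z) (n : ℕ) (p : Fin (n + 1) → Y) (a : ℤ) :
    lmap f n (Finsupp.single p a) = Finsupp.single (f ∘ p) a := by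
  simp [lmap]

theorem lbd_lmap (f : Y → Z) (n : ℕ) (c : LC (n + 1) Y) :
    lbd n (lmap f (n + 1) c) = lmap f n (lbd n c) :=
  linear_ext_single (lbd n ∘ₗ lmap f (n + 1)) (lmap f n ∘ₗ lbd n)
    (fun p => by simp [lmap_single, lbd_single, Function.comp_assoc]) c

/-- The cone operator. -/
def cone (b : Y) (n : ℕ) : LC n Y →ₗ[ℤ] LC (n + 1) Y :=
  Finsupp.lmapDomain ℤ ℤ fun p => (Fin.cons b p : Fin (n + 2) → Y)

theorem cone_single (b : Y) (n : ℕ) (p : Fin (n + 1) → Y) (a : ℤ) :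
    cone b n (Finsupp.single p a) = Finsupp.single (Fin.cons b p : Fin (n + 2) → Y) a := by
  simp [cone]

theorem lmap_cone (f : Y → Z) (b : Y) (n : ℕ) (c : LC n Y) :
    lmap f (n + 1) (cone b n c) = cone (f b) n (lmap f n c) :=
  linear_ext_single (lmap f (n + 1) ∘ₗ cone b n) (cone (f b) n ∘ₗ lmap f n)
    (fun p => by
      have : f ∘ (Fin.cons b p : Fin (n + 2) → Y) = (Fin.cons (f b) (f ∘ p) : Fin (n + 2) → Z) := by
        funext i
        refine Fin.cases ?_ (fun j => ?_) i <;> simp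
      simp [lmap_single, cone_single, this]) c

/-- The augmentation. -/
def aug : LC 0 Y →ₗ[ℤ] ℤ := Finsupp.linearCombination ℤ fun _ => 1

theorem aug_single (p : Fin 1 → Y) : aug (Finsupp.single p 1) = 1 := by simp [aug]

theorem aug_lbd (c : LC 1 Y) : aug (lbd 0 c) = 0 :=
  linear_ext_single (aug ∘ₗ lbd 0) 0 (fun p => by
    simp [lbd_single, aug_single, Fin.sum_univ_two]) c

theorem aug_lmap (f : Y → Z) (c : LC 0 Y) : aug (lmap f 0 c) = aug c :=
  linear_ext_single (aug ∘ₗ lmap f 0) aug (fun p => by simp [lmap_single, aug_single]) c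

/-- Face `0` of a cone is its base, and face `i + 1` is the cone over face `i` of the base, with the
opposite sign. -/
theorem lbd_cone (b : Y) (n : ℕ) (c : LC (n + 1) Y) :
    lbd (n + 1) (cone b (n + 1) c) = c - cone b n (lbd n c) :=
  linear_ext_single (lbd (n + 1) ∘ₗ cone b (n + 1)) (LinearMap.id - cone b n ∘ₗ lbd n)
    (fun p => by
      have h : ∀ i : Fin (n + 2), (Fin.cons b p : Fin (n + 3) → Y) ∘ i.succ.succAbove =
          (Fin.cons b (p ∘ i.succAbove) : Fin (n + 2) → Y) := by
        intro i
        funext j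
        refine Fin.cases ?_ (fun j => ?_) j <;> simp
      have h0 : (Fin.cons b p : Fin (n + 3) → Y) ∘ (0 : Fin (n + 3)).succAbove = p := by
        funext j
        simp
      simp only [LinearMap.comp_apply, LinearMap.sub_apply, LinearMap.id_apply, cone_single,
        lbd_single, Fin.sum_univ_succ (n := n + 2), h, h0, map_sum, map_zsmul]
      simp [pow_succ, sub_eq_add_neg]) c

/-- In the lowest degree the base has no faces to cone off; the second end of each edge is the apex,
which is counted by the augmentation. -/
theorem lbd_cone_zero (b : Y) (c : LC 0 Y) :
    lbd 0 (cone b 0 c) = c - aug c • Finsupp.single (fun _ => b) 1 :=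
  linear_ext_single (lbd 0 ∘ₗ cone b 0)
    (LinearMap.id - LinearMap.toSpanSingleton ℤ _ (Finsupp.single (fun _ => b) 1) ∘ₗ aug)
    (fun p => by
      have h1 : (Fin.cons b p : Fin 2 → Y) ∘ (1 : Fin 2).succAbove = fun _ => b := by
        funext j
        fin_cases j
        rfl
      have h0 : (Fin.cons b p : Fin 2 → Y) ∘ (0 : Fin 2).succAbove = p := by
        funext j
        simp
      simp only [LinearMap.comp_apply, LinearMap.sub_apply, LinearMap.id_apply, cone_single,
        lbd_single, aug_single, LinearMap.toSpanSingleton_apply]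
      rw [Fin.sum_univ_two, h0, h1]
      simp [sub_eq_add_neg]) c

/-- Every tuple is the cone over its tail with apex its first entry, so the cone formula lowers the
degree. -/
theorem lbd_lbd (n : ℕ) (c : LC (n + 2) Y) : lbd n (lbd (n + 1) c) = 0 := by
  induction n with
  | zero =>
    refine linear_ext_single (lbd 0 ∘ₗ lbd 1) 0 (fun p => ?_) c
    rw [← Fin.cons_self_tail p, ← cone_single]
    simp only [LinearMap.comp_apply, lbd_cone, map_sub, lbd_cone_zero, aug_lbd]
    simp
  | succ n ih =>
    refine linear_ext_single (lbd (n + 1) ∘ₗ lbd (n + 2)) 0 (fun p => ?_) c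
    rw [← Fin.cons_self_tail p, ← cone_single]
    simp only [LinearMap.comp_apply, lbd_cone, map_sub, ih]
    simp

/-- The chain homotopy between two augmentation preserving chain maps, built by coning off. -/
def coneHtpy (F G : ∀ n, LC n Y →ₗ[ℤ] LC n Z) (b : ∀ n, (Fin (n + 1) → Y) → Z) :
    ∀ n, LC n Y →ₗ[ℤ] LC (n + 1) Z
  | 0 => Finsupp.linearCombination ℤ fun p =>
      cone (b 0 p) 0 (F 0 (Finsupp.single p 1) - G 0 (Finsupp.single p 1))
  | n + 1 => Finsupp.linearCombination ℤ fun p =>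
      cone (b (n + 1) p) (n + 1) (F (n + 1) (Finsupp.single p 1) - G (n + 1) (Finsupp.single p 1) -
        coneHtpy F G b n (lbd n (Finsupp.single p 1)))

section

variable (F G : ∀ n, LC n Y →ₗ[ℤ] LC n Z) (b : ∀ n, (Fin (n + 1) → Y) → Z)

theorem coneHtpy_zero_single (p : Fin 1 → Y) : coneHtpy F G b 0 (Finsupp.single p 1) =
    cone (b 0 p) 0 (F 0 (Finsupp.single p 1) - G 0 (Finsupp.single p 1)) := by
  simp [coneHtpy]

theorem coneHtpy_succ_single (n : ℕ) (p : Fin (n + 2) → Y) :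
    coneHtpy F G b (n + 1) (Finsupp.single p 1) =
    cone (b (n + 1) p) (n + 1) (F (n + 1) (Finsupp.single p 1) - G (n + 1) (Finsupp.single p 1) -
        coneHtpy F G b n (lbd n (Finsupp.single p 1))) := by
  rw [coneHtpy]
  simp

variable {F G}

theorem lbd_coneHtpy_zero (h : ∀ c, aug (F 0 c) = aug (G 0 c)) (c : LC 0 Y) :
    lbd 0 (coneHtpy F G b 0 c) = F 0 c - G 0 c :=
  linear_ext_single (lbd 0 ∘ₗ coneHtpy F G b 0) (F 0 - G 0) (fun p => by
    simp [coneHtpy_zero_single, lbd_cone_zero, h, -map_sub, map_sub aug]) c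

/-- By induction the chain that is coned off, `F - G` minus the homotopy of the boundary, is a
cycle, so the boundary of its cone is that chain itself. The apexes are arbitrary; equal
augmentations start the induction. -/
theorem lbd_coneHtpy (h : ∀ c, aug (F 0 c) = aug (G 0 c))
    (hF : ∀ n c, lbd n (F (n + 1) c) = F n (lbd n c))
    (hG : ∀ n c, lbd n (G (n + 1) c) = G n (lbd n c)) (n : ℕ) (c : LC (n + 1) Y) :
    lbd (n + 1) (coneHtpy F G b (n + 1) c) =
      F (n + 1) c - G (n + 1) c - coneHtpy F G b n (lbd n c) := by
  induction n with
  | zero =>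
    refine linear_ext_single (lbd 1 ∘ₗ coneHtpy F G b 1)
      (F 1 - G 1 - coneHtpy F G b 0 ∘ₗ lbd 0) (fun p => ?_) c
    simp only [LinearMap.comp_apply, LinearMap.sub_apply, coneHtpy_succ_single, lbd_cone, map_sub,
      lbd_coneHtpy_zero b h, hF, hG]
    abel
  | succ n ih =>
    refine linear_ext_single (lbd (n + 2) ∘ₗ coneHtpy F G b (n + 2))
      (F (n + 2) - G (n + 2) - coneHtpy F G b (n + 1) ∘ₗ lbd (n + 1)) (fun p => ?_) c
    simp only [LinearMap.comp_apply, LinearMap.sub_apply, coneHtpy_succ_single, lbd_cone, map_sub,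
      ih, hF, hG, lbd_lbd, map_zero]
    abel

theorem coneHtpy_natural {Y' : Type*} {Z' : Type*} {F' G' : ∀ n, LC n Y' →ₗ[ℤ] LC n Z'}
    {b' : ∀ n, (Fin (n + 1) → Y') → Z'} (f : Y → Y') (g : Z → Z')
    (hF : ∀ n c, F' n (lmap f n c) = lmap g n (F n c))
    (hG : ∀ n c, G' n (lmap f n c) = lmap g n (G n c))
    (hb : ∀ n p, b' n (f ∘ p) = g (b n p)) (n : ℕ) (c : LC n Y) :
    coneHtpy F' G' b' n (lmap f n c) = lmap g (n + 1) (coneHtpy F G b n c) := by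
  induction n with
  | zero =>
    refine linear_ext_single (coneHtpy F' G' b' 0 ∘ₗ lmap f 0) (lmap g 1 ∘ₗ coneHtpy F G b 0)
      (fun p => ?_) c
    simp only [LinearMap.comp_apply, lmap_single, coneHtpy_zero_single, lmap_cone, map_sub, hb,
      ← hF, ← hG]
  | succ n ih =>
    refine linear_ext_single (coneHtpy F' G' b' (n + 1) ∘ₗ lmap f (n + 1))
      (lmap g (n + 2) ∘ₗ coneHtpy F G b (n + 1)) (fun p => ?_) c
    simp only [LinearMap.comp_apply, lmap_single, coneHtpy_succ_single, lmap_cone, map_sub, hb,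
      ← hF, ← hG, ← ih, ← lbd_lmap]

end

/-- The subdivision operator determined by a choice of barycentres. -/
def lsd (b : ∀ n, (Fin (n + 1) → Y) → Y) : ∀ n, LC n Y →ₗ[ℤ] LC n Y
  | 0 => LinearMap.id
  | n + 1 => Finsupp.linearCombination ℤ fun p =>
      cone (b (n + 1) p) n (lsd b n (lbd n (Finsupp.single p 1)))

section

variable (b : ∀ n, (Fin (n + 1) → Y) → Y)

theorem lsd_succ_single (n : ℕ) (p : Fin (n + 2) → Y) : lsd b (n + 1) (Finsupp.single p 1) =
    cone (b (n + 1) p) n (lsd b n (lbd n (Finsupp.single p 1))) := by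
  rw [lsd]
  simp

/-- The subdivided boundary is a cycle by induction, so coning it off gives it back as boundary. In
degree one the apex term disappears because a boundary has augmentation zero. -/
theorem lbd_lsd (n : ℕ) (c : LC (n + 1) Y) : lbd n (lsd b (n + 1) c) = lsd b n (lbd n c) := by
  induction n with
  | zero =>
    refine linear_ext_single (lbd 0 ∘ₗ lsd b 1) (lsd b 0 ∘ₗ lbd 0) (fun p => ?_) c
    simp only [LinearMap.comp_apply, lsd_succ_single, lbd_cone_zero]
    simp [lsd, aug_lbd]
  | succ n ih =>
    refine linear_ext_single (lbd (n + 1) ∘ₗ lsd b (n + 2)) (lsd b (n + 1) ∘ₗ lbd (n + 1))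
      (fun p => ?_) c
    simp only [LinearMap.comp_apply, lsd_succ_single, lbd_cone, ih, lbd_lbd]
    simp

theorem lsd_natural {Y' : Type*} {b' : ∀ n, (Fin (n + 1) → Y') → Y'} (f : Y → Y')
    (hb : ∀ n p, b' n (f ∘ p) = f (b n p)) (n : ℕ) (c : LC n Y) :
    lsd b' n (lmap f n c) = lmap f n (lsd b n c) := by
  induction n with
  | zero => rfl
  | succ n ih =>
    refine linear_ext_single (lsd b' (n + 1) ∘ₗ lmap f (n + 1)) (lmap f (n + 1) ∘ₗ lsd b (n + 1))
      (fun p => ?_) c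
    simp only [LinearMap.comp_apply, lmap_single, lsd_succ_single, lmap_cone, hb, ← ih, ← lbd_lmap]

end

end Tuples

/-! ### Affine simplices in a convex set -/

section Affine

variable {V : Type u} [AddCommGroup V] [Module ℝ V] [TopologicalSpace V] [ContinuousAdd V]
  [ContinuousSMul ℝ V] {K : Set V}

/-- The affine singular simplex of a convex set with given vertices. -/
def affSx (hK : Convex ℝ K) {n : ℕ} (p : Fin (n + 1) → K) : Sx n K :=
  ⟨fun x => ⟨∑ i, x i • (p i : V),
    hK.sum_mem (fun i _ => x.2.1 i) x.2.2 (fun i _ => (p i).2)⟩, by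
    refine Continuous.subtype_mk (continuous_finsetSum _ fun i _ => ?_) _
    exact (((continuous_apply i).comp continuous_subtype_val).smul continuous_const)⟩

theorem affSx_apply (hK : Convex ℝ K) {n : ℕ} (p : Fin (n + 1) → K)
    (x : stdSimplex ℝ (Fin (n + 1))) : (affSx hK p x : V) = ∑ i, x i • (p i : V) := rfl

theorem stdSimplex_sum_map {X Y : Type*} [Fintype X] [Fintype Y] {W : Type*}
    [AddCommGroup W] [Module ℝ W]
    (f : X → Y) (x : stdSimplex ℝ X) (q : Y → W) :
    ∑ j, stdSimplex.map f x j • q j = ∑ i, x i • q (f i) := by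
  classical
  have h : ∀ j, stdSimplex.map f x j = ∑ i with f i = j, x i := fun j => by
    rw [stdSimplex.map_coe, FunOnFinite.linearMap_apply_apply]
  simp only [h, Finset.sum_smul]
  rw [← Finset.sum_fiberwise (s := Finset.univ) (g := f)]
  refine Finset.sum_congr rfl fun j _ => Finset.sum_congr rfl fun i hi => ?_
  rw [(Finset.mem_filter.1 hi).2]

theorem affSx_comp_faceMap (hK : Convex ℝ K) {n : ℕ} (p : Fin (n + 2) → K) (i : Fin (n + 2)) :
    (affSx hK p).comp (faceMap n i) = affSx hK (p ∘ i.succAbove) := by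
  ext x
  exact stdSimplex_sum_map i.succAbove x fun j => (p j : V)

/-- The singular chain of a chain of tuples. -/
def realize (hK : Convex ℝ K) (n : ℕ) : LC n K →ₗ[ℤ] SC n K :=
  Finsupp.lmapDomain ℤ ℤ fun p => affSx hK p

theorem realize_single (hK : Convex ℝ K) (n : ℕ) (p : Fin (n + 1) → K) (a : ℤ) :
    realize hK n (Finsupp.single p a) = Finsupp.single (affSx hK p) a := by
  simp [realize]

theorem sbd_realize (hK : Convex ℝ K) (n : ℕ) (c : LC (n + 1) K) :
    sbd n (realize hK (n + 1) c) = realize hK n (lbd n c) :=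
  linear_ext_single (sbd n ∘ₗ realize hK (n + 1)) (realize hK n ∘ₗ lbd n)
    (fun p => by simp [realize_single, sbd_single, lbd_single, affSx_comp_faceMap]) c

/-- The barycentre of a tuple. -/
def bary (hK : Convex ℝ K) (n : ℕ) (p : Fin (n + 1) → K) : K := affSx hK p stdSimplex.barycenter

variable {V' : Type v} [AddCommGroup V'] [Module ℝ V'] [TopologicalSpace V'] [ContinuousAdd V']
  [ContinuousSMul ℝ V'] {K' : Set V'}

/-- A map of convex sets is affine. -/
def IsAffOn (hK : Convex ℝ K) (hK' : Convex ℝ K') (a : C(K, K')) : Prop :=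
  ∀ (n : ℕ) (p : Fin (n + 1) → K), a.comp (affSx hK p) = affSx hK' (a ∘ p)

theorem IsAffOn.spush_realize {hK : Convex ℝ K} {hK' : Convex ℝ K'} {a : C(K, K')}
    (ha : IsAffOn hK hK' a) (n : ℕ) (c : LC n K) :
    spush a n (realize hK n c) = realize hK' n (lmap a n c) :=
  linear_ext_single (spush a n ∘ₗ realize hK n) (realize hK' n ∘ₗ lmap a n)
    (fun p => by simp [realize_single, lmap_single, spush_single, ha n p]) c

theorem IsAffOn.bary {hK : Convex ℝ K} {hK' : Convex ℝ K'} {a : C(K, K')}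
    (ha : IsAffOn hK hK' a) (n : ℕ) (p : Fin (n + 1) → K) :
    bary hK' n (a ∘ p) = a (bary hK n p) :=
  (congrArg (fun f => f stdSimplex.barycenter) (ha n p)).symm

end Affine

/-! ### Models -/

abbrev Dx (n : ℕ) : Set (Fin (n + 1) → ℝ) := stdSimplex ℝ (Fin (n + 1))

theorem convexDx (n : ℕ) : Convex ℝ (Dx n) := convex_stdSimplex ℝ _

/-- The prism. -/
def Prism (n : ℕ) : Set ((Fin (n + 1) → ℝ) × ℝ) := Dx n ×ˢ Set.Icc (0 : ℝ) 1

theorem convexPrism (n : ℕ) : Convex ℝ (Prism n) := (convexDx n).prod (convex_Icc 0 1)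

/-- The tuple of vertices of the standard simplex. -/
def vtx (n : ℕ) : Fin (n + 1) → Dx n := fun i => stdSimplex.vertex i

theorem sum_smul_vtx (n : ℕ) (x : Dx n) :
    ∑ i, x i • ((vtx n i : Dx n) : Fin (n + 1) → ℝ) = (x : Fin (n + 1) → ℝ) := by
  funext j
  simp [vtx, Pi.single_apply]

theorem affSx_vtx (n : ℕ) : affSx (convexDx n) (vtx n) = ContinuousMap.id _ := by
  ext x : 2
  exact sum_smul_vtx n x

theorem faceMap_vtx (n : ℕ) (i : Fin (n + 2)) :
    faceMap n i ∘ vtx n = vtx (n + 1) ∘ i.succAbove := by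
  funext j
  exact stdSimplex.map_vertex _ _

theorem affSx_comp_vtx {V : Type u} [AddCommGroup V] [Module ℝ V] [TopologicalSpace V]
    [ContinuousAdd V] [ContinuousSMul ℝ V] {K : Set V} (hK : Convex ℝ K) {n : ℕ}
    (p : Fin (n + 1) → K) : affSx hK p ∘ vtx n = p := by
  funext j
  ext1
  change ∑ i, (vtx n j) i • (p i : V) = p j
  simp [vtx, Pi.single_apply]

theorem isAffOn_affSx {V : Type u} [AddCommGroup V] [Module ℝ V] [TopologicalSpace V]
    [ContinuousAdd V] [ContinuousSMul ℝ V] {K : Set V} (hK : Convex ℝ K) {n : ℕ}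
    (p : Fin (n + 1) → K) : IsAffOn (convexDx n) hK (affSx hK p) := by
  intro m q
  ext x
  change ∑ i, (∑ j, x j • ((q j : Dx n) : Fin (n + 1) → ℝ)) i • (p i : V) =
    ∑ j, x j • ∑ i, (q j) i • (p i : V)
  simp only [Finset.sum_apply, Finset.sum_smul, Pi.smul_apply, smul_eq_mul, Finset.smul_sum,
    mul_smul]
  exact Finset.sum_comm

theorem faceMap_eq_affSx (n : ℕ) (i : Fin (n + 2)) :
    faceMap n i = affSx (convexDx (n + 1)) (vtx (n + 1) ∘ i.succAbove) := by
  rw [← affSx_comp_faceMap, affSx_vtx, ContinuousMap.id_comp]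

theorem isAffOn_faceMap (n : ℕ) (i : Fin (n + 2)) :
    IsAffOn (convexDx n) (convexDx (n + 1)) (faceMap n i) := by
  rw [faceMap_eq_affSx]
  exact isAffOn_affSx _ _

/-- The slice of the prism at height `t`. -/
def slice (n : ℕ) (t : unitInterval) : C(Dx n, Prism n) :=
  ⟨fun x => ⟨((x : Fin (n + 1) → ℝ), (t : ℝ)), ⟨x.2, t.2⟩⟩, by fun_prop⟩

/-- The face of the prism. -/
def prismFace (n : ℕ) (i : Fin (n + 2)) : C(Prism n, Prism (n + 1)) :=
  ⟨fun z => ⟨(faceMap n i ⟨z.1.1, z.2.1⟩, z.1.2), ⟨(faceMap n i ⟨z.1.1, z.2.1⟩).2, z.2.2⟩⟩, by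
    fun_prop⟩

theorem isAffOn_slice (n : ℕ) (t : unitInterval) :
    IsAffOn (convexDx n) (convexPrism n) (slice n t) := by
  intro m p
  ext1 x
  apply Subtype.ext
  change ((∑ i, x i • ((p i : Dx n) : Fin (n + 1) → ℝ)), (t : ℝ)) =
    ∑ i, x i • (((p i : Dx n) : Fin (n + 1) → ℝ), (t : ℝ))
  ext1
  · simp [Prod.fst_sum]
  · simp [Prod.snd_sum, ← Finset.sum_mul]

theorem isAffOn_prismFace (n : ℕ) (i : Fin (n + 2)) :
    IsAffOn (convexPrism n) (convexPrism (n + 1)) (prismFace n i) := by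
  intro m p
  ext1 x
  apply Subtype.ext
  have h := congrArg (fun f => f x) (isAffOn_faceMap n i m fun j => ⟨(p j).1.1, (p j).2.1⟩)
  have h' := congrArg Subtype.val h
  refine Prod.ext ?_ ?_
  · refine Eq.trans ?_ (h'.trans ?_)
    · change ((faceMap n i _ : Dx (n + 1)) : Fin (n + 2) → ℝ) =
        ((faceMap n i _ : Dx (n + 1)) : Fin (n + 2) → ℝ)
      congr 2
      apply Subtype.ext
      simp [affSx_apply, Prod.fst_sum]
    · simp only [affSx_apply, Prod.fst_sum, Prod.smul_fst]
      rfl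
  · change (affSx (convexPrism n) p x).1.2 = _
    simp only [affSx_apply, Prod.snd_sum, Prod.smul_snd]
    rfl

/-! ### Subdivision -/

section Subdivision

variable {V : Type u} [AddCommGroup V] [Module ℝ V] [TopologicalSpace V] [ContinuousAdd V]
  [ContinuousSMul ℝ V] {K : Set V} (hK : Convex ℝ K)
  {V' : Type w} [AddCommGroup V'] [Module ℝ V'] [TopologicalSpace V'] [ContinuousAdd V']
  [ContinuousSMul ℝ V'] {K' : Set V'} {hK' : Convex ℝ K'}

/-- The subdivision of a chain of tuples. -/
def sdL (n : ℕ) : LC n K →ₗ[ℤ] LC n K := lsd (bary hK) n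

/-- The homotopy between the identity and the subdivision. -/
def tdL (n : ℕ) : LC n K →ₗ[ℤ] LC (n + 1) K :=
  coneHtpy (fun _ => LinearMap.id) (sdL hK) (bary hK) n

theorem lbd_sdL (n : ℕ) (c : LC (n + 1) K) : lbd n (sdL hK (n + 1) c) = sdL hK n (lbd n c) :=
  lbd_lsd _ n c

theorem lbd_tdL_zero (c : LC 0 K) : lbd 0 (tdL hK 0 c) = c - sdL hK 0 c :=
  lbd_coneHtpy_zero (bary hK) (F := fun _ => LinearMap.id) (G := sdL hK) (fun _ => rfl) c

theorem lbd_tdL (n : ℕ) (c : LC (n + 1) K) :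
    lbd (n + 1) (tdL hK (n + 1) c) = c - sdL hK (n + 1) c - tdL hK n (lbd n c) :=
  lbd_coneHtpy (bary hK) (F := fun _ => LinearMap.id) (G := sdL hK) (fun _ => rfl)
    (fun _ _ => rfl) (lbd_sdL hK) n c

variable {hK}

theorem sdL_natural {a : C(K, K')} (ha : IsAffOn hK hK' a) (n : ℕ) (c : LC n K) :
    sdL hK' n (lmap a n c) = lmap a n (sdL hK n c) :=
  lsd_natural (bary hK) a (fun m p => ha.bary m p) n c

theorem tdL_natural {a : C(K, K')} (ha : IsAffOn hK hK' a) (n : ℕ) (c : LC n K) :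
    tdL hK' n (lmap a n c) = lmap a (n + 1) (tdL hK n c) :=
  coneHtpy_natural (bary hK) (F := fun _ => LinearMap.id) (G := sdL hK)
    (F' := fun _ => LinearMap.id) (G' := sdL hK') (b' := bary hK') _ _ (fun _ _ => rfl)
    (sdL_natural ha) (fun m p => ha.bary m p) n c

variable {E : Type v} [TopologicalSpace E]

/-- The barycentric subdivision of singular chains. -/
def sd (n : ℕ) : SC n E →ₗ[ℤ] SC n E :=
  Finsupp.linearCombination ℤ fun σ =>
    spush σ n (realize (convexDx n) n (sdL (convexDx n) n (Finsupp.single (vtx n) 1)))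

/-- The homotopy between the identity and the subdivision. -/
def td (n : ℕ) : SC n E →ₗ[ℤ] SC (n + 1) E :=
  Finsupp.linearCombination ℤ fun σ =>
    spush σ (n + 1) (realize (convexDx n) (n + 1) (tdL (convexDx n) n (Finsupp.single (vtx n) 1)))

theorem sd_single (n : ℕ) (σ : Sx n E) : sd n (Finsupp.single σ 1) =
    spush σ n (realize (convexDx n) n (sdL (convexDx n) n (Finsupp.single (vtx n) 1))) := by
  simp [sd]

theorem td_single (n : ℕ) (σ : Sx n E) : td n (Finsupp.single σ 1) =
    spush σ (n + 1)
      (realize (convexDx n) (n + 1) (tdL (convexDx n) n (Finsupp.single (vtx n) 1))) := by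
  simp [td]

theorem lbd_vtx (n : ℕ) : lbd n (Finsupp.single (vtx (n + 1)) 1) =
    ∑ i : Fin (n + 2), (-1 : ℤ) ^ (i : ℕ) • lmap (faceMap n i) n (Finsupp.single (vtx n) 1) := by
  simp only [lbd_single, lmap_single, faceMap_vtx]

/-- The subdivision of `σ` is the image under `σ` of the subdivided tautological simplex. Face
inclusions are affine, so naturality reduces the claim to chains of tuples. -/
theorem sbd_sd (n : ℕ) (c : SC (n + 1) E) : sbd n (sd (n + 1) c) = sd n (sbd n c) := by
  refine linear_ext_single (sbd n ∘ₗ sd (n + 1)) (sd n ∘ₗ sbd n) (fun σ => ?_) c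
  simp only [LinearMap.comp_apply, sd_single, sbd_spush, sbd_realize, lbd_sdL, lbd_vtx, map_sum,
    map_zsmul, sbd_single, sdL_natural (isAffOn_faceMap n _),
    ← (isAffOn_faceMap n _).spush_realize, spush_comp]

theorem sbd_td_zero (c : SC 0 E) : sbd 0 (td 0 c) = c - sd 0 c := by
  refine linear_ext_single (sbd 0 ∘ₗ td 0) (LinearMap.id - sd 0) (fun σ => ?_) c
  simp only [LinearMap.comp_apply, LinearMap.sub_apply, LinearMap.id_apply, sd_single, td_single,
    sbd_spush, sbd_realize]
  rw [lbd_tdL_zero]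
  simp [realize_single, affSx_vtx, spush_single]

theorem sbd_td (n : ℕ) (c : SC (n + 1) E) :
    sbd (n + 1) (td (n + 1) c) = c - sd (n + 1) c - td n (sbd n c) := by
  refine linear_ext_single (sbd (n + 1) ∘ₗ td (n + 1))
    (LinearMap.id - sd (n + 1) - td n ∘ₗ sbd n) (fun σ => ?_) c
  simp only [LinearMap.comp_apply, LinearMap.sub_apply, LinearMap.id_apply, sd_single, td_single,
    sbd_spush, sbd_realize]
  rw [lbd_tdL]
  simp only [map_sub, lbd_vtx, map_sum, map_zsmul, tdL_natural (isAffOn_faceMap n _),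
    ← (isAffOn_faceMap n _).spush_realize, sbd_single, td_single, spush_comp]
  simp [realize_single, affSx_vtx, spush_single]

theorem sd_spush {E' : Type w} [TopologicalSpace E'] (f : C(E, E')) (n : ℕ) (c : SC n E) :
    sd n (spush f n c) = spush f n (sd n c) :=
  linear_ext_single (sd n ∘ₗ spush f n) (spush f n ∘ₗ sd n)
    (fun σ => by simp [spush_single, sd_single, spush_comp]) c

/-- This moves iterated subdivision to the level of tuples, where the size of a simplex is the
largest distance between its vertices. -/
theorem sd_realize (hK : Convex ℝ K) (n : ℕ) (c : LC n K) :
    sd n (realize hK n c) = realize hK n (sdL hK n c) := by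
  refine linear_ext_single (sd n ∘ₗ realize hK n) (realize hK n ∘ₗ sdL hK n) (fun p => ?_) c
  simp only [LinearMap.comp_apply, realize_single, sd_single]
  rw [(isAffOn_affSx hK p).spush_realize,
    ← sdL_natural (isAffOn_affSx hK p), lmap_single,
    affSx_comp_vtx]

end Subdivision

/-! ### The prism operator -/

section PrismOp

/-- The prism operator on tuples. -/
def prismL (n : ℕ) : LC n (Dx n) →ₗ[ℤ] LC (n + 1) (Prism n) :=
  coneHtpy (lmap (slice n 1)) (lmap (slice n 0))
    (fun m p => slice n 0 (bary (convexDx n) m p)) n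

variable {E : Type u} {E' : Type v} [TopologicalSpace E] [TopologicalSpace E']

/-- The operator on chains determined by a family of homotopies, one for every simplex. -/
def prismOp (F : ∀ n, Sx n E → C(Prism n, E')) (n : ℕ) : SC n E →ₗ[ℤ] SC (n + 1) E' :=
  Finsupp.linearCombination ℤ fun σ =>
    spush (F n σ) (n + 1) (realize (convexPrism n) (n + 1) (prismL n (Finsupp.single (vtx n) 1)))

/-- The end of a family of homotopies. -/
def prismEnd (F : ∀ n, Sx n E → C(Prism n, E')) (t : unitInterval) (n : ℕ) :
    SC n E →ₗ[ℤ] SC n E' :=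
  Finsupp.lmapDomain ℤ ℤ fun σ => (F n σ).comp (slice n t)

variable (F : ∀ n, Sx n E → C(Prism n, E'))

theorem prismOp_single (n : ℕ) (σ : Sx n E) : prismOp F n (Finsupp.single σ 1) =
    spush (F n σ) (n + 1)
      (realize (convexPrism n) (n + 1) (prismL n (Finsupp.single (vtx n) 1))) := by
  simp [prismOp]

theorem prismEnd_single (t : unitInterval) (n : ℕ) (σ : Sx n E) (a : ℤ) :
    prismEnd F t n (Finsupp.single σ a) = Finsupp.single ((F n σ).comp (slice n t)) a := by
  simp [prismEnd]

theorem realize_slice (t : unitInterval) (n : ℕ) (G : C(Prism n, E')) :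
    spush G n (realize (convexPrism n) n (lmap (slice n t) n (Finsupp.single (vtx n) 1))) =
      Finsupp.single (G.comp (slice n t)) 1 := by
  rw [← (isAffOn_slice n t).spush_realize]
  simp [realize_single, affSx_vtx, spush_single]

theorem sbd_prismOp_zero (c : SC 0 E) :
    sbd 0 (prismOp F 0 c) = prismEnd F 1 0 c - prismEnd F 0 0 c := by
  refine linear_ext_single (sbd 0 ∘ₗ prismOp F 0) (prismEnd F 1 0 - prismEnd F 0 0)
    (fun σ => ?_) c
  simp only [LinearMap.comp_apply, LinearMap.sub_apply, prismOp_single, sbd_spush, sbd_realize,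
    prismL]
  rw [lbd_coneHtpy_zero _ (fun c => by rw [aug_lmap, aug_lmap])]
  simp only [map_sub, realize_slice, prismEnd_single]

/-- The homotopies need only be compatible with faces; they need not come from one homotopy of
spaces. This generality is needed for straightening, where the homotopy depends on the vertices of
each simplex. -/
theorem sbd_prismOp (hF : ∀ n (σ : Sx (n + 1) E) i,
    F n (σ.comp (faceMap n i)) = (F (n + 1) σ).comp (prismFace n i)) (n : ℕ) (c : SC (n + 1) E) :
    sbd (n + 1) (prismOp F (n + 1) c) =
      prismEnd F 1 (n + 1) c - prismEnd F 0 (n + 1) c - prismOp F n (sbd n c) := by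
  refine linear_ext_single (sbd (n + 1) ∘ₗ prismOp F (n + 1))
    (prismEnd F 1 (n + 1) - prismEnd F 0 (n + 1) - prismOp F n ∘ₗ sbd n) (fun σ => ?_) c
  -- The prism over a face is the corresponding face of the prism, because its apex, the barycentre
  -- in the bottom slice, is natural for the affine face inclusion.
  have hn : ∀ i, coneHtpy (lmap (slice (n + 1) 1)) (lmap (slice (n + 1) 0))
      (fun m p => slice (n + 1) 0 (bary (convexDx (n + 1)) m p)) n
      (lmap (faceMap n i) n (Finsupp.single (vtx n) 1)) =
      lmap (prismFace n i) (n + 1) (prismL n (Finsupp.single (vtx n) 1)) := by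
    intro i
    refine coneHtpy_natural _ _ _ (fun m c => ?_) (fun m c => ?_) (fun m p => ?_) n _
    · exact linear_ext_single (lmap (slice (n + 1) 1) m ∘ₗ lmap (faceMap n i) m)
        (lmap (prismFace n i) m ∘ₗ lmap (slice n 1) m)
        (fun p => by simp only [LinearMap.comp_apply, lmap_single]; rfl) c
    · exact linear_ext_single (lmap (slice (n + 1) 0) m ∘ₗ lmap (faceMap n i) m)
        (lmap (prismFace n i) m ∘ₗ lmap (slice n 0) m)
        (fun p => by simp only [LinearMap.comp_apply, lmap_single]; rfl) c
    · rw [(isAffOn_faceMap n i).bary]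
      rfl
  simp only [LinearMap.comp_apply, LinearMap.sub_apply, prismOp_single, sbd_spush, sbd_realize]
  rw [prismL, lbd_coneHtpy _ (fun c => by rw [aug_lmap, aug_lmap])
    (fun n c => lbd_lmap _ n c) (fun n c => lbd_lmap _ n c)]
  simp only [map_sub, realize_slice, prismEnd_single, lbd_vtx, map_sum, map_zsmul, hn,
    ← (isAffOn_prismFace n _).spush_realize, sbd_single, prismOp_single, hF, spush_comp]

end PrismOp

/-! ### Supports of singular chains -/

section Supports

/-- Nearly every support estimate below is an instance of this: the image is controlled once it is
controlled on the permitted generators. -/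
theorem map_mem_of_supported {α M : Type*} [AddCommGroup M] (L : (α →₀ ℤ) →ₗ[ℤ] M)
    (N : Submodule ℤ M) {s : Set α} (h : ∀ a ∈ s, L (Finsupp.single a 1) ∈ N) {c : α →₀ ℤ}
    (hc : c ∈ Finsupp.supported ℤ ℤ s) : L c ∈ N := by
  rw [Finsupp.supported_eq_span_single] at hc
  have : Submodule.span ℤ ((fun i => Finsupp.single i (1 : ℤ)) '' s) ≤ N.comap L :=
    Submodule.span_le.2 (by rintro _ ⟨a, ha, rfl⟩; exact h a ha)
  exact this hc

variable {E : Type u} [TopologicalSpace E] {E' : Type v} [TopologicalSpace E']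

/-- The singular chains whose simplices lie in `A`. -/
def sIn (A : Set E) (n : ℕ) : Submodule ℤ (SC n E) :=
  Finsupp.supported ℤ ℤ {σ : Sx n E | ∀ x, σ x ∈ A}

/-- The singular chains whose simplices each lie in one of the sets `U i`. -/
def sSmall {ι : Type*} (U : ι → Set E) (n : ℕ) : Submodule ℤ (SC n E) :=
  Finsupp.supported ℤ ℤ {σ : Sx n E | ∃ i, ∀ x, σ x ∈ U i}

theorem single_mem_sIn {A : Set E} {n : ℕ} {σ : Sx n E} (h : ∀ x, σ x ∈ A) (a : ℤ) :
    Finsupp.single σ a ∈ sIn A n := Finsupp.single_mem_supported ℤ a h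

theorem sIn_mono {A B : Set E} (h : A ⊆ B) (n : ℕ) : sIn A n ≤ sIn B n :=
  Finsupp.supported_mono fun _ hσ x => h (hσ x)

theorem sIn_univ (n : ℕ) : sIn (Set.univ : Set E) n = ⊤ := by
  rw [sIn, ← Finsupp.supported_univ]
  congr 1
  ext σ
  simp

theorem spush_mem_sIn {f : C(E, E')} {A : Set E} {B : Set E'} (h : Set.MapsTo f A B) {n : ℕ}
    {c : SC n E} (hc : c ∈ sIn A n) : spush f n c ∈ sIn B n :=
  map_mem_of_supported _ _ (fun σ hσ => by
    rw [spush_single]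
    exact single_mem_sIn (fun x => h (hσ x)) 1) hc

theorem spush_mem_sIn' {f : C(E, E')} {B : Set E'} (h : ∀ x, f x ∈ B) {n : ℕ}
    (c : SC n E) : spush f n c ∈ sIn B n :=
  spush_mem_sIn (A := Set.univ) (fun x _ => h x) (by rw [sIn_univ]; trivial)

theorem sbd_mem_sIn {A : Set E} {n : ℕ} {c : SC (n + 1) E} (hc : c ∈ sIn A (n + 1)) :
    sbd n c ∈ sIn A n :=
  map_mem_of_supported _ _ (fun σ hσ => by
    rw [sbd_single]
    exact Submodule.sum_mem _ fun i _ => Submodule.smul_mem _ _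
      (single_mem_sIn (σ := σ.comp (faceMap n i)) (fun x => hσ _) 1)) hc

theorem sd_mem_sIn {A : Set E} {n : ℕ} {c : SC n E} (hc : c ∈ sIn A n) : sd n c ∈ sIn A n :=
  map_mem_of_supported _ _ (fun σ hσ => by
    rw [sd_single]
    exact spush_mem_sIn' hσ _) hc

theorem td_mem_sIn {A : Set E} {n : ℕ} {c : SC n E} (hc : c ∈ sIn A n) :
    td n c ∈ sIn A (n + 1) :=
  map_mem_of_supported _ _ (fun σ hσ => by
    rw [td_single]
    exact spush_mem_sIn' hσ _) hc

theorem sd_mem_sSmall {ι : Type*} {U : ι → Set E} {n : ℕ} {c : SC n E} (hc : c ∈ sSmall U n) :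
    sd n c ∈ sSmall U n :=
  map_mem_of_supported _ _ (fun σ hσ => by
    obtain ⟨i, hi⟩ := hσ
    rw [sd_single]
    have h : sIn (U i) n ≤ sSmall U n := Finsupp.supported_mono fun τ hτ => ⟨i, hτ⟩
    exact h (spush_mem_sIn' hi _)) hc

theorem exists_spush_eq {f : C(E, E')} (hf : Topology.IsInducing f) {n : ℕ} {c : SC n E'}
    (hc : c ∈ sIn (Set.range f) n) : ∃ b : SC n E, spush f n b = c := by
  have := map_mem_of_supported LinearMap.id (LinearMap.range (spush f n)) (fun σ hσ => ?_) hc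
  · exact this
  · choose g hg using hσ
    refine ⟨Finsupp.single ⟨g, hf.continuous_iff.2 ?_⟩ 1, ?_⟩
    · convert σ.continuous
      exact funext hg
    · rw [spush_single]
      congr 1
      ext x
      exact hg x

theorem spush_injective {f : C(E, E')} (hf : Function.Injective f) (n : ℕ) :
    Function.Injective (spush f n) :=
  Finsupp.mapDomain_injective fun σ τ h => by
    ext x
    exact hf (DFunLike.congr_fun h x)

theorem mem_sIn_of_spush {f : C(E, E')} (hf : Function.Injective f) {n : ℕ} {c : SC n E}
    {B : Set E'} (hc : spush f n c ∈ sIn B n) : c ∈ sIn (f ⁻¹' B) n := by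
  intro σ hσ x
  have hinj : Function.Injective fun σ : Sx n E => f.comp σ := fun σ τ h => by
    ext x
    exact hf (DFunLike.congr_fun h x)
  refine hc (a := f.comp σ) ?_ x
  simp only [spush, Finsupp.lmapDomain_apply, Finset.mem_coe, Finsupp.mem_support_iff] at hσ ⊢
  rw [Finsupp.mapDomain_apply hinj]
  exact hσ

end Supports

/-! ### Relative cycles and boundaries, and their homotopy invariance -/

section DegreeBoundary

variable {E : Type u} [TopologicalSpace E] {E' : Type v} [TopologicalSpace E']

/-- The boundary, zero in degree zero. -/
def bnd : ∀ k, SC k E →ₗ[ℤ] SC (k - 1) E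
  | 0 => 0
  | k + 1 => sbd k

theorem bnd_spush (f : C(E, E')) (k : ℕ) (c : SC k E) :
    bnd k (spush f k c) = spush f (k - 1) (bnd k c) := by
  cases k with
  | zero => simp [bnd]
  | succ k => exact sbd_spush f k c

theorem bnd_sd (k : ℕ) (c : SC k E) : bnd k (sd k c) = sd (k - 1) (bnd k c) := by
  cases k with
  | zero => simp [bnd]
  | succ k => exact sbd_sd k c

theorem bnd_mem_sIn {A : Set E} {k : ℕ} {c : SC k E} (hc : c ∈ sIn A k) :
    bnd k c ∈ sIn A (k - 1) := by
  cases k with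
  | zero => simp [bnd]
  | succ k => exact sbd_mem_sIn hc

/-- Relative cycles of a pair of subspaces. -/
def rcyc (S A : Set E) (k : ℕ) : Submodule ℤ (SC k E) := sIn S k ⊓ (sIn A (k - 1)).comap (bnd k)

/-- Relative boundaries of a pair of subspaces. -/
def rbdr (S A : Set E) (k : ℕ) : Submodule ℤ (SC k E) := (sIn S (k + 1)).map (sbd k) ⊔ sIn A k

theorem mem_rcyc {S A : Set E} {k : ℕ} {c : SC k E} :
    c ∈ rcyc S A k ↔ c ∈ sIn S k ∧ bnd k c ∈ sIn A (k - 1) := Iff.rfl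

theorem mem_rbdr {S A : Set E} {k : ℕ} {c : SC k E} :
    c ∈ rbdr S A k ↔ ∃ b ∈ sIn S (k + 1), ∃ a ∈ sIn A k, sbd k b + a = c := by
  simp [rbdr, Submodule.mem_sup]

theorem rcyc_mono {S A S' A' : Set E} (hS : S ⊆ S') (hA : A ⊆ A') (k : ℕ) :
    rcyc S A k ≤ rcyc S' A' k := fun _ hc => ⟨sIn_mono hS k hc.1, sIn_mono hA _ hc.2⟩

theorem rbdr_mono {S A S' A' : Set E} (hS : S ⊆ S') (hA : A ⊆ A') (k : ℕ) :
    rbdr S A k ≤ rbdr S' A' k :=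
  sup_le_sup (Submodule.map_mono (sIn_mono hS _)) (sIn_mono hA _)

theorem spush_mem_rcyc {f : C(E, E')} {S A : Set E} {S' A' : Set E'} (hS : Set.MapsTo f S S')
    (hA : Set.MapsTo f A A') {k : ℕ} {c : SC k E} (hc : c ∈ rcyc S A k) :
    spush f k c ∈ rcyc S' A' k :=
  ⟨spush_mem_sIn hS hc.1, by
    change bnd k (spush f k c) ∈ sIn A' (k - 1)
    rw [bnd_spush]
    exact spush_mem_sIn hA hc.2⟩

theorem spush_mem_rbdr {f : C(E, E')} {S A : Set E} {S' A' : Set E'} (hS : Set.MapsTo f S S')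
    (hA : Set.MapsTo f A A') {k : ℕ} {c : SC k E} (hc : c ∈ rbdr S A k) :
    spush f k c ∈ rbdr S' A' k := by
  obtain ⟨b, hb, a, ha, rfl⟩ := mem_rbdr.1 hc
  exact mem_rbdr.2 ⟨_, spush_mem_sIn hS hb, _, spush_mem_sIn hA ha, by
    rw [map_add, sbd_spush]⟩

theorem sd_mem_rcyc {S A : Set E} {k : ℕ} {c : SC k E} (hc : c ∈ rcyc S A k) :
    sd k c ∈ rcyc S A k :=
  ⟨sd_mem_sIn hc.1, by
    change bnd k (sd k c) ∈ sIn A (k - 1)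
    rw [bnd_sd]
    exact sd_mem_sIn hc.2⟩

theorem sub_sd_mem_rbdr {S A : Set E} {k : ℕ} {c : SC k E} (hc : c ∈ rcyc S A k) :
    c - sd k c ∈ rbdr S A k := by
  cases k with
  | zero => exact mem_rbdr.2 ⟨td 0 c, td_mem_sIn hc.1, 0, zero_mem _, by rw [sbd_td_zero, add_zero]⟩
  | succ k =>
    exact mem_rbdr.2 ⟨td (k + 1) c, td_mem_sIn hc.1, td k (sbd k c), td_mem_sIn hc.2, by
      rw [sbd_td, sub_add_cancel]⟩

theorem sd_iterate_mem_rcyc {S A : Set E} {k : ℕ} {c : SC k E} (hc : c ∈ rcyc S A k) (m : ℕ) :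
    (sd k)^[m] c ∈ rcyc S A k := by
  induction m with
  | zero => exact hc
  | succ m ih =>
    rw [Function.iterate_succ_apply']
    exact sd_mem_rcyc ih

theorem sub_sd_iterate_mem_rbdr {S A : Set E} {k : ℕ} {c : SC k E} (hc : c ∈ rcyc S A k)
    (m : ℕ) : c - (sd k)^[m] c ∈ rbdr S A k := by
  induction m with
  | zero => simp
  | succ m ih =>
    rw [Function.iterate_succ_apply']
    have := add_mem ih (sub_sd_mem_rbdr (sd_iterate_mem_rcyc hc m))
    rwa [sub_add_sub_cancel] at this

theorem prismOp_mem_sIn {F : ∀ n, Sx n E → C(Prism n, E')} {A : Set E} {A' : Set E'} {n : ℕ}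
    (hA : ∀ σ : Sx n E, (∀ x, σ x ∈ A) → ∀ z, F n σ z ∈ A') {c : SC n E} (hc : c ∈ sIn A n) :
    prismOp F n c ∈ sIn A' (n + 1) :=
  map_mem_of_supported _ _ (fun σ hσ => by
    rw [prismOp_single]
    exact spush_mem_sIn' (hA σ hσ) _) hc

/-- The homotopies attached to the simplices by a homotopy of maps. -/
def htpyFam (f : C(unitInterval × E, E')) (n : ℕ) (σ : Sx n E) : C(Prism n, E') :=
  ⟨fun z => f (⟨z.1.2, z.2.2⟩, σ ⟨z.1.1, z.2.1⟩), by fun_prop⟩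

/-- The stage of a homotopy. -/
def atTime (f : C(unitInterval × E, E')) (t : unitInterval) : C(E, E') :=
  ⟨fun x => f (t, x), by fun_prop⟩

theorem prismEnd_htpyFam (f : C(unitInterval × E, E')) (t : unitInterval) (n : ℕ) :
    prismEnd (htpyFam f) t n = spush (atTime f t) n := rfl

/-- The prism over the chain is the bounding chain. The prism over its boundary is the correction
term, and it lies in `A'` because the homotopy carries `A` there throughout. -/
theorem spush_sub_mem_rbdr {f : C(unitInterval × E, E')} {S A : Set E} {S' A' : Set E'}
    (hS : ∀ t, ∀ x ∈ S, f (t, x) ∈ S') (hA : ∀ t, ∀ x ∈ A, f (t, x) ∈ A') {k : ℕ} {c : SC k E}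
    (hc : c ∈ rcyc S A k) :
    spush (atTime f 1) k c - spush (atTime f 0) k c ∈ rbdr S' A' k := by
  rw [← prismEnd_htpyFam, ← prismEnd_htpyFam]
  cases k with
  | zero =>
    exact mem_rbdr.2 ⟨prismOp (htpyFam f) 0 c, prismOp_mem_sIn (F := htpyFam f) (fun σ hσ z =>
      hS _ _ (hσ _)) hc.1, 0,
      zero_mem _, by rw [sbd_prismOp_zero, add_zero]⟩
  | succ k =>
    exact mem_rbdr.2 ⟨prismOp (htpyFam f) (k + 1) c,
      prismOp_mem_sIn (F := htpyFam f) (fun σ hσ z => hS _ _ (hσ _)) hc.1,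
      prismOp (htpyFam f) k (sbd k c), prismOp_mem_sIn (F := htpyFam f) (fun σ hσ z => hA _ _
        (hσ _)) hc.2, by
      rw [sbd_prismOp (htpyFam f) (fun n σ i => rfl), sub_add_cancel]⟩

end DegreeBoundary

/-! ### Small simplices -/

section Small

variable {V : Type u} [NormedAddCommGroup V] [NormedSpace ℝ V] {K : Set V}

/-- A vertex minus the barycentre is the average of its `n + 1` differences with the vertices. One
of these is zero, which gives the contraction factor `n / (n + 1)`. -/
theorem dist_bary_le (hK : Convex ℝ K) {n : ℕ} {p : Fin (n + 1) → K} {d : ℝ}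
    (hd : ∀ i j, dist (p i) (p j) ≤ d) (j : Fin (n + 1)) :
    dist (p j : V) (bary hK n p) ≤ (n : ℝ) / (n + 1) * d := by
  have h0 : (0 : ℝ) < n + 1 := by positivity
  have hb : ∀ i, (stdSimplex.barycenter : stdSimplex ℝ (Fin (n + 1))) i = ((n : ℝ) + 1)⁻¹ :=
    fun i => (stdSimplex.barycenter_apply i).trans (by simp)
  have e : (p j : V) - bary hK n p = ∑ i, ((n : ℝ) + 1)⁻¹ • ((p j : V) - p i) := by
    simp only [smul_sub, Finset.sum_sub_distrib, Finset.sum_const, Finset.card_univ,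
      Fintype.card_fin, bary, affSx_apply, hb, ← Nat.cast_smul_eq_nsmul ℝ,
      smul_smul]
    push_cast
    rw [mul_inv_cancel₀ h0.ne', one_smul]
  rw [dist_eq_norm, e]
  refine (norm_sum_le _ _).trans ?_
  rw [← Finset.sum_erase_add _ _ (Finset.mem_univ j)]
  simp only [sub_self, smul_zero, norm_zero, add_zero]
  refine (Finset.sum_le_card_nsmul _ _ (((n : ℝ) + 1)⁻¹ * d) fun i _ => ?_).trans ?_
  · rw [norm_smul, Real.norm_of_nonneg (by positivity), ← dist_eq_norm]
    exact mul_le_mul_of_nonneg_left (hd j i) (by positivity)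
  · rw [Finset.card_erase_of_mem (Finset.mem_univ j), Finset.card_univ, Fintype.card_fin,
      nsmul_eq_mul]
    apply le_of_eq
    simp only [Nat.add_sub_cancel]
    field_simp

/-- The hull condition is carried through the induction to bound new edges: a closed ball about the
barycentre contains the old vertices, hence the hull, hence the vertices of the subdivided faces.
Old edges obey the bound because `n / (n + 1)` increases with `n`. -/
theorem sdL_mem_supported (hK : Convex ℝ K) {n : ℕ} {p : Fin (n + 1) → K} {d : ℝ}
    (hd : ∀ i j, dist (p i) (p j) ≤ d) : sdL hK n (Finsupp.single p 1) ∈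
      Finsupp.supported ℤ ℤ {q : Fin (n + 1) → K |
        (∀ i, (q i : V) ∈ convexHull ℝ (Set.range fun j => (p j : V))) ∧
        ∀ i j, dist (q i) (q j) ≤ (n : ℝ) / (n + 1) * d} := by
  have hd0 : 0 ≤ d := dist_nonneg.trans (hd 0 0)
  induction n with
  | zero =>
    refine Finsupp.single_mem_supported ℤ _ ⟨fun i => subset_convexHull _ _ ⟨i, rfl⟩, fun i j => ?_⟩
    have : i = j := Subsingleton.elim (α := Fin 1) i j
    simp [this]
  | succ n ih =>
    have hb : ∀ y ∈ convexHull ℝ (Set.range fun j => (p j : V)),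
        dist y (bary hK (n + 1) p : V) ≤ ((n + 1 : ℕ) : ℝ) / ((n + 1 : ℕ) + 1) * d := fun y hy =>
      convexHull_min (by rintro _ ⟨j, rfl⟩; exact dist_bary_le hK hd j)
        (convex_closedBall (bary hK (n + 1) p : V) _) hy
    have hbm : (bary hK (n + 1) p : V) ∈ convexHull ℝ (Set.range fun j => (p j : V)) :=
      (convex_convexHull ℝ _).sum_mem
        (fun i _ => (stdSimplex.barycenter : stdSimplex ℝ (Fin (n + 2))).2.1 i)
        (stdSimplex.barycenter : stdSimplex ℝ (Fin (n + 2))).2.2 fun i _ =>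
          subset_convexHull _ _ ⟨i, rfl⟩
    rw [sdL, lsd_succ_single]
    refine map_mem_of_supported _ _ (s := {q : Fin (n + 1) → K |
        (∀ i, (q i : V) ∈ convexHull ℝ (Set.range fun j => (p j : V))) ∧
        ∀ i j, dist (q i) (q j) ≤ (n : ℝ) / (n + 1) * d}) (fun q hq => ?_) ?_
    · rw [cone_single]
      refine Finsupp.single_mem_supported ℤ _ ⟨fun i => ?_, fun i j => ?_⟩
      · refine Fin.cases ?_ (fun i => ?_) i
        · exact hbm
        · exact hq.1 i
      · refine Fin.cases ?_ (fun i => ?_) i <;> refine Fin.cases ?_ (fun j => ?_) j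
        · simp only [Fin.cons_zero, dist_self]
          positivity
        · simp only [Fin.cons_zero, Fin.cons_succ]
          rw [dist_comm]
          exact hb _ (hq.1 j)
        · simp only [Fin.cons_zero, Fin.cons_succ]
          exact hb _ (hq.1 i)
        · simp only [Fin.cons_succ]
          refine (hq.2 i j).trans (mul_le_mul_of_nonneg_right ?_ hd0)
          rw [div_le_div_iff₀ (by positivity) (by positivity)]
          push_cast
          nlinarith
    · rw [lbd_single, map_sum]
      refine Submodule.sum_mem _ fun i _ => ?_
      rw [map_zsmul]
      refine Submodule.smul_mem _ _ (Finsupp.supported_mono ?_ (ih fun a b => hd _ _))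
      rintro q ⟨h1, h2⟩
      refine ⟨fun a => convexHull_mono ?_ (h1 a), h2⟩
      rintro _ ⟨j, rfl⟩
      exact ⟨i.succAbove j, rfl⟩

theorem sdL_iterate_mem_supported (hK : Convex ℝ K) {n : ℕ} {p : Fin (n + 1) → K} {d : ℝ}
    (hd : ∀ i j, dist (p i) (p j) ≤ d) (m : ℕ) : (sdL hK n)^[m] (Finsupp.single p 1) ∈
      Finsupp.supported ℤ ℤ {q : Fin (n + 1) → K |
        ∀ i j, dist (q i) (q j) ≤ ((n : ℝ) / (n + 1)) ^ m * d} := by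
  induction m with
  | zero => exact Finsupp.single_mem_supported ℤ _ (by simpa using hd)
  | succ m ih =>
    rw [Function.iterate_succ_apply']
    refine map_mem_of_supported _ _ (fun q hq => ?_) ih
    refine Finsupp.supported_mono ?_ (sdL_mem_supported hK hq)
    rintro r ⟨-, hr⟩ i j
    rw [pow_succ', mul_assoc]
    exact hr i j

variable {E : Type v} [TopologicalSpace E]

theorem sd_iterate_single (n m : ℕ) (σ : Sx n E) : (sd n)^[m] (Finsupp.single σ 1) =
    spush σ n (realize (convexDx n) n ((sdL (convexDx n) n)^[m] (Finsupp.single (vtx n) 1))) := by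
  induction m with
  | zero => simp [realize_single, affSx_vtx, spush_single]
  | succ m ih =>
    rw [Function.iterate_succ_apply', Function.iterate_succ_apply', ih, sd_spush, sd_realize]

theorem dist_affSx_le (hK : Convex ℝ K) {n : ℕ} {q : Fin (n + 1) → K} {d : ℝ}
    (hd : ∀ i j, dist (q i) (q j) ≤ d) (x : Dx n) : dist (affSx hK q x) (q 0) ≤ d :=
  (convex_closedBall (q 0 : V) d).sum_mem (fun i _ => x.2.1 i) x.2.2 fun i _ => hd i 0

/-- Pull the cover back to the compact standard simplex and take a Lebesgue number; the diameters of
the iterated subdivision decay geometrically. -/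
theorem exists_sd_iterate_single_mem {ι : Type*} {U : ι → Set E} (hU : ∀ i, IsOpen (U i))
    {S : Set E} (hS : S ⊆ ⋃ i, U i) {n : ℕ} {σ : Sx n E} (hσ : ∀ x, σ x ∈ S) :
    ∃ m, (sd n)^[m] (Finsupp.single σ 1) ∈ sSmall (fun i => U i ∩ S) n := by
  obtain ⟨δ, hδ, h⟩ := lebesgue_number_lemma_of_metric (s := (Set.univ : Set (Dx n)))
    (c := fun i => σ ⁻¹' U i) isCompact_univ (fun i => (hU i).preimage σ.continuous)
    (fun x _ => by simpa using hS (hσ x))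
  have hb : ∀ i j, dist (vtx n i) (vtx n j) ≤ Metric.diam (Set.univ : Set (Dx n)) := fun i j =>
    Metric.dist_le_diam_of_mem isCompact_univ.isBounded trivial trivial
  have hr : Filter.Tendsto (fun m : ℕ => ((n : ℝ) / (n + 1)) ^ m *
      Metric.diam (Set.univ : Set (Dx n))) Filter.atTop (nhds (0 * _)) :=
    (tendsto_pow_atTop_nhds_zero_of_lt_one (by positivity)
      ((div_lt_one (by positivity)).2 (by linarith))).mul_const _
  rw [zero_mul] at hr
  obtain ⟨m, hm⟩ := (hr.eventually_lt_const hδ).exists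
  refine ⟨m, ?_⟩
  rw [sd_iterate_single]
  refine map_mem_of_supported (spush σ n ∘ₗ realize (convexDx n) n) _ (fun q hq => ?_)
    (sdL_iterate_mem_supported (convexDx n) hb m)
  obtain ⟨i, hi⟩ := h (q 0) trivial
  simp only [LinearMap.comp_apply, realize_single, spush_single]
  refine Finsupp.single_mem_supported ℤ _ ⟨i, fun x => ⟨hi ?_, hσ _⟩⟩
  exact (dist_affSx_le (convexDx n) hq x).trans_lt hm

theorem sd_iterate_mem_sSmall {ι : Type*} {U : ι → Set E} {n : ℕ} {c : SC n E}
    (hc : c ∈ sSmall U n) (m : ℕ) : (sd n)^[m] c ∈ sSmall U n := by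
  induction m with
  | zero => exact hc
  | succ m ih =>
    rw [Function.iterate_succ_apply']
    exact sd_mem_sSmall ih

theorem sd_iterate_mem_of_le {ι : Type*} {U : ι → Set E} {n : ℕ} {c : SC n E} {m m' : ℕ}
    (h : m ≤ m') (hc : (sd n)^[m] c ∈ sSmall U n) : (sd n)^[m'] c ∈ sSmall U n := by
  obtain ⟨a, rfl⟩ := Nat.exists_eq_add_of_le' h
  rw [Function.iterate_add_apply]
  exact sd_iterate_mem_sSmall hc a

/-- Iterated subdivision makes chains small with respect to an open cover. -/
theorem exists_sd_iterate_mem {ι : Type*} {U : ι → Set E} (hU : ∀ i, IsOpen (U i))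
    {S : Set E} (hS : S ⊆ ⋃ i, U i) {n : ℕ} {c : SC n E} (hc : c ∈ sIn S n) :
    ∃ m, (sd n)^[m] c ∈ sSmall (fun i => U i ∩ S) n := by
  rw [sIn, Finsupp.supported_eq_span_single] at hc
  induction hc using Submodule.span_induction with
  | mem x hx =>
    obtain ⟨σ, hσ, rfl⟩ := hx
    exact exists_sd_iterate_single_mem hU hS hσ
  | zero => exact ⟨0, zero_mem _⟩
  | add x y _ _ hx hy =>
    obtain ⟨m, hm⟩ := hx
    obtain ⟨m', hm'⟩ := hy
    refine ⟨max m m', ?_⟩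
    rw [← Module.End.coe_pow, map_add, Module.End.coe_pow]
    exact add_mem (sd_iterate_mem_of_le (le_max_left _ _) hm)
      (sd_iterate_mem_of_le (le_max_right _ _) hm')
  | smul a x _ hx =>
    obtain ⟨m, hm⟩ := hx
    refine ⟨m, ?_⟩
    rw [← Module.End.coe_pow, map_zsmul, Module.End.coe_pow]
    exact Submodule.smul_mem _ _ hm

end Small

/-! ### Finite generation of the relative homology of a ball -/

section BallFG

variable {V : Type u} [NormedAddCommGroup V] [NormedSpace ℝ V]

/-- The open unit ball. -/
abbrev Bl (V : Type u) [NormedAddCommGroup V] : Set V := Metric.ball (0 : V) 1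

/-- The points of the open unit ball of norm greater than `1 / 2`. -/
def Wl (V : Type u) [NormedAddCommGroup V] : Set (Bl V) := {x | 1 / 2 < ‖(x : V)‖}

theorem convexBl (V : Type u) [NormedAddCommGroup V] [NormedSpace ℝ V] : Convex ℝ (Bl V) :=
  convex_ball 0 1

/-- The factor by which the inner part of the unit ball is stretched. -/
def stretchFactor (r : ℝ) : ℝ := max 1 (3 / 4 / max r (1 / 2))

theorem continuous_stretchFactor : Continuous stretchFactor := by
  refine continuous_const.max (continuous_const.div (continuous_id.max continuous_const) fun r =>
    ?_)
  exact (lt_of_lt_of_le (by norm_num) (le_max_right _ _)).ne'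

theorem one_le_stretchFactor (r : ℝ) : 1 ≤ stretchFactor r := le_max_left _ _

theorem stretchFactor_mul_lt {r : ℝ} (h1 : r < 1) : stretchFactor r * r < 1 := by
  have hm : 0 < max r (1 / 2) := lt_of_lt_of_le (by norm_num) (le_max_right _ _)
  rcases max_cases 1 (3 / 4 / max r (1 / 2)) with h | h <;> rw [stretchFactor, h.1]
  · linarith
  · rw [div_mul_eq_mul_div, div_lt_one hm]
    have := le_max_left r (1 / 2)
    linarith

/-- The gap between `1 / 2` and `3 / 4` is the room in which boundary simplices can later be
straightened without leaving the collar. -/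
theorem le_stretchFactor_mul {r : ℝ} (h : 1 / 2 < r) : 3 / 4 ≤ stretchFactor r * r := by
  have h2 : 3 / 4 / max r (1 / 2) ≤ stretchFactor r := le_max_right _ _
  rw [max_eq_left h.le] at h2
  have : 3 / 4 / r * r ≤ stretchFactor r * r := mul_le_mul_of_nonneg_right h2 (by linarith)
  rwa [div_mul_cancel₀ _ (by linarith)] at this

theorem one_le_stretch (t : unitInterval) (r : ℝ) : 1 ≤ 1 + (t : ℝ) * (stretchFactor r - 1) := by
  have := mul_nonneg t.2.1 (sub_nonneg.2 (one_le_stretchFactor r))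
  linarith

theorem stretch_le (t : unitInterval) (r : ℝ) :
    1 + (t : ℝ) * (stretchFactor r - 1) ≤ stretchFactor r := by
  have := mul_le_mul_of_nonneg_right t.2.2 (sub_nonneg.2 (one_le_stretchFactor r))
  linarith

/-- The stretching homotopy of the ball. -/
def stretch (V : Type u) [NormedAddCommGroup V] [NormedSpace ℝ V] :
    C(unitInterval × Bl V, Bl V) where
  toFun z := ⟨(1 + (z.1 : ℝ) * (stretchFactor ‖(z.2 : V)‖ - 1)) • (z.2 : V), by
    have h1 : ‖(z.2 : V)‖ < 1 := mem_ball_zero_iff.1 z.2.2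
    rw [Metric.mem_ball, dist_zero_right, norm_smul, Real.norm_of_nonneg
      (zero_le_one.trans (one_le_stretch _ _))]
    exact (mul_le_mul_of_nonneg_right (stretch_le _ _) (norm_nonneg _)).trans_lt
      (stretchFactor_mul_lt h1)⟩
  continuous_toFun := by
    have := continuous_stretchFactor
    fun_prop

theorem norm_stretch (t : unitInterval) (x : Bl V) : ‖(stretch V (t, x) : V)‖ =
    (1 + (t : ℝ) * (stretchFactor ‖(x : V)‖ - 1)) * ‖(x : V)‖ := by
  change ‖(1 + (t : ℝ) * (stretchFactor ‖(x : V)‖ - 1)) • (x : V)‖ = _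
  rw [norm_smul, Real.norm_of_nonneg (zero_le_one.trans (one_le_stretch _ _))]

theorem stretch_mem_Wl (t : unitInterval) {x : Bl V} (hx : x ∈ Wl V) : stretch V (t, x) ∈ Wl V := by
  refine lt_of_lt_of_le (b := ‖(x : V)‖) hx ?_
  rw [norm_stretch]
  exact le_mul_of_one_le_left (norm_nonneg _) (one_le_stretch _ _)

theorem atTime_stretch_zero : atTime (stretch V) 0 = ContinuousMap.id _ := by
  ext x
  change (1 + (0 : ℝ) * _) • (x : V) = x
  simp

theorem le_norm_stretch_one {x : Bl V} (hx : x ∈ Wl V) : 3 / 4 ≤ ‖(stretch V (1, x) : V)‖ := by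
  rw [norm_stretch, Set.Icc.coe_one, one_mul, add_sub_cancel]
  exact le_stretchFactor_mul hx

/-- The straight-line homotopy from a simplex of a convex set to the affine simplex whose vertices
are the images of the vertices under `ν`. -/
def straighten {K : Set V} (hK : Convex ℝ K) (ν : K → K) (n : ℕ) (σ : Sx n K) :
    C(Prism n, K) where
  toFun z := ⟨(1 - z.1.2) • (σ ⟨z.1.1, z.2.1⟩ : V) +
      z.1.2 • (affSx hK (ν ∘ σ ∘ vtx n) ⟨z.1.1, z.2.1⟩ : V),
    hK (σ _).2 (affSx hK _ _).2 (sub_nonneg.2 z.2.2.2) z.2.2.1 (sub_add_cancel _ _)⟩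
  continuous_toFun := by
    have h : Continuous fun z : Prism n => (⟨z.1.1, z.2.1⟩ : Dx n) := by fun_prop
    refine Continuous.subtype_mk (Continuous.add (Continuous.smul (by fun_prop) ?_)
      (Continuous.smul (by fun_prop) ?_)) _
    · exact continuous_subtype_val.comp (σ.continuous.comp h)
    · exact continuous_subtype_val.comp ((affSx hK _).continuous.comp h)

/-- The affine target depends only on the vertices, and the vertices of a face are vertices of the
simplex. No continuity of `ν` is involved. -/
theorem straighten_faceMap {K : Set V} (hK : Convex ℝ K) (ν : K → K) (n : ℕ) (σ : Sx (n + 1) K)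
    (i : Fin (n + 2)) : straighten hK ν n (σ.comp (faceMap n i)) =
      (straighten hK ν (n + 1) σ).comp (prismFace n i) := by
  have h : affSx hK (ν ∘ (σ.comp (faceMap n i)) ∘ vtx n) =
      (affSx hK (ν ∘ σ ∘ vtx (n + 1))).comp (faceMap n i) := by
    rw [affSx_comp_faceMap, ContinuousMap.coe_comp, Function.comp_assoc, faceMap_vtx]
    rfl
  ext z
  simp only [straighten, ContinuousMap.coe_mk, h]
  rfl

theorem straighten_slice_zero {K : Set V} (hK : Convex ℝ K) (ν : K → K) (n : ℕ) (σ : Sx n K) :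
    (straighten hK ν n σ).comp (slice n 0) = σ := by
  ext x
  change (1 - (0 : ℝ)) • (σ x : V) + (0 : ℝ) • _ = _
  simp

theorem straighten_slice_one {K : Set V} (hK : Convex ℝ K) (ν : K → K) (n : ℕ) (σ : Sx n K) :
    (straighten hK ν n σ).comp (slice n 1) = affSx hK (ν ∘ σ ∘ vtx n) := by
  ext x
  change (1 - (1 : ℝ)) • (σ x : V) + (1 : ℝ) • (affSx hK _ x : V) = _
  simp

theorem dist_straighten_le {K : Set V} (hK : Convex ℝ K) {ν : K → K} {ε : ℝ}
    (hν : ∀ x, dist (ν x) x ≤ ε) {n : ℕ} {σ : Sx n K} {y : K} (hσ : ∀ x, dist (σ x) y ≤ ε)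
    (z : Prism n) : dist (straighten hK ν n σ z) y ≤ 2 * ε := by
  have hε : 0 ≤ ε := dist_nonneg.trans (hν y)
  have hc : Convex ℝ (Metric.closedBall (y : V) (2 * ε)) := convex_closedBall _ _
  refine hc (x := (σ ⟨z.1.1, z.2.1⟩ : V)) ?_
    (y := (affSx hK (ν ∘ σ ∘ vtx n) ⟨z.1.1, z.2.1⟩ : V)) ?_ (sub_nonneg.2 z.2.2.2) z.2.2.1
    (sub_add_cancel _ _)
  · exact (hσ _).trans (by linarith)
  · refine hc.sum_mem (fun i _ => z.2.1.1 i) z.2.1.2 fun i _ => ?_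
    have h1 := dist_triangle (ν (σ (vtx n i))) (σ (vtx n i)) y
    have h2 := hν (σ (vtx n i))
    have h3 := hσ (vtx n i)
    exact h1.trans (by linarith)

variable (V) in
theorem exists_finite_approx [FiniteDimensional ℝ V] {ε : ℝ} (hε : 0 < ε) :
    ∃ ν : Bl V → Bl V, (Set.range ν).Finite ∧ ∀ x, dist (ν x) x ≤ ε := by
  have : ProperSpace V := FiniteDimensional.proper ℝ V
  obtain ⟨t, ht, htf, hc⟩ := Metric.finite_approx_of_totallyBounded
    ((isCompact_closedBall (0 : V) 1).totallyBounded.subset Metric.ball_subset_closedBall) ε hε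
  have h : ∀ x : Bl V, ∃ y : Bl V, (y : V) ∈ t ∧ dist y x ≤ ε := fun x => by
    obtain ⟨y, hy, hxy⟩ := Set.mem_iUnion₂.1 (hc x.2)
    refine ⟨⟨y, ht hy⟩, hy, ?_⟩
    rw [dist_comm]
    exact (Metric.mem_ball.1 hxy).le
  choose ν h1 h2 using h
  refine ⟨ν, Set.Finite.subset (htf.preimage (Subtype.val_injective.injOn)) ?_, h2⟩
  rintro _ ⟨x, rfl⟩
  exact h1 x

variable (V) in
/-- The relative cycles of the ball modulo a collar are, up to relative boundaries, combinations
of finitely many simplices. -/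
theorem exists_fg_approx [FiniteDimensional ℝ V] (k : ℕ) : ∃ N : Submodule ℤ (SC k (Bl V)),
    N.FG ∧ ∀ c ∈ rcyc Set.univ (Wl V) k, ∃ c' ∈ N, c - c' ∈ rbdr Set.univ (Wl V) k := by
  -- With net and cover both of scale `1 / 16`, straightening moves points at most `3 / 16` from a
  -- vertex of norm at least `3 / 4`, so norms stay at least `9 / 16 > 1 / 2`.
  obtain ⟨ν, hfin, hν⟩ := exists_finite_approx V (ε := 1 / 16) (by norm_num)
  refine ⟨Submodule.span ℤ ((fun q => Finsupp.single (affSx (convexBl V) q) 1) ''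
    {q : Fin (k + 1) → Bl V | ∀ i, q i ∈ Set.range ν}), ?_, fun c hc => ?_⟩
  · refine Submodule.fg_span (Set.Finite.image _ ?_)
    have := Set.Finite.pi' (fun _ : Fin (k + 1) => hfin)
    exact this
  set W' : Set (Bl V) := {x | 3 / 4 ≤ ‖(x : V)‖} with hW'
  have hWW : W' ⊆ Wl V := fun x hx => lt_of_lt_of_le (b := (3 / 4 : ℝ)) (by norm_num) hx
  set c1 := spush (atTime (stretch V) 1) k c with hc1
  have h1 : c1 - c ∈ rbdr Set.univ (Wl V) k := by
    have := spush_sub_mem_rbdr (f := stretch V) (S := Set.univ) (S' := Set.univ) (A := Wl V)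
      (A' := Wl V) (fun _ _ _ => trivial) (fun t x hx => stretch_mem_Wl t hx) hc
    rwa [atTime_stretch_zero, spush_id] at this
  have h1' : c1 ∈ rcyc Set.univ W' k := spush_mem_rcyc (fun _ _ => Set.mem_univ _)
    (fun x hx => le_norm_stretch_one hx) hc
  let U : Bl V → Set (Bl V) := fun x => Metric.ball x (1 / 16)
  have hU : ∀ x, IsOpen (U x) := fun x => Metric.isOpen_ball
  have hcov : ∀ S : Set (Bl V), S ⊆ ⋃ x, U x := fun S x _ =>
    Set.mem_iUnion.2 ⟨x, Metric.mem_ball_self (by norm_num)⟩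
  obtain ⟨m1, hm1⟩ := exists_sd_iterate_mem hU (hcov _) h1'.1
  obtain ⟨m2, hm2⟩ := exists_sd_iterate_mem hU (hcov _) h1'.2
  set m := max m1 m2
  set c2 := (sd k)^[m] c1 with hc2
  have h2 : c1 - c2 ∈ rbdr Set.univ (Wl V) k :=
    rbdr_mono le_rfl hWW k (sub_sd_iterate_mem_rbdr h1' m)
  have hb2 : bnd k c2 ∈ sSmall (fun x => U x ∩ W') (k - 1) := by
    have e : ∀ j, bnd k ((sd k)^[j] c1) = (sd (k - 1))^[j] (bnd k c1) := fun j => by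
      induction j with
      | zero => rfl
      | succ j ih => rw [Function.iterate_succ_apply', Function.iterate_succ_apply', bnd_sd, ih]
    rw [hc2, e]
    exact sd_iterate_mem_of_le (le_max_right _ _) hm2
  set F := straighten (convexBl V) ν with hF
  -- Only the boundary of the chain has to remain in the collar, so smallness matters only for
  -- simplices inside `W'`.
  have hP : ∀ {n : ℕ} {b : SC n (Bl V)}, b ∈ sSmall (fun x => U x ∩ W') n →
      prismOp F n b ∈ sIn (Wl V) (n + 1) := fun {n b} hb =>
    map_mem_of_supported _ _ (fun σ hσ => by
      obtain ⟨y, hy⟩ := hσ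
      rw [prismOp_single]
      refine spush_mem_sIn' (fun z => ?_) _
      have d1 := dist_straighten_le (convexBl V) hν (fun x => (hy x).1.le) z
      have d2 : dist (σ (vtx n 0)) y < 1 / 16 := (hy (vtx n 0)).1
      have d3 : 3 / 4 ≤ ‖(σ (vtx n 0) : V)‖ := (hy (vtx n 0)).2
      have d4 : dist (σ (vtx n 0)) (F n σ z) ≤ 3 / 16 := by
        have := dist_triangle_right (σ (vtx n 0)) (F n σ z) y
        linarith
      have d5 : ‖(σ (vtx n 0) : V)‖ ≤ ‖(F n σ z : V)‖ + 3 / 16 := by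
        refine (norm_le_norm_add_norm_sub' _ (F n σ z : V)).trans ?_
        rw [← dist_eq_norm]
        exact add_le_add le_rfl d4
      change 1 / 2 < ‖(F n σ z : V)‖
      linarith) hb
  have e0 : ∀ n (b : SC n (Bl V)), prismEnd F 0 n b = b := fun n =>
    linear_ext_single (prismEnd F 0 n) LinearMap.id (fun σ => by
      rw [prismEnd_single, straighten_slice_zero]
      rfl)
  have h3 : prismEnd F 1 k c2 - c2 ∈ rbdr Set.univ (Wl V) k := by
    nth_rewrite 2 [← e0 k c2]
    clear_value c2
    clear hc1 h1 h1' hm1 hm2 h2 hc2 hc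
    clear_value c1
    cases k with
    | zero => exact mem_rbdr.2 ⟨prismOp F 0 c2, by rw [sIn_univ]; trivial, 0, zero_mem _, by
        rw [sbd_prismOp_zero, add_zero]⟩
    | succ k => exact mem_rbdr.2 ⟨prismOp F (k + 1) c2, by rw [sIn_univ]; trivial,
        prismOp F k (sbd k c2), hP hb2, by
          rw [sbd_prismOp F (straighten_faceMap (convexBl V) ν), sub_add_cancel]⟩
  refine ⟨prismEnd F 1 k c2, ?_, ?_⟩
  · refine map_mem_of_supported (prismEnd F 1 k) _ (s := Set.univ) (fun σ _ => ?_)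
      (by rw [Finsupp.supported_univ]; trivial)
    rw [prismEnd_single, straighten_slice_one]
    exact Submodule.subset_span ⟨_, fun i => ⟨_, rfl⟩, rfl⟩
  · have h := sub_mem (sub_mem h2 h1) h3
    have e : c1 - c2 - (c1 - c) - (prismEnd F 1 k c2 - c2) = c - prismEnd F 1 k c2 := by abel
    rwa [e] at h

end BallFG

/-! ### Deck transformations -/

section Deck

variable {X : Type u} [TopologicalSpace X] {E : Type v} [TopologicalSpace E]

theorem _root_.IsLocalHomeomorph.locallyPathConnectedSpace [LocallyPathConnectedSpace X]
    {p : E → X} (h : IsLocalHomeomorph p) : LocallyPathConnectedSpace E := by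
  choose f hf using h
  let _ : ChartedSpace X E :=
    { atlas := Set.range f
      chartAt := f
      mem_chart_source := fun x => (hf x).1
      chart_mem_atlas := fun x => ⟨x, rfl⟩ }
  exact ChartedSpace.locallyPathConnectedSpace X E

theorem _root_.IsCoveringMap.surjective_of_pathConnected [PathConnectedSpace X] [Nonempty E]
    {p : E → X} (h : IsCoveringMap p) : Function.Surjective p := by
  intro x
  obtain ⟨e⟩ := ‹Nonempty E›
  let γ : Path (p e) x := PathConnectedSpace.somePath _ _
  refine ⟨h.liftPath γ e γ.source 1, ?_⟩
  exact (congr_fun (h.liftPath_lifts γ e γ.source) 1).trans γ.target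

variable {π : C(E, X)} {e₀ : E}

theorem IsDeck.apply_base (hπ : IsCoveringMap π) {g : FundamentalGroup X (π e₀)} {T : C(E, E)}
    (h : IsDeck π e₀ g T) :
    T e₀ = hπ.monodromy (FundamentalGroup.toPath g) ⟨e₀, rfl⟩ := by
  obtain ⟨h1, h2, Γ, rfl⟩ := h
  have := hπ.monodromy_eq_of_map_eq (ex := ⟨e₀, rfl⟩) (ey := ⟨T e₀, h2⟩)
    (γ := Path.Homotopic.Quotient.mk ((Γ.map π.continuous).cast rfl h2.symm))
    (Path.Homotopic.Quotient.mk Γ) rfl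
  exact congrArg Subtype.val this.symm

theorem eq_of_lifts [PreconnectedSpace E] (hπ : IsCoveringMap π) {T T' : C(E, E)}
    (h : ∀ x, π (T x) = π x)
    (h' : ∀ x, π (T' x) = π x) {e : E} (he : T e = T' e) : T = T' :=
  DFunLike.coe_injective <| hπ.eq_of_comp_eq T.continuous T'.continuous
    (funext fun x => (h x).trans (h' x).symm) e he

theorem IsDeck.unique [PreconnectedSpace E] (hπ : IsCoveringMap π) {g : FundamentalGroup X (π e₀)}
    {T T' : C(E, E)}
    (h : IsDeck π e₀ g T) (h' : IsDeck π e₀ g T') : T = T' :=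
  eq_of_lifts hπ h.1 h'.1 ((IsDeck.apply_base hπ h).trans (IsDeck.apply_base hπ h').symm)

theorem IsDeck.class_eq [SimplyConnectedSpace E] {g g' : FundamentalGroup X (π e₀)} {T : C(E, E)}
    (h : IsDeck π e₀ g T) (h' : IsDeck π e₀ g' T) : g = g' := by
  obtain ⟨-, h2, Γ, rfl⟩ := h
  obtain ⟨-, h2', Γ', rfl⟩ := h'
  have : Path.Homotopic.Quotient.mk Γ = Path.Homotopic.Quotient.mk Γ' := Subsingleton.elim _ _
  exact congrArg (fun q : Path.Homotopic.Quotient e₀ (T e₀) => (q.map π).cast rfl h2.symm) this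

/-- The lifting criterion gives a lift of `π` through itself with a prescribed value at one point.
Its class is the projection of any path from `e₀` to its image. This is transitivity on fibres. -/
theorem exists_isDeck_apply_eq [SimplyConnectedSpace E] [LocallyPathConnectedSpace E]
    (hπ : IsCoveringMap π) {e e' : E}
    (h : π e' = π e) : ∃ g T, IsDeck π e₀ g T ∧ T e = e' := by
  obtain ⟨T, ⟨hT, hT'⟩, -⟩ := hπ.existsUnique_continuousMap_lifts π e e' h
  have h1 : ∀ x, π (T x) = π x := fun x => congrFun hT' x
  exact ⟨_, T, ⟨h1, h1 e₀, PathConnectedSpace.somePath _ _, rfl⟩, hT⟩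

theorem exists_isDeck [SimplyConnectedSpace E] [LocallyPathConnectedSpace E]
    (hπ : IsCoveringMap π) (g : FundamentalGroup X (π e₀)) : ∃ T, IsDeck π e₀ g T := by
  set e₁ := hπ.monodromy (FundamentalGroup.toPath g) ⟨e₀, rfl⟩
  obtain ⟨T, ⟨hT, hT'⟩, -⟩ := hπ.existsUnique_continuousMap_lifts π e₀ e₁.1 e₁.2
  have h1 : ∀ x, π (T x) = π x := fun x => congrFun hT' x
  have hm := hπ.map_liftPathQuotient (FundamentalGroup.toPath g) ⟨e₀, rfl⟩
  obtain ⟨Γ, hΓ⟩ : ∃ Γ, Path.Homotopic.Quotient.mk Γ =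
      hπ.liftPathQuotient (FundamentalGroup.toPath g) ⟨e₀, rfl⟩ := Quotient.exists_rep _
  rw [← hΓ] at hm
  -- The endpoint is made a variable so that the equality of `T e₀` with the monodromy endpoint can
  -- be substituted into the types of the path classes.
  have key : ∀ {e : E} (he : π e = π e₀) (Δ : Path e₀ e) (q : Path.Homotopic.Quotient (π e₀)
    (π e₀)),
      (Path.Homotopic.Quotient.mk Δ).map π = q.cast rfl he → ∀ {x : E} (hx : x = e),
      ∃ (h : π x = π e₀) (Δ' : Path e₀ x), q = FundamentalGroup.fromPath
        (Path.Homotopic.Quotient.mk ((Δ'.map π.continuous).cast rfl h.symm)) := by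
    rintro e he Δ q hq x rfl
    refine ⟨he, Δ, ?_⟩
    have := congrArg (fun q : Path.Homotopic.Quotient (π e₀) (π x) => q.cast rfl he.symm) hq
    simp only [Path.Homotopic.Quotient.cast_cast, Path.Homotopic.Quotient.cast_rfl_rfl] at this
    exact this.symm
  exact ⟨T, h1, key e₁.2 Γ _ hm hT⟩

/-- Freeness of the action: lifts agreeing at one point coincide, and a deck map determines its
class since all paths from `e₀` to its image are homotopic. -/
theorem IsDeck.eq_of_apply_eq [SimplyConnectedSpace E] (hπ : IsCoveringMap π)
    {g g' : FundamentalGroup X (π e₀)}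
    {T T' : C(E, E)} (h : IsDeck π e₀ g T) (h' : IsDeck π e₀ g' T') {e : E} (he : T e = T' e) :
    g = g' := by
  obtain rfl := eq_of_lifts hπ h.1 h'.1 he
  exact h.class_eq h'

/-- The path for the composite runs to `S e₀` and then along the `S`-image of the path for `T`,
which has the same projection as that path. This matches the order of multiplication in the
fundamental group. -/
theorem IsDeck.mul {g h : FundamentalGroup X (π e₀)} {T S : C(E, E)} (hT : IsDeck π e₀ g T)
    (hS : IsDeck π e₀ h S) : IsDeck π e₀ (g * h) (S.comp T) := by
  obtain ⟨hT1, hT2, Γ, rfl⟩ := hT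
  obtain ⟨hS1, hS2, Δ, rfl⟩ := hS
  refine ⟨fun e => (hS1 _).trans (hT1 e), (hS1 _).trans hT2, Δ.trans (Γ.map S.continuous), ?_⟩
  rw [FundamentalGroup.mul_def]
  refine (Path.Homotopic.Quotient.mk_trans _ _).symm.trans (congrArg _ ?_)
  ext t
  simp only [Path.trans_apply, Path.cast_coe, Path.map_coe, Function.comp_apply]
  split_ifs
  · rfl
  · exact (hS1 _).symm

end Deck

/-! ### Finite CW complexes -/

section CW

open Topology Metric

/-- The closed unit ball. -/
abbrev Cb (k : ℕ) : Set (Fin k → ℝ) := closedBall 0 1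

variable {X : Type u} [TopologicalSpace X] [CWComplex (Set.univ : Set X)]

/-- The set of `k`-cells. -/
abbrev Cell (X : Type u) [TopologicalSpace X] [CWComplex (Set.univ : Set X)] (k : ℕ) : Type u :=
  RelCWComplex.cell (Set.univ : Set X) k

instance finite_cell [CWComplex.Finite (Set.univ : Set X)] (k : ℕ) : Finite (Cell X k) :=
  RelCWComplex.FiniteType.finite_cell k

/-- The characteristic map of a cell. -/
def charMap {k : ℕ} (e : Cell X k) : C(Cb k, X) :=
  ⟨fun x => RelCWComplex.map k e x, (RelCWComplex.continuousOn k e).domRestrict⟩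

theorem charMap_eq {k : ℕ} {e e' : Cell X k} {x y : Cb k} (h : charMap e x = charMap e' y)
    (hx : ‖(x : Fin k → ℝ)‖ < 1) (hy : ‖(y : Fin k → ℝ)‖ < 1) : e = e' ∧ x = y := by
  have hx' : (x : Fin k → ℝ) ∈ ball (0 : Fin k → ℝ) 1 := mem_ball_zero_iff.2 hx
  have hy' : (y : Fin k → ℝ) ∈ ball (0 : Fin k → ℝ) 1 := mem_ball_zero_iff.2 hy
  have he : e = e' := by
    by_contra hne
    have := RelCWComplex.disjoint_openCell_of_ne (C := (Set.univ : Set X)) (n := k) (m := k)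
      (i := e) (j := e') (by simpa using hne)
    exact this.le_bot ⟨⟨x, hx', rfl⟩, ⟨y, hy', h.symm⟩⟩
  subst he
  refine ⟨rfl, Subtype.ext ?_⟩
  have := (RelCWComplex.map k e).injOn
  rw [RelCWComplex.source_eq] at this
  exact this hx' hy' h

variable [T2Space X]

/-- The union of the cells of dimension less than `k`. -/
abbrev sk (X : Type u) [TopologicalSpace X] [CWComplex (Set.univ : Set X)] [T2Space X] (k : ℕ) :
    Set X :=
  CWComplex.skeletonLT (Set.univ : Set X) (k : ℕ∞)

theorem isClosed_sk (k : ℕ) : IsClosed (sk X k) := RelCWComplex.Subcomplex.closed _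

theorem sk_subset_succ (k : ℕ) : sk X k ⊆ sk X (k + 1) :=
  RelCWComplex.skeletonLT_mono (by exact_mod_cast Nat.le_succ k)

theorem charMap_mem_succ {k : ℕ} (e : Cell X k) (x : Cb k) : charMap e x ∈ sk X (k + 1) :=
  RelCWComplex.closedCell_subset_skeletonLT k e ⟨x, x.2, rfl⟩

theorem charMap_mem_iff {k : ℕ} (e : Cell X k) (x : Cb k) :
    charMap e x ∈ sk X k ↔ ‖(x : Fin k → ℝ)‖ = 1 := by
  have hx := mem_closedBall_zero_iff.1 x.2
  constructor
  · intro h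
    by_contra hne
    have := RelCWComplex.disjoint_skeletonLT_openCell (C := (Set.univ : Set X)) (n := (k : ℕ∞))
      (m := k) (j := e) le_rfl
    exact this.le_bot ⟨h, ⟨x, mem_ball_zero_iff.2 (lt_of_le_of_ne hx hne), rfl⟩⟩
  · intro h
    exact RelCWComplex.cellFrontier_subset_skeletonLT k e ⟨x, mem_sphere_zero_iff_norm.2 h, rfl⟩

theorem mem_sk_succ {k : ℕ} {x : X} (h : x ∈ sk X (k + 1)) :
    x ∈ sk X k ∨ ∃ (e : Cell X k) (y : Cb k), charMap e y = x := by
  have := RelCWComplex.skeletonLT_union_iUnion_closedCell_eq_skeletonLT_succ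
    (C := (Set.univ : Set X)) k
  have h' : x ∈ (CWComplex.skeletonLT (Set.univ : Set X) ((k : ℕ∞) + 1) : Set X) := by
    exact_mod_cast h
  rw [← this] at h'
  rcases h' with h' | h'
  · exact Or.inl h'
  · obtain ⟨e, y, hy, rfl⟩ := Set.mem_iUnion.1 h'
    exact Or.inr ⟨e, ⟨y, hy⟩, rfl⟩

instance compactSpace_Cb (k : ℕ) : CompactSpace (Cb k) :=
  isCompact_iff_compactSpace.1 (isCompact_closedBall 0 1)

section Finite

variable (X) [CWComplex.Finite (Set.univ : Set X)]

/-- The union of all characteristic maps. -/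
def allCells : (Σ c : (Σ n, Cell X n), Cb c.1) → X := fun z => charMap z.1.2 z.2

/-- A continuous surjection from a finite union of compact balls to a Hausdorff space is closed.
Compactness and local path connectedness of `X` descend from the balls. -/
theorem isQuotientMap_allCells : IsQuotientMap (allCells X) := by
  have : Finite (Σ n, Cell X n) := RelCWComplex.finite_cells_of_finite
  have hc : Continuous (allCells X) := continuous_sigma fun c => (charMap c.2).continuous
  refine hc.isClosedMap.isQuotientMap hc fun x => ?_
  have hx : x ∈ ⋃ (n : ℕ) (j : Cell X n), RelCWComplex.closedCell n j := by
    rw [CWComplex.union]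
    trivial
  obtain ⟨n, hn⟩ := Set.mem_iUnion.1 hx
  obtain ⟨e, y, hy, rfl⟩ := Set.mem_iUnion.1 hn
  exact ⟨⟨⟨n, e⟩, ⟨y, hy⟩⟩, rfl⟩

theorem compactSpace_of_finite : CompactSpace X := by
  have : Finite (Σ n, Cell X n) := RelCWComplex.finite_cells_of_finite
  have h := isQuotientMap_allCells X
  exact h.surjective.compactSpace h.continuous

theorem locallyPathConnectedSpace_of_finite : LocallyPathConnectedSpace X := by
  have : ∀ c : (Σ n, Cell X n), LocallyPathConnectedSpace (Cb c.1) := fun c =>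
    (convex_closedBall (0 : Fin c.1 → ℝ) 1).locallyPathConnectedSpace
  exact (isQuotientMap_allCells X).locallyPathConnectedSpace

variable (k : ℕ)

/-- A skeleton as a quotient of the preceding one and a union of balls. -/
def attach : sk X k ⊕ (Σ _ : Cell X k, Cb k) → sk X (k + 1) :=
  Sum.elim (fun x => ⟨x, sk_subset_succ k x.2⟩) fun z => ⟨charMap z.1 z.2, charMap_mem_succ _ _⟩

theorem isQuotientMap_attach : IsQuotientMap (attach X k) := by
  have := compactSpace_of_finite X
  have : CompactSpace (sk X k) := isCompact_iff_compactSpace.1 (isClosed_sk k).isCompact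
  have hc : Continuous (attach X k) :=
    Continuous.sumElim (by fun_prop)
      (continuous_sigma fun e => (charMap e).continuous.subtype_mk _)
  refine hc.isClosedMap.isQuotientMap hc ?_
  rintro ⟨x, hx⟩
  rcases mem_sk_succ hx with h | ⟨e, y, rfl⟩
  · exact ⟨Sum.inl ⟨x, h⟩, rfl⟩
  · exact ⟨Sum.inr ⟨e, y⟩, rfl⟩

end Finite

/-! ### Stretching the cells -/

/-- The factor by which a closed ball is stretched. -/
theorem continuous_expandFactor : Continuous fun r : ℝ => (max r (1 / 2))⁻¹ :=
  (continuous_id.max continuous_const).inv₀ fun _ =>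
    (lt_of_lt_of_le (by norm_num) (le_max_right _ _)).ne'

theorem one_le_expandFactor {r : ℝ} (h : r ≤ 1) : 1 ≤ (max r (1 / 2))⁻¹ :=
  (one_le_inv₀ (lt_of_lt_of_le (by norm_num) (le_max_right _ _))).2 (max_le h (by norm_num))

theorem expandFactor_mul_le (r : ℝ) : (max r (1 / 2))⁻¹ * r ≤ 1 := by
  have hm : 0 < max r (1 / 2) := lt_of_lt_of_le (by norm_num) (le_max_right _ _)
  rw [inv_mul_le_iff₀ hm, mul_one]
  exact le_max_left _ _

theorem expand_coeff_le (t : unitInterval) {r : ℝ} (h : r ≤ 1) :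
    1 ≤ 1 + (t : ℝ) * ((max r (1 / 2))⁻¹ - 1) ∧
      1 + (t : ℝ) * ((max r (1 / 2))⁻¹ - 1) ≤ (max r (1 / 2))⁻¹ := by
  have h0 := sub_nonneg.2 (one_le_expandFactor h)
  have h1 := mul_nonneg t.2.1 h0
  have h2 := mul_le_mul_of_nonneg_right t.2.2 h0
  constructor <;> linarith

theorem norm_Cb_le {k : ℕ} (x : Cb k) : ‖(x : Fin k → ℝ)‖ ≤ 1 := mem_closedBall_zero_iff.1 x.2

/-- The homotopy of the closed ball that moves the points outside the ball of radius `1 / 2` to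
the boundary. -/
def expand (k : ℕ) : C(Cb k × unitInterval, Cb k) where
  toFun z := ⟨(1 + (z.2 : ℝ) * ((max ‖(z.1 : Fin k → ℝ)‖ (1 / 2))⁻¹ - 1)) • (z.1 : Fin k → ℝ), by
    have h := expand_coeff_le z.2 (norm_Cb_le z.1)
    rw [mem_closedBall_zero_iff, norm_smul, Real.norm_of_nonneg (zero_le_one.trans h.1)]
    exact (mul_le_mul_of_nonneg_right h.2 (norm_nonneg _)).trans (expandFactor_mul_le _)⟩
  continuous_toFun := by
    have h1 : Continuous fun z : Cb k × unitInterval => (z.1 : Fin k → ℝ) :=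
      continuous_subtype_val.comp continuous_fst
    have h2 : Continuous fun z : Cb k × unitInterval => (z.2 : ℝ) :=
      continuous_subtype_val.comp continuous_snd
    have h3 := continuous_expandFactor.comp (continuous_norm.comp h1)
    exact Continuous.subtype_mk ((continuous_const.add (h2.mul (h3.sub continuous_const))).smul h1)
      _

theorem norm_expand {k : ℕ} (x : Cb k) (t : unitInterval) :
    ‖(expand k (x, t) : Fin k → ℝ)‖ =
      (1 + (t : ℝ) * ((max ‖(x : Fin k → ℝ)‖ (1 / 2))⁻¹ - 1)) * ‖(x : Fin k → ℝ)‖ := by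
  change ‖(1 + (t : ℝ) * ((max ‖(x : Fin k → ℝ)‖ (1 / 2))⁻¹ - 1)) • (x : Fin k → ℝ)‖ = _
  rw [norm_smul, Real.norm_of_nonneg (zero_le_one.trans (expand_coeff_le t (norm_Cb_le x)).1)]

theorem le_norm_expand {k : ℕ} (x : Cb k) (t : unitInterval) :
    ‖(x : Fin k → ℝ)‖ ≤ ‖(expand k (x, t) : Fin k → ℝ)‖ := by
  rw [norm_expand]
  exact le_mul_of_one_le_left (norm_nonneg _) (expand_coeff_le t (norm_Cb_le x)).1

theorem expand_zero {k : ℕ} (x : Cb k) : expand k (x, 0) = x := by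
  apply Subtype.ext
  change (1 + (0 : ℝ) * _) • (x : Fin k → ℝ) = x
  simp

theorem expand_of_norm_eq_one {k : ℕ} {x : Cb k} (h : ‖(x : Fin k → ℝ)‖ = 1) (t : unitInterval) :
    expand k (x, t) = x := by
  apply Subtype.ext
  change (1 + (t : ℝ) * ((max ‖(x : Fin k → ℝ)‖ (1 / 2))⁻¹ - 1)) • (x : Fin k → ℝ) = x
  rw [h, max_eq_left (by norm_num)]
  simp

theorem norm_expand_one {k : ℕ} {x : Cb k} (h : 1 / 2 < ‖(x : Fin k → ℝ)‖) :
    ‖(expand k (x, 1) : Fin k → ℝ)‖ = 1 := by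
  rw [norm_expand, Set.Icc.coe_one, one_mul, add_sub_cancel, max_eq_left h.le,
    inv_mul_cancel₀ (by linarith)]

/-- The union of the half-size closed cells of dimension `k`. -/
def halfCells (X : Type u) [TopologicalSpace X] [CWComplex (Set.univ : Set X)] (k : ℕ) : Set X :=
  ⋃ e : Cell X k, charMap e '' {y | ‖(y : Fin k → ℝ)‖ ≤ 1 / 2}

theorem isClosed_halfCells [CWComplex.Finite (Set.univ : Set X)] (k : ℕ) :
    IsClosed (halfCells X k) := by
  refine isClosed_iUnion_of_finite fun e => ?_
  refine (IsCompact.image (IsClosed.isCompact ?_) (charMap e).continuous).isClosed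
  exact isClosed_le (by fun_prop) continuous_const

theorem charMap_mem_halfCells {k : ℕ} (e : Cell X k) (y : Cb k) :
    charMap e y ∈ halfCells X k ↔ ‖(y : Fin k → ℝ)‖ ≤ 1 / 2 := by
  constructor
  · intro h
    obtain ⟨e', w, hw, h⟩ := Set.mem_iUnion.1 h
    have hw1 : ‖(w : Fin k → ℝ)‖ < 1 := lt_of_le_of_lt hw (by norm_num)
    have hy1 : ‖(y : Fin k → ℝ)‖ < 1 := by
      refine lt_of_le_of_ne (norm_Cb_le y) fun h1 => ?_
      rw [← charMap_mem_iff e y, ← h, charMap_mem_iff] at h1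
      exact hw1.ne h1
    rw [← (charMap_eq h hw1 hy1).2]
    exact hw
  · intro h
    exact Set.mem_iUnion.2 ⟨e, y, h, rfl⟩

theorem not_mem_halfCells {k : ℕ} {x : X} (h : x ∈ sk X k) : x ∉ halfCells X k := by
  intro hx
  obtain ⟨e, w, hw, rfl⟩ := Set.mem_iUnion.1 hx
  rw [charMap_mem_iff] at h
  have hw' : ‖(w : Fin k → ℝ)‖ ≤ 1 / 2 := hw
  linarith

/-- A skeleton can be stretched so that the complement of the half-size cells moves to the
preceding skeleton. -/
theorem exists_stretch_sk [CWComplex.Finite (Set.univ : Set X)] (k : ℕ) :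
    ∃ h : C(unitInterval × sk X (k + 1), X), (∀ x, h (0, x) = x) ∧
      (∀ z, h z ∈ sk X (k + 1)) ∧
      (∀ (t : unitInterval) (x : sk X (k + 1)), (x : X) ∈ sk X k → h (t, x) ∈ sk X k) ∧
      (∀ (t : unitInterval) (x : sk X (k + 1)),
        (x : X) ∉ halfCells X k → h (t, x) ∉ halfCells X k) ∧
      ∀ x : sk X (k + 1), (x : X) ∉ halfCells X k → h (1, x) ∈ sk X k := by
  -- The homotopy is built as a map into the path space, so that it descends along the attaching
  -- quotient map without forming the product of that quotient with the interval.
  let g : C(sk X k ⊕ (Σ _ : Cell X k, Cb k), C(unitInterval, X)) :=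
    ⟨Sum.elim (fun x => ContinuousMap.const _ (x : X))
      (fun z => ((charMap z.1).comp (expand k)).curry z.2), by
      refine Continuous.sumElim ?_ (continuous_sigma fun e => ?_)
      · exact (ContinuousMap.curry ⟨fun z : sk X k × unitInterval => (z.1 : X), by
          fun_prop⟩).continuous
      · exact (ContinuousMap.curry ((charMap e).comp (expand k))).continuous⟩
  -- The expansion fixes the boundary sphere; elsewhere a point has a unique preimage in the cells.
  -- Together these show that `g` factors through `attach`.
  have hsphere : ∀ (e : Cell X k) (y : Cb k), charMap e y ∈ sk X k →
      g (Sum.inr ⟨e, y⟩) = ContinuousMap.const _ (charMap e y) := by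
    intro e y hy
    ext t
    change charMap e (expand k (y, t)) = charMap e y
    rw [expand_of_norm_eq_one ((charMap_mem_iff e y).1 hy)]
  have hg : Function.FactorsThrough g (attach X k) := by
    rintro (x | ⟨e, y⟩) (x' | ⟨e', y'⟩) h
    · have : (x : X) = x' := congrArg (fun z : sk X (k + 1) => (z : X)) h
      exact congrArg (ContinuousMap.const unitInterval) this
    · have h' : (x : X) = charMap e' y' := congrArg (fun z : sk X (k + 1) => (z : X)) h
      rw [hsphere e' y' (h' ▸ x.2), ← h']
      rfl
    · have h' : charMap e y = (x' : X) := congrArg (fun z : sk X (k + 1) => (z : X)) h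
      rw [hsphere e y (h' ▸ x'.2), h']
      rfl
    · have h' : charMap e y = charMap e' y' := congrArg (fun z : sk X (k + 1) => (z : X)) h
      by_cases hy : charMap e y ∈ sk X k
      · rw [hsphere e y hy, hsphere e' y' (h' ▸ hy), h']
      · have hy' := h' ▸ hy
        rw [charMap_mem_iff] at hy hy'
        obtain ⟨rfl, rfl⟩ := charMap_eq h' (lt_of_le_of_ne (norm_Cb_le y) hy)
          (lt_of_le_of_ne (norm_Cb_le y') hy')
        rfl
  have hq := isQuotientMap_attach X k
  let a : C(sk X k ⊕ (Σ _ : Cell X k, Cb k), sk X (k + 1)) := ⟨attach X k, hq.continuous⟩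
  have ha : IsQuotientMap a := hq
  let L : C(sk X (k + 1), C(unitInterval, X)) := ha.lift g hg
  have hLq : ∀ z, L (attach X k z) = g z := fun z => DFunLike.congr_fun (ha.lift_comp g hg) z
  refine ⟨L.uncurry.comp ContinuousMap.prodSwap, ?_, ?_, ?_, ?_, ?_⟩
  · intro x
    obtain ⟨z, rfl⟩ := hq.surjective x
    change L (attach X k z) 0 = _
    rw [hLq]
    rcases z with x | ⟨e, y⟩
    · rfl
    · change charMap e (expand k (y, 0)) = charMap e y
      rw [expand_zero]
  · rintro ⟨t, x⟩
    obtain ⟨z, rfl⟩ := hq.surjective x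
    change L (attach X k z) t ∈ _
    rw [hLq]
    rcases z with x | ⟨e, y⟩
    · exact sk_subset_succ k x.2
    · exact charMap_mem_succ e _
  · intro t x hx
    obtain ⟨z, rfl⟩ := hq.surjective x
    change L (attach X k z) t ∈ _
    rw [hLq]
    rcases z with x | ⟨e, y⟩
    · exact x.2
    · rw [hsphere e y hx]
      exact hx
  · intro t x hx
    obtain ⟨z, rfl⟩ := hq.surjective x
    change L (attach X k z) t ∉ _
    rw [hLq]
    rcases z with x | ⟨e, y⟩
    · exact hx
    · change charMap e y ∉ _ at hx
      change charMap e (expand k (y, t)) ∉ _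
      rw [charMap_mem_halfCells, not_le] at hx ⊢
      exact hx.trans_le (le_norm_expand y t)
  · intro x hx
    obtain ⟨z, rfl⟩ := hq.surjective x
    change L (attach X k z) 1 ∈ _
    rw [hLq]
    rcases z with x | ⟨e, y⟩
    · exact x.2
    · change charMap e y ∉ _ at hx
      change charMap e (expand k (y, 1)) ∈ _
      rw [charMap_mem_halfCells, not_le] at hx
      rw [charMap_mem_iff, norm_expand_one hx]

end CW

/-! ### Excision for a family of disjoint charts -/

section Excision

variable {E : Type u} [TopologicalSpace E] {B : Type v} [TopologicalSpace B] {ι : Type w}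

/-- The push-forward of a family of chains along a family of maps. -/
def pushAll (ψ : ι → C(B, E)) (n : ℕ) : (ι →₀ SC n B) →ₗ[ℤ] SC n E :=
  Finsupp.lsum ℤ fun i => spush (ψ i) n

theorem pushAll_single (ψ : ι → C(B, E)) (n : ℕ) (i : ι) (c : SC n B) :
    pushAll ψ n (Finsupp.single i c) = spush (ψ i) n c := by
  simp [pushAll]

theorem pushAll_comm (ψ : ι → C(B, E)) {n m : ℕ} (f : SC n B →ₗ[ℤ] SC m B)
    (f' : SC n E →ₗ[ℤ] SC m E) (h : ∀ i c, f' (spush (ψ i) n c) = spush (ψ i) m (f c))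
    (z : ι →₀ SC n B) : f' (pushAll ψ n z) = pushAll ψ m (Finsupp.mapRange.linearMap f z) := by
  have : f' ∘ₗ pushAll ψ n = pushAll ψ m ∘ₗ Finsupp.mapRange.linearMap f :=
    Finsupp.lhom_ext fun i c => by simp [pushAll_single, h]
  exact LinearMap.congr_fun this z

variable {ψ : ι → C(B, E)}

/-- Disjoint images and injective charts prevent cancellation between simplices, so the coefficients
of each component can be read off the push-forward. -/
theorem pushAll_apply (hψ : ∀ i j x y, ψ i x = ψ j y → i = j ∧ x = y) {n : ℕ}
    (z : ι →₀ SC n B) (i : ι) (τ : Sx n B) : pushAll ψ n z ((ψ i).comp τ) = z i τ := by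
  classical
  induction z using Finsupp.induction_linear with
  | zero => simp
  | add x y hx hy => simp [map_add, hx, hy]
  | single j c =>
    rw [pushAll_single]
    induction c using Finsupp.induction_linear with
    | zero => simp
    | add x y hx hy => simp [map_add, hx, hy]
    | single ρ a =>
      rw [spush_single]
      have key : (ψ j).comp ρ = (ψ i).comp τ ↔ j = i ∧ ρ = τ := by
        constructor
        · intro h
          have hx := fun x => hψ _ _ _ _ (DFunLike.congr_fun h x)
          exact ⟨(hx (Classical.arbitrary _)).1, ContinuousMap.ext fun x => (hx x).2⟩
        · rintro ⟨rfl, rfl⟩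
          rfl
      by_cases h : j = i
      · subst h
        simp [Finsupp.single_apply, key]
      · simp [key, h]

theorem pushAll_mem_sIn (hψ : ∀ i j x y, ψ i x = ψ j y → i = j ∧ x = y) {n : ℕ}
    {z : ι →₀ SC n B} {S : Set E} (hz : pushAll ψ n z ∈ sIn S n) (i : ι) :
    z i ∈ sIn (ψ i ⁻¹' S) n := by
  intro τ hτ x
  refine hz (a := (ψ i).comp τ) ?_ x
  rw [Finset.mem_coe, Finsupp.mem_support_iff] at hτ ⊢
  rwa [pushAll_apply hψ]

theorem exists_pushAll_eq {U : Set E}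
    (hlift : ∀ (n : ℕ) (σ : Sx n E), (∀ x, σ x ∈ U) → ∃ i τ, σ = (ψ i).comp τ) {n : ℕ}
    {c : SC n E} (hc : c ∈ sIn U n) : ∃ z, pushAll ψ n z = c :=
  map_mem_of_supported LinearMap.id (LinearMap.range (pushAll ψ n)) (fun σ hσ => by
    obtain ⟨i, τ, rfl⟩ := hlift n σ hσ
    exact ⟨Finsupp.single i (Finsupp.single τ 1), by rw [pushAll_single, spush_single]; rfl⟩) hc

theorem exists_add_of_mem_sSmall {O : Bool → Set E} {n : ℕ} {c : SC n E} (hc : c ∈ sSmall O n) :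
    ∃ a ∈ sIn (O true) n, ∃ b ∈ sIn (O false) n, a + b = c := by
  rw [← Submodule.mem_sup, sIn, sIn, ← Finsupp.supported_union]
  refine Finsupp.supported_mono ?_ hc
  rintro σ ⟨_ | _, h⟩
  · exact Or.inr h
  · exact Or.inl h

/-- The maps `ψ i` embed copies of `B` as a relatively open partition of `Y \ A`, and the subset `W`
of `B` corresponds to the subset `V` of `Y`. -/
structure IsChartFamily (ψ : ι → C(B, E)) (W : Set B) (Y A V : Set E) : Prop where
  inj : ∀ i j x y, ψ i x = ψ j y → i = j ∧ x = y
  mem_iff : ∀ i x, ψ i x ∈ V ↔ x ∈ W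
  lift : ∀ (n : ℕ) (σ : Sx n E), (∀ x, σ x ∈ Y \ A) → ∃ i τ, σ = (ψ i).comp τ
  subset : A ⊆ V
  exists_isOpen : ∃ O, IsOpen O ∧ O ∩ Y = V
  exists_isOpen' : ∃ O, IsOpen O ∧ O ∩ Y = Y \ A

variable {W : Set B} {Y A V : Set E}

/-- Since `A ⊆ V`, the relatively open sets `Y \ A` and `V` cover `Y`. After enough subdivision
every simplex lies in one of them, and those in `Y \ A` factor through charts. -/
theorem IsChartFamily.exists_sd_iterate (h : IsChartFamily ψ W Y A V) {n : ℕ} {c : SC n E}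
    (hc : c ∈ sIn Y n) : ∃ m, ∃ z, ∃ b ∈ sIn V n, pushAll ψ n z + b = (sd n)^[m] c := by
  obtain ⟨O, hO, hO'⟩ := h.exists_isOpen
  obtain ⟨P, hP, hP'⟩ := h.exists_isOpen'
  obtain ⟨m, hm⟩ := exists_sd_iterate_mem (U := fun b : Bool => if b then P else O)
    (by rintro (_ | _) <;> simpa) (S := Y) (fun y hy => by
      by_cases hA : y ∈ A
      · have : y ∈ O ∩ Y := hO'.symm ▸ h.subset hA
        exact Set.mem_iUnion.2 ⟨false, by simpa using this.1⟩
      · have : y ∈ P ∩ Y := hP'.symm ▸ ⟨hy, hA⟩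
        exact Set.mem_iUnion.2 ⟨true, by simpa using this.1⟩) hc
  obtain ⟨a, ha, b, hb, hab⟩ := exists_add_of_mem_sSmall hm
  simp only [if_true, Bool.false_eq_true, if_false, hO', hP'] at ha hb
  obtain ⟨z, rfl⟩ := exists_pushAll_eq h.lift ha
  exact ⟨m, z, b, hb, hab⟩

/-- The injective half of excision. Subdivide the bounding chain and split off its chart part; what
remains of the equation lies in `V`, so its components lie in `W`. -/
theorem IsChartFamily.mem_rbdr_of_pushAll (h : IsChartFamily ψ W Y A V) {k : ℕ}
    {z : ι →₀ SC k B} (hz : ∀ i, z i ∈ rcyc Set.univ W k) (hb : pushAll ψ k z ∈ rbdr Y V k)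
    (i : ι) : z i ∈ rbdr Set.univ W k := by
  obtain ⟨b, hb, a, ha, e⟩ := mem_rbdr.1 hb
  obtain ⟨m, y, b', hb', e'⟩ := h.exists_sd_iterate hb
  have hsd : ∀ (n : ℕ) (x : SC n E), (sd n)^[m] x = (sd n ^ m) x := fun n x => by
    rw [Module.End.coe_pow]
  have hcomm : ∀ x : SC (k + 1) E, sbd k ((sd (k + 1))^[m] x) = (sd k)^[m] (sbd k x) :=
    fun x => Function.Semiconj.iterate_right (f := sbd k) (fun x => sbd_sd k x) m x
  have hpush : ∀ (j : ι) (x : SC k B), (sd k)^[m] (spush (ψ j) k x) =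
    spush (ψ j) k ((sd k)^[m] x) :=
    fun j x => (Function.Semiconj.iterate_right (f := spush (ψ j) k)
      (fun x => (sd_spush _ _ x).symm) m x).symm
  have hE : pushAll ψ k (Finsupp.mapRange.linearMap (sd k ^ m) z -
      Finsupp.mapRange.linearMap (sbd k) y) = sbd k b' + (sd k)^[m] a := by
    rw [map_sub, ← pushAll_comm ψ (sd k ^ m) (sd k ^ m) (by simpa only [← hsd,
      Module.End.coe_pow] using hpush),
      ← pushAll_comm ψ (sbd k) (sbd k) (fun i c => sbd_spush _ _ _), ← e, map_add, ← hsd, ← hsd,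
      ← hcomm, ← e', map_add]
    abel
  have ha' : ∀ j, (sd k)^[j] a ∈ sIn V k := fun j => by
    induction j with
    | zero => exact ha
    | succ j ih =>
      rw [Function.iterate_succ_apply']
      exact sd_mem_sIn ih
  have hV := pushAll_mem_sIn h.inj (hE ▸ add_mem (sbd_mem_sIn hb') (ha' m)) i
  have hW : ψ i ⁻¹' V = W := Set.ext fun x => h.mem_iff i x
  rw [hW] at hV
  have h1 : (sd k)^[m] (z i) ∈ rbdr Set.univ W k :=
    mem_rbdr.2 ⟨y i, by rw [sIn_univ]; trivial, _, hV, by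
      rw [Finsupp.sub_apply, Finsupp.mapRange.linearMap_apply, Finsupp.mapRange.linearMap_apply,
        Finsupp.mapRange_apply, Finsupp.mapRange_apply, add_sub_cancel, Module.End.coe_pow]⟩
  have h2 := add_mem (sub_sd_iterate_mem_rbdr (hz i) m) h1
  rwa [sub_add_cancel] at h2

/-- The surjective half of excision: the chart part of a subdivision represents the same relative
class. -/
theorem IsChartFamily.exists_sub_pushAll_mem (h : IsChartFamily ψ W Y A V) {k : ℕ} {c : SC k E}
    (hc : c ∈ rcyc Y V k) : ∃ z : ι →₀ SC k B, (∀ i, z i ∈ rcyc Set.univ W k) ∧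
      c - pushAll ψ k z ∈ rbdr Y V k := by
  obtain ⟨m, z, b, hb, e⟩ := h.exists_sd_iterate hc.1
  have hm := sd_iterate_mem_rcyc hc m
  have h1 : bnd k (pushAll ψ k z) ∈ sIn V (k - 1) := by
    have := sub_mem hm.2 (bnd_mem_sIn hb)
    rw [← e, add_sub_cancel_right] at this
    exact this
  rw [pushAll_comm ψ (bnd k) (bnd k) (fun i c => bnd_spush _ _ _)] at h1
  refine ⟨z, fun i => ⟨by rw [sIn_univ]; trivial, ?_⟩, ?_⟩
  · have := pushAll_mem_sIn h.inj h1 i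
    have hW : ψ i ⁻¹' V = W := Set.ext fun x => h.mem_iff i x
    rw [hW] at this
    simpa using this
  · have h2 := sub_sd_iterate_mem_rbdr hc m
    have h3 : b ∈ rbdr Y V k := mem_rbdr.2 ⟨0, zero_mem _, b, hb, by simp⟩
    have := add_mem h2 h3
    rw [← e] at this
    convert this using 1
    abel

end Excision

/-! ### The cells of a covering -/

section LiftedCells

variable {X : Type u} [TopologicalSpace X] [Topology.CWComplex (Set.univ : Set X)]
  {E : Type v} [TopologicalSpace E]

/-- The inclusion of the open ball in the closed ball. -/
def ballIncl (k : ℕ) : C(Bl (Fin k → ℝ), Cb k) :=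
  ⟨fun x => ⟨x, Metric.ball_subset_closedBall x.2⟩, by fun_prop⟩

theorem norm_ballIncl_lt {k : ℕ} (x : Bl (Fin k → ℝ)) : ‖(ballIncl k x : Fin k → ℝ)‖ < 1 :=
  mem_ball_zero_iff.1 x.2

theorem exists_lift_charMap [PathConnectedSpace X] [Nonempty E] {π : C(E, X)}
    (hπ : IsCoveringMap π) {k : ℕ} (e : Cell X k) :
    ∃ Φ : C(Cb k, E), ∀ x, π (Φ x) = charMap e x := by
  have hconv := convex_closedBall (0 : Fin k → ℝ) 1
  have hne : (Metric.closedBall (0 : Fin k → ℝ) 1).Nonempty := ⟨0, by simp⟩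
  have : LocallyPathConnectedSpace (Cb k) := hconv.locallyPathConnectedSpace
  have : ContractibleSpace (Cb k) := hconv.contractibleSpace hne
  obtain ⟨x₀, hx₀⟩ := hne
  obtain ⟨e₁, he₁⟩ := hπ.surjective_of_pathConnected (charMap e ⟨x₀, hx₀⟩)
  obtain ⟨Φ, ⟨-, hΦ⟩, -⟩ := hπ.existsUnique_continuousMap_lifts (charMap e) ⟨x₀, hx₀⟩ e₁ he₁
  exact ⟨Φ, fun x => congrFun hΦ x⟩

variable [T2Space X]

/-- The part of the preimage of a skeleton outside the half-size cells. -/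
def liftedCollar (π : C(E, X)) (k : ℕ) : Set E :=
  liftedSkeleta π (k + 1) \ π ⁻¹' halfCells X k

theorem liftedSkeleta_subset_succ (π : C(E, X)) (k : ℕ) :
    liftedSkeleta π k ⊆ liftedSkeleta π (k + 1) :=
  Set.preimage_mono (sk_subset_succ k)

theorem liftedSkeleta_subset_collar (π : C(E, X)) (k : ℕ) :
    liftedSkeleta π k ⊆ liftedCollar π k :=
  fun _ hx => ⟨liftedSkeleta_subset_succ π k hx, not_mem_halfCells hx⟩

variable [Topology.CWComplex.Finite (Set.univ : Set X)]

/-- A map from a connected space to the union of the open cells of one dimension factors through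
one of them. -/
theorem exists_factor_charMap {Z : Type*} [TopologicalSpace Z] [ConnectedSpace Z] {k : ℕ}
    (f : C(Z, X)) (h : ∀ z, f z ∈ sk X (k + 1)) (h' : ∀ z, f z ∉ sk X k) :
    ∃ (e : Cell X k) (τ : C(Z, Bl (Fin k → ℝ))), ∀ z, charMap e (ballIncl k (τ z)) = f z := by
  have hlt : ∀ (e : Cell X k) (y : Cb k), charMap e y ∉ sk X k → ‖(y : Fin k → ℝ)‖ < 1 :=
    fun e y hy => lt_of_le_of_ne (norm_Cb_le y) fun h1 => hy ((charMap_mem_iff e y).2 h1)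
  choose e y hy using fun z => (mem_sk_succ (h z)).resolve_left (h' z)
  have hy1 : ∀ z, ‖(y z : Fin k → ℝ)‖ < 1 := fun z => hlt (e z) (y z) (by rw [hy]; exact h' z)
  let _ : TopologicalSpace (Cell X k) := ⊥
  have : DiscreteTopology (Cell X k) := ⟨rfl⟩
  have hpre : ∀ s : Set (Cell X k), e ⁻¹' s = ⋃ c ∈ s, f ⁻¹' Set.range (charMap c) := by
    intro s
    ext z
    simp only [Set.mem_preimage, Set.mem_iUnion, Set.mem_range, exists_prop]
    constructor
    · exact fun hz => ⟨e z, hz, y z, hy z⟩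
    · rintro ⟨c, hc, w, hw⟩
      have hw1 := hlt c w (by rw [hw]; exact h' z)
      obtain ⟨rfl, -⟩ := charMap_eq (hw.trans (hy z).symm) hw1 (hy1 z)
      exact hc
  -- The index of the cell is locally constant: by `hpre` the preimage of any set of cells is a
  -- finite union of preimages of compact images, hence closed.
  have he : Continuous e := continuous_iff_isClosed.2 fun s _ => by
    rw [hpre]
    exact s.toFinite.isClosed_biUnion fun c _ =>
      (isCompact_range (charMap c).continuous).isClosed.preimage f.continuous
  obtain ⟨z₀⟩ : Nonempty Z := inferInstance
  have hconst : ∀ z, e z = e z₀ := fun z => PreconnectedSpace.constant inferInstance he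
  have hball : ∀ z, (y z : Fin k → ℝ) ∈ (Topology.RelCWComplex.map k (e z₀)).source := fun z => by
    rw [Topology.RelCWComplex.source_eq]
    exact mem_ball_zero_iff.2 (hy1 z)
  have hf : ∀ z, f z = Topology.RelCWComplex.map k (e z₀) (y z : Fin k → ℝ) := fun z => by
    rw [← hconst z]
    exact (hy z).symm
  have hcont : Continuous fun z => (y z : Fin k → ℝ) := by
    have h1 : (fun z => (y z : Fin k → ℝ)) =
        fun z => (Topology.RelCWComplex.map k (e z₀)).symm (f z) := funext fun z => by
      rw [hf z, PartialEquiv.left_inv _ (hball z)]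
    rw [h1]
    refine (Topology.RelCWComplex.continuousOn_symm k (e z₀)).comp_continuous f.continuous
      fun z => ?_
    rw [hf z]
    exact PartialEquiv.map_source _ (hball z)
  exact ⟨e z₀, ⟨fun z => ⟨y z, mem_ball_zero_iff.2 (hy1 z)⟩, hcont.subtype_mk _⟩,
    fun z => (hf z).symm⟩

/-- The stretching of the cells lifts to a covering. -/
theorem exists_stretch_lift {π : C(E, X)} (hπ : IsCoveringMap π) (k : ℕ) :
    ∃ f : C(unitInterval × liftedSkeleta π (k + 1), E), (∀ x, f (0, x) = x) ∧
      (∀ z, f z ∈ liftedSkeleta π (k + 1)) ∧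
      (∀ (t : unitInterval) (x : liftedSkeleta π (k + 1)),
        (x : E) ∈ liftedSkeleta π k → f (t, x) ∈ liftedSkeleta π k) ∧
      (∀ (t : unitInterval) (x : liftedSkeleta π (k + 1)),
        (x : E) ∈ liftedCollar π k → f (t, x) ∈ liftedCollar π k) ∧
      ∀ x : liftedSkeleta π (k + 1), (x : E) ∈ liftedCollar π k → f (1, x) ∈ liftedSkeleta π k := by
  obtain ⟨h, h0, h1, h2, h3, h4⟩ := exists_stretch_sk (X := X) k
  let H : C(unitInterval × liftedSkeleta π (k + 1), X) :=
    ⟨fun z => h (z.1, ⟨π z.2, z.2.2⟩), by fun_prop⟩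
  have H0 : ∀ x, H (0, x) = π (incl (liftedSkeleta π (k + 1)) x) := fun x => h0 _
  have hf : ∀ z, π (hπ.liftHomotopy H (incl _) H0 z) = H z := fun z =>
    congrFun (hπ.liftHomotopy_lifts H (incl _) H0) z
  refine ⟨hπ.liftHomotopy H (incl _) H0, hπ.liftHomotopy_zero H (incl _) H0, fun z => ?_,
    fun t x hx => ?_, fun t x hx => ⟨?_, ?_⟩, fun x hx => ?_⟩
  · change π _ ∈ sk X (k + 1)
    rw [hf]
    exact h1 _
  · change π _ ∈ sk X k
    rw [hf]
    exact h2 _ _ hx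
  · change π _ ∈ sk X (k + 1)
    rw [hf]
    exact h1 _
  · change π _ ∉ halfCells X k
    rw [hf]
    exact h3 _ _ hx.2
  · change π _ ∈ sk X k
    rw [hf]
    exact h4 _ hx.2

variable [SimplyConnectedSpace E] [LocallyPathConnectedSpace E]

/-- The fundamental group permutes the lifts of each open cell simply transitively: freeness makes
the charts disjoint, and transitivity with unique lifting makes them exhaust the simplices over the
open cells. -/
theorem isChartFamily_lift {π : C(E, X)} (hπ : IsCoveringMap π) {e₀ : E} {k : ℕ}
    {Φ : Cell X k → C(Cb k, E)} (hΦ : ∀ e x, π (Φ e x) = charMap e x)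
    {T : FundamentalGroup X (π e₀) → C(E, E)} (hT : ∀ g, IsDeck π e₀ g (T g)) :
    IsChartFamily (fun i : Cell X k × FundamentalGroup X (π e₀) =>
      (T i.2).comp ((Φ i.1).comp (ballIncl k))) (Wl (Fin k → ℝ)) (liftedSkeleta π (k + 1))
      (liftedSkeleta π k) (liftedCollar π k) where
  inj := by
    rintro ⟨e, g⟩ ⟨e', g'⟩ x y h
    have h1 : charMap e (ballIncl k x) = charMap e' (ballIncl k y) := by
      have h0 : π (T g (Φ e (ballIncl k x))) = π (T g' (Φ e' (ballIncl k y))) := congrArg π h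
      rwa [(hT g).1, (hT g').1, hΦ, hΦ] at h0
    obtain ⟨rfl, h2⟩ := charMap_eq h1 (norm_ballIncl_lt x) (norm_ballIncl_lt y)
    obtain rfl : x = y := Subtype.ext (congrArg (fun z : Cb k => (z : Fin k → ℝ)) h2)
    exact ⟨by rw [(hT g).eq_of_apply_eq hπ (hT g') h], rfl⟩
  mem_iff := by
    rintro ⟨e, g⟩ x
    have h : π (T g (Φ e (ballIncl k x))) = charMap e (ballIncl k x) := by rw [(hT g).1, hΦ]
    change π (T g (Φ e (ballIncl k x))) ∈ sk X (k + 1) ∧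
      π (T g (Φ e (ballIncl k x))) ∉ halfCells X k ↔ 1 / 2 < ‖(x : Fin k → ℝ)‖
    rw [h, charMap_mem_halfCells, not_le]
    exact and_iff_right (charMap_mem_succ e _)
  lift := by
    intro n σ hσ
    obtain ⟨e, τ, hτ⟩ := exists_factor_charMap (π.comp σ) (fun z => (hσ z).1) (fun z => (hσ z).2)
    let x₀ : stdSimplex ℝ (Fin (n + 1)) := Classical.arbitrary _
    have hlift : ∀ x, π (Φ e (ballIncl k (τ x))) = π (σ x) := fun x => by
      rw [hΦ, hτ]
      rfl
    obtain ⟨g, S, hS, hx⟩ := exists_isDeck_apply_eq (e₀ := e₀) hπ (hlift x₀).symm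
    obtain rfl := hS.unique hπ (hT g)
    refine ⟨(e, g), τ, DFunLike.coe_injective (hπ.eq_of_comp_eq σ.continuous
      (ContinuousMap.continuous _) (funext fun x => ?_) x₀ hx.symm)⟩
    exact ((hS.1 _).trans (hlift x)).symm
  subset := liftedSkeleta_subset_collar π k
  exists_isOpen := ⟨(π ⁻¹' halfCells X k)ᶜ,
    ((isClosed_halfCells k).preimage π.continuous).isOpen_compl, by
      rw [Set.inter_comm, ← Set.sdiff_eq]
      rfl⟩
  exists_isOpen' := ⟨(liftedSkeleta π k)ᶜ,
    ((isClosed_sk k).preimage π.continuous).isOpen_compl, by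
      rw [Set.inter_comm, ← Set.sdiff_eq]⟩

/-- Cellular chains of a covering in terms of the chains of a ball. -/
theorem exists_cell_charts [PathConnectedSpace X] {π : C(E, X)} (hπ : IsCoveringMap π) (e₀ : E)
    (k : ℕ) : ∃ θ : Cell X k → C(Bl (Fin k → ℝ), E),
      (∀ e x, θ e x ∈ liftedSkeleta π (k + 1)) ∧
      (∀ e, ∀ x ∈ Wl (Fin k → ℝ), θ e x ∈ liftedSkeleta π k) ∧
      ∀ T : FundamentalGroup X (π e₀) → C(E, E), (∀ g, IsDeck π e₀ g (T g)) →
        (∀ z : (Cell X k × FundamentalGroup X (π e₀)) →₀ SC k (Bl (Fin k → ℝ)),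
          (∀ i, z i ∈ rcyc Set.univ (Wl (Fin k → ℝ)) k) →
          pushAll (fun i => (T i.2).comp (θ i.1)) k z ∈
            rbdr (liftedSkeleta π (k + 1)) (liftedSkeleta π k) k →
          ∀ i, z i ∈ rbdr Set.univ (Wl (Fin k → ℝ)) k) ∧
        ∀ c ∈ rcyc (liftedSkeleta π (k + 1)) (liftedSkeleta π k) k,
          ∃ z : (Cell X k × FundamentalGroup X (π e₀)) →₀ SC k (Bl (Fin k → ℝ)),
            (∀ i, z i ∈ rcyc Set.univ (Wl (Fin k → ℝ)) k) ∧
            c - pushAll (fun i => (T i.2).comp (θ i.1)) k z ∈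
              rbdr (liftedSkeleta π (k + 1)) (liftedSkeleta π k) k := by
  choose Φ hΦ using fun e : Cell X k => exists_lift_charMap hπ e
  obtain ⟨f, f0, fY, fA, fV, fVA⟩ := exists_stretch_lift hπ k
  have hAV : (liftedSkeleta π k) ⊆ liftedCollar π k := liftedSkeleta_subset_collar π k
  have hVY : liftedCollar π k ⊆ (liftedSkeleta π (k + 1)) := fun x hx => hx.1
  -- The lifted cells are moved by the end of the stretching, so that the collar of the ball lands
  -- in the lower skeleton itself and not merely in a neighbourhood of it.
  let Ψ : Cell X k → C(Bl (Fin k → ℝ), (liftedSkeleta π (k + 1))) := fun e =>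
    ⟨fun x => ⟨Φ e (ballIncl k x), by
      change π _ ∈ sk X (k + 1)
      rw [hΦ]
      exact charMap_mem_succ e _⟩, by fun_prop⟩
  have hΨW : ∀ e, ∀ x ∈ Wl (Fin k → ℝ), (Ψ e x : E) ∈ liftedCollar π k := fun e x hx => by
    refine ⟨(Ψ e x).2, ?_⟩
    change π (Φ e (ballIncl k x)) ∉ halfCells X k
    rw [hΦ, charMap_mem_halfCells, not_le]
    exact hx
  have hf0 : atTime f 0 = incl (liftedSkeleta π (k + 1)) := ContinuousMap.ext f0
  have hind : Topology.IsInducing (incl (liftedSkeleta π (k + 1))) := Topology.IsInducing.subtypeVal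
  have hinj : Function.Injective (incl (liftedSkeleta π (k + 1))) := Subtype.val_injective
  have hrange : Set.range (incl (liftedSkeleta π (k + 1))) =
    (liftedSkeleta π (k + 1)) := Subtype.range_val
  -- the part of the excisive pair that is a boundary is a boundary already in the filtration
  have H1 : ∀ c ∈ rcyc (liftedSkeleta π (k + 1)) (liftedSkeleta π k) k,
      c ∈ rbdr (liftedSkeleta π (k + 1)) (liftedCollar π k) k →
        c ∈ rbdr (liftedSkeleta π (k + 1)) (liftedSkeleta π k) k := by
    intro c hc hc'
    obtain ⟨b, hb, a, ha, e⟩ := mem_rbdr.1 hc'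
    obtain ⟨c', rfl⟩ := exists_spush_eq hind (hrange.symm ▸ hc.1)
    obtain ⟨b', rfl⟩ := exists_spush_eq hind (hrange.symm ▸ hb)
    obtain ⟨a', rfl⟩ := exists_spush_eq hind (hrange.symm ▸ sIn_mono hVY _ ha)
    have hbc := hc.2
    change bnd k (spush (incl (liftedSkeleta π (k + 1))) k c') ∈
      sIn (liftedSkeleta π k) (k - 1) at hbc
    rw [bnd_spush] at hbc
    have hc2 : c' ∈ rcyc Set.univ (incl (liftedSkeleta π (k + 1)) ⁻¹' (liftedSkeleta π k)) k :=
      ⟨by rw [sIn_univ]; trivial, mem_sIn_of_spush hinj hbc⟩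
    have h1 := spush_sub_mem_rbdr (f := f) (S' := (liftedSkeleta π (k + 1)))
      (A' := liftedSkeleta π k) (fun t x _ => fY _) fA hc2
    rw [hf0] at h1
    have e' : sbd k b' + a' = c' := spush_injective hinj k (by rw [map_add, ← sbd_spush, e])
    have h2 : spush (atTime f 1) k c' ∈ rbdr (liftedSkeleta π (k + 1))
      (liftedSkeleta π k) k := mem_rbdr.2
      ⟨spush (atTime f 1) (k + 1) b', spush_mem_sIn' (f := atTime f 1) (fun x => fY _) _,
        spush (atTime f 1) k a',
          spush_mem_sIn (A := incl (liftedSkeleta π (k + 1)) ⁻¹' liftedCollar π k)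
          (fun x hx => fVA x hx) (mem_sIn_of_spush hinj ha), by rw [← e', map_add, sbd_spush]⟩
    have := sub_mem h2 h1
    rwa [sub_sub_cancel] at this
  have hθY : ∀ e x, ((atTime f 1).comp (Ψ e)) x ∈ (liftedSkeleta π (k + 1)) := fun e x => fY _
  have hθA : ∀ e, ∀ x ∈ Wl (Fin k → ℝ), ((atTime f 1).comp (Ψ e)) x ∈
    liftedSkeleta π k := fun e x hx =>
    fVA _ (hΨW e x hx)
  refine ⟨fun e => (atTime f 1).comp (Ψ e), hθY, hθA, fun T hT => ?_⟩
  have hch := isChartFamily_lift hπ hΦ hT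
  have hTV : ∀ g, Set.MapsTo (T g) (liftedCollar π k) (liftedCollar π k) := fun g x hx =>
    ⟨(hT g).mapsTo _ hx.1, by
      have := hx.2
      rwa [Set.mem_preimage, ← (hT g).1] at this⟩
  -- Stretched and unstretched charts are homotopic as maps of pairs into the skeleton and its
  -- collar, so excision for the unstretched charts transfers to the stretched ones.
  have H2 : ∀ z : (Cell X k × FundamentalGroup X (π e₀)) →₀ SC k (Bl (Fin k → ℝ)),
      (∀ i, z i ∈ rcyc Set.univ (Wl (Fin k → ℝ)) k) →
      pushAll (fun i => (T i.2).comp ((atTime f 1).comp (Ψ i.1))) k z -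
        pushAll (fun i : Cell X k × FundamentalGroup X (π e₀) =>
          (T i.2).comp ((Φ i.1).comp (ballIncl k))) k z ∈ rbdr (liftedSkeleta π (k + 1))
            (liftedCollar π k) k := by
    intro z hz
    rw [pushAll, pushAll, Finsupp.lsum_apply, Finsupp.lsum_apply, Finsupp.sum, Finsupp.sum,
      ← Finset.sum_sub_distrib]
    refine Submodule.sum_mem _ fun i _ => ?_
    have h1 : spush (Ψ i.1) k (z i) ∈ rcyc Set.univ
        (incl (liftedSkeleta π (k + 1)) ⁻¹' liftedCollar π k) k :=
      spush_mem_rcyc (f := Ψ i.1) (fun x _ => Set.mem_univ _) (fun x hx => hΨW i.1 x hx) (hz i)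
    have h2 := spush_sub_mem_rbdr (f := f) (S' := (liftedSkeleta π (k + 1)))
      (A' := liftedCollar π k) (fun t x _ => fY _)
      fV h1
    have h3 := spush_mem_rbdr ((hT i.2).mapsTo (k + 1)) (hTV i.2) h2
    rw [hf0, map_sub, ← spush_comp, ← spush_comp, ← spush_comp, ← spush_comp] at h3
    exact h3
  refine ⟨fun z hz hb => ?_, fun c hc => ?_⟩
  · refine hch.mem_rbdr_of_pushAll hz ?_
    have := sub_mem (rbdr_mono subset_rfl hAV k hb) (H2 z hz)
    rwa [sub_sub_cancel] at this
  · obtain ⟨z, hz, hcz⟩ := hch.exists_sub_pushAll_mem (rcyc_mono subset_rfl hAV k hc)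
    refine ⟨z, hz, H1 _ (sub_mem hc ?_) ?_⟩
    · rw [pushAll, Finsupp.lsum_apply]
      refine Submodule.sum_mem _ fun i _ => spush_mem_rcyc
        (f := (T i.2).comp ((atTime f 1).comp (Ψ i.1))) (fun x _ => (hT i.2).mapsTo (k + 1)
          (hθY i.1 x))
        (fun x hx => (hT i.2).mapsTo k (hθA i.1 x hx)) (hz i)
    · have := sub_mem hcz (H2 z hz)
      rwa [sub_sub_sub_cancel_right] at this

end LiftedCells

/-! ### Cellular chains in terms of concrete singular chains -/

section Transfer

variable {E : Type v} [TopologicalSpace E]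

theorem chainEquiv_mem_sIn {A : Set E} {k : ℕ} {c : (singChains E).X k} :
    chainEquiv k E c ∈ sIn A k ↔ c ∈ chainsIn A k := by
  constructor
  · intro h
    obtain ⟨b, hb⟩ := exists_spush_eq (f := incl A) Topology.IsInducing.subtypeVal
      ((Subtype.range_val : Set.range (incl A) = A).symm ▸ h)
    refine ⟨(chainEquiv k A).symm b, (chainEquiv k E).injective ?_⟩
    rw [chainEquiv_push, AddEquiv.apply_symm_apply, hb]
  · rintro ⟨y, rfl⟩
    rw [chainEquiv_push]
    exact spush_mem_sIn' (fun x => x.2) _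

theorem chainEquiv_mem_rcyc {F : ℕ → Set E} {k : ℕ} {c : (singChains E).X k} :
    chainEquiv k E c ∈ rcyc (F (k + 1)) (F k) k ↔ c ∈ relCycles F k := by
  rw [mem_relCycles, mem_rcyc, chainEquiv_mem_sIn]
  refine and_congr_right fun _ => ?_
  have h0 : ∀ j, j + 1 ≠ k → bd E k j c = 0 := fun j hj =>
    congrArg (fun m => m.hom c) ((singChains E).shape k j hj)
  cases k with
  | zero =>
    -- In degree zero both boundary conditions are vacuous: there is no differential out of degree
    -- zero, and `bnd` is zero there by definition.
    refine iff_of_true (by simp [bnd]) fun j => ?_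
    rw [h0 j (Nat.succ_ne_zero j)]
    exact zero_mem _
  | succ k =>
    change sbd k (chainEquiv (k + 1) E c) ∈ sIn _ k ↔ _
    rw [← chainEquiv_bd, chainEquiv_mem_sIn]
    refine ⟨fun h j => ?_, fun h => h k⟩
    by_cases hj : j = k
    · exact hj ▸ h
    · rw [h0 j (by omega)]
      exact zero_mem _

theorem chainEquiv_mem_rbdr {F : ℕ → Set E} {k : ℕ} {c : (singChains E).X k} :
    chainEquiv k E c ∈ rbdr (F (k + 1)) (F k) k ↔ c ∈ relBoundaries F k := by
  rw [mem_rbdr, relBoundaries, AddSubgroup.mem_sup]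
  constructor
  · rintro ⟨b, hb, a, ha, h⟩
    refine ⟨_, ⟨(chainEquiv (k + 1) E).symm b, chainEquiv_mem_sIn.1 ?_, rfl⟩,
      (chainEquiv k E).symm a, chainEquiv_mem_sIn.1 ?_, (chainEquiv k E).injective ?_⟩
    · rwa [AddEquiv.apply_symm_apply]
    · rwa [AddEquiv.apply_symm_apply]
    · rw [map_add, chainEquiv_bd, AddEquiv.apply_symm_apply, AddEquiv.apply_symm_apply, h]
  · rintro ⟨_, ⟨b, hb, rfl⟩, a, ha, rfl⟩
    exact ⟨_, chainEquiv_mem_sIn.2 hb, _, chainEquiv_mem_sIn.2 ha, by rw [map_add, chainEquiv_bd]⟩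

/-- The class of a relative cycle. -/
def cellClass (F : ℕ → Set E) (k : ℕ) : rcyc (F (k + 1)) (F k) k →+ CellChains F k :=
  (QuotientAddGroup.mk' _).comp
    (((chainEquiv k E).symm.toAddMonoidHom.comp
      (rcyc (F (k + 1)) (F k) k).subtype.toAddMonoidHom).codRestrict (relCycles F k) fun c =>
        chainEquiv_mem_rcyc.1
          (((chainEquiv k E).apply_symm_apply (c : SC k E)).symm ▸ c.2))

theorem cellClass_eq_zero {F : ℕ → Set E} {k : ℕ} {c : rcyc (F (k + 1)) (F k) k} :
    cellClass F k c = 0 ↔ (c : SC k E) ∈ rbdr (F (k + 1)) (F k) k := by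
  refine (QuotientAddGroup.eq_zero_iff _).trans ?_
  rw [AddSubgroup.mem_addSubgroupOf, ← chainEquiv_mem_rbdr]
  change chainEquiv k E ((chainEquiv k E).symm (c : SC k E)) ∈ _ ↔ _
  rw [AddEquiv.apply_symm_apply]

theorem cellClass_surjective (F : ℕ → Set E) (k : ℕ) : Function.Surjective (cellClass F k) := by
  intro x
  obtain ⟨c, rfl⟩ := QuotientAddGroup.mk_surjective x
  refine ⟨⟨chainEquiv k E c, chainEquiv_mem_rcyc.2 c.2⟩, ?_⟩
  exact congrArg (QuotientAddGroup.mk (s := (relBoundaries F k).addSubgroupOf (relCycles F k)))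
    (Subtype.ext ((chainEquiv k E).symm_apply_apply (c : (singChains E).X k)))

theorem cellMap_cellClass {F : ℕ → Set E} {T : C(E, E)} (hT : ∀ j, Set.MapsTo T (F j) (F j))
    {k : ℕ} (c : rcyc (F (k + 1)) (F k) k) : cellMap T hT k (cellClass F k c) =
      cellClass F k ⟨spush T k c, spush_mem_rcyc (hT _) (hT _) c.2⟩ := by
  refine congrArg (QuotientAddGroup.mk (s := (relBoundaries F k).addSubgroupOf (relCycles F k)))
    (Subtype.ext ((chainEquiv k E).injective ?_))
  refine (chainEquiv_push T k _).trans ?_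
  change spush T k (chainEquiv k E ((chainEquiv k E).symm (c : SC k E))) =
    chainEquiv k E ((chainEquiv k E).symm _)
  rw [AddEquiv.apply_symm_apply, AddEquiv.apply_symm_apply]
  rfl

theorem cellMap_comp {F : ℕ → Set E} {S T : C(E, E)} (hS : ∀ j, Set.MapsTo S (F j) (F j))
    (hT : ∀ j, Set.MapsTo T (F j) (F j)) (hST : ∀ j, Set.MapsTo (S.comp T) (F j) (F j)) (k : ℕ)
    (c : CellChains F k) : cellMap (S.comp T) hST k c = cellMap S hS k (cellMap T hT k c) := by
  obtain ⟨c, rfl⟩ := cellClass_surjective F k c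
  rw [cellMap_cellClass, cellMap_cellClass, cellMap_cellClass]
  congr 1
  exact Subtype.ext (spush_comp T S k c)

end Transfer

/-! ### The cellular chains of the universal covering -/

section Structure

/-- The relative homology of the open ball and its collar. -/
abbrev BallHomology (k : ℕ) : Type :=
  rcyc Set.univ (Wl (Fin k → ℝ)) k ⧸
    (rbdr Set.univ (Wl (Fin k → ℝ)) k).submoduleOf (rcyc Set.univ (Wl (Fin k → ℝ)) k)

/-- The approximating chains in `N` need not be chosen as cycles, so the homology is embedded in the
image of `N` modulo boundaries rather than covered by `N`; noetherianity of `ℤ` finishes. -/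
instance ballHomology_finite (k : ℕ) : Module.Finite ℤ (BallHomology k) := by
  obtain ⟨N, hN, h⟩ := exists_fg_approx (Fin k → ℝ) k
  set B := rbdr Set.univ (Wl (Fin k → ℝ)) k
  have hfin : Module.Finite ℤ (N.map B.mkQ) := Module.Finite.iff_fg.2 (hN.map _)
  let f : BallHomology k →ₗ[ℤ] N.map B.mkQ := Submodule.liftQ _
    ((B.mkQ ∘ₗ Submodule.subtype _).codRestrict (N.map B.mkQ) fun c => by
      obtain ⟨c', hc', hc⟩ := h c c.2
      exact ⟨c', hc', ((Submodule.Quotient.eq B).2 hc).symm⟩)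
    (fun c hc => Subtype.ext ((Submodule.Quotient.mk_eq_zero B).2 hc))
  refine Module.Finite.of_injective f ?_
  rw [← LinearMap.ker_eq_bot, LinearMap.ker_eq_bot']
  intro x hx
  obtain ⟨c, rfl⟩ := Submodule.Quotient.mk_surjective _ x
  exact (Submodule.Quotient.mk_eq_zero _).2
    ((Submodule.Quotient.mk_eq_zero B).1 (congrArg Subtype.val hx))

variable {X : Type u} [TopologicalSpace X] [T2Space X] [Topology.CWComplex (Set.univ : Set X)]
  {E : Type v} [TopologicalSpace E] [Topology.CWComplex.Finite (Set.univ : Set X)]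
  [SimplyConnectedSpace E] [LocallyPathConnectedSpace E] [PathConnectedSpace X]

/-- The cellular chains of the universal covering are freely generated over the fundamental group
by copies of the relative homology of a ball. -/
theorem exists_cellChains_basis {π : C(E, X)} (hπ : IsCoveringMap π) (e₀ : E) (k : ℕ) :
    ∃ j : Cell X k → BallHomology k →+ CellChains (liftedSkeleta π) k,
      ∀ (T : FundamentalGroup X (π e₀) → C(E, E)) (hT : ∀ g, IsDeck π e₀ g (T g)),
        Function.Bijective (Finsupp.liftAddHom fun i : Cell X k × FundamentalGroup X (π e₀) =>
          (cellMap (T i.2) (hT i.2).mapsTo k).comp (j i.1)) := by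
  classical
  obtain ⟨θ, hθY, hθA, hθ⟩ := exists_cell_charts hπ e₀ k
  let F := liftedSkeleta π
  let Z := rcyc Set.univ (Wl (Fin k → ℝ)) k
  let θ' : Cell X k → Z →+ rcyc (F (k + 1)) (F k) k := fun e =>
    ((spush (θ e) k ∘ₗ Z.subtype).codRestrict _ fun c =>
      spush_mem_rcyc (fun x _ => hθY e x) (hθA e) c.2).toAddMonoidHom
  let j : Cell X k → BallHomology k →+ CellChains F k := fun e =>
    (Submodule.liftQ _ ((cellClass F k).comp (θ' e)).toIntLinearMap fun c hc =>
      cellClass_eq_zero.2 (spush_mem_rbdr (fun x _ => hθY e x) (hθA e) hc)).toAddMonoidHom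
  refine ⟨j, fun T hT => ?_⟩
  obtain ⟨hinj, hsurj⟩ := hθ T hT
  let P : ((Cell X k × FundamentalGroup X (π e₀)) →₀ Z) →+ rcyc (F (k + 1)) (F k) k :=
    Finsupp.liftAddHom fun i => (((spush (T i.2) k ∘ₗ Submodule.subtype _).codRestrict _ fun c =>
      spush_mem_rcyc ((hT i.2).mapsTo _) ((hT i.2).mapsTo _) c.2).toAddMonoidHom).comp (θ' i.1)
  let S : ((Cell X k × FundamentalGroup X (π e₀)) →₀ Z) →+
      ((Cell X k × FundamentalGroup X (π e₀)) →₀ SC k (Bl (Fin k → ℝ))) :=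
    Finsupp.mapRange.addMonoidHom Z.subtype.toAddMonoidHom
  let q : ((Cell X k × FundamentalGroup X (π e₀)) →₀ Z) →+
      ((Cell X k × FundamentalGroup X (π e₀)) →₀ BallHomology k) :=
    Finsupp.mapRange.addMonoidHom (Submodule.mkQ _).toAddMonoidHom
  have hPS : ∀ z, (P z : SC k E) = pushAll (fun i => (T i.2).comp (θ i.1)) k (S z) := by
    have : (Submodule.subtype _).toAddMonoidHom.comp P =
        (pushAll (fun i => (T i.2).comp (θ i.1)) k).toAddMonoidHom.comp S := by
      refine Finsupp.addHom_ext fun i c => ?_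
      simp only [AddMonoidHom.comp_apply, P, S, Finsupp.liftAddHom_apply_single,
        Finsupp.mapRange.addMonoidHom_apply, Finsupp.mapRange_single, LinearMap.toAddMonoidHom_coe,
        pushAll_single, spush_comp]
      rfl
    exact DFunLike.congr_fun this
  have hPq : ∀ z, cellClass F k (P z) = Finsupp.liftAddHom
      (fun i : Cell X k × FundamentalGroup X (π e₀) =>
        (cellMap (T i.2) (hT i.2).mapsTo k).comp (j i.1)) (q z) := by
    have : (cellClass F k).comp P = (Finsupp.liftAddHom
      (fun i : Cell X k × FundamentalGroup X (π e₀) =>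
        (cellMap (T i.2) (hT i.2).mapsTo k).comp (j i.1))).comp q := by
      refine Finsupp.addHom_ext fun i c => ?_
      simp only [AddMonoidHom.comp_apply, P, q, Finsupp.liftAddHom_apply_single,
        Finsupp.mapRange.addMonoidHom_apply, Finsupp.mapRange_single, LinearMap.toAddMonoidHom_coe]
      exact (cellMap_cellClass (hT i.2).mapsTo (θ' i.1 c)).symm
    exact DFunLike.congr_fun this
  constructor
  · rw [injective_iff_map_eq_zero]
    intro x hx
    obtain ⟨z, rfl⟩ : ∃ z, q z = x := Finsupp.mapRange_surjective _ (map_zero _)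
      (Submodule.Quotient.mk_surjective _) x
    rw [← hPq, cellClass_eq_zero, hPS] at hx
    have := hinj (S z) (fun i => (z i).2) hx
    ext i
    exact (Submodule.Quotient.mk_eq_zero _).2 (this i)
  · intro y
    obtain ⟨c, rfl⟩ := cellClass_surjective F k y
    obtain ⟨z, hz, hcz⟩ := hsurj c c.2
    -- All values of `z` are cycles, so the default value `0` is never taken; it only makes the map
    -- on coefficients total.
    obtain ⟨z', rfl⟩ : ∃ z', S z' = z := by
      refine ⟨z.mapRange (fun c => if h : c ∈ Z then ⟨c, h⟩ else 0) (by
        rw [dif_pos (zero_mem _)]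
        rfl), ?_⟩
      ext1 i
      change ((if h : z i ∈ Z then (⟨z i, h⟩ : Z) else 0 : Z) : SC k _) = z i
      rw [dif_pos (hz i)]
    refine ⟨q z', ?_⟩
    rw [← hPq, ← sub_eq_zero, ← neg_eq_zero, neg_sub, ← map_sub, cellClass_eq_zero]
    change (c : SC k E) - P z' ∈ _
    rw [hPS]
    exact hcz

end Structure

/-! ### Ranks of homology modules -/

section Ranks

open Module

/-- Rank-nullity over a domain, applied to cycles modulo boundaries and to the outgoing map. It is
stated for cardinals, so finiteness is checked before passing to natural numbers. -/
theorem finrank_homology_add {L : Type w} [CommRing L] [IsDomain L]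
    (S : ShortComplex (ModuleCat.{max w v} L)) [Module.Finite L S.X₂] :
    finrank L S.homology + finrank L (LinearMap.range S.f.hom) +
      finrank L (LinearMap.range S.g.hom) = finrank L S.X₂ := by
  have e := S.moduleCatHomologyIso.toLinearEquiv.finrank_eq
  have hf : S.f.hom.range ≤ LinearMap.ker S.g.hom := by
    rintro _ ⟨x, rfl⟩
    exact S.moduleCat_zero_apply x
  have h1 := HasRankNullity.rank_quotient_add_rank (LinearMap.range S.moduleCatToCycles)
  have h2 := HasRankNullity.rank_quotient_add_rank (LinearMap.ker S.g.hom)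
  have hfin : Module.rank L S.X₂ < Cardinal.aleph0 := rank_lt_aleph0 L S.X₂
  have e2 := S.g.hom.quotKerEquivRange.finrank_eq
  have e3 : finrank L (LinearMap.range S.moduleCatToCycles) =
      finrank L (LinearMap.range S.f.hom) := by
    have h : (LinearMap.range S.moduleCatToCycles).map (LinearMap.ker S.g.hom).subtype =
        LinearMap.range S.f.hom := by
      rw [← LinearMap.range_comp]
      rfl
    rw [← h]
    exact (Submodule.equivMapOfInjective _ (Submodule.injective_subtype _) _).finrank_eq
  have hK : Module.rank L (LinearMap.ker S.g.hom) < Cardinal.aleph0 :=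
    lt_of_le_of_lt (le_add_self.trans h2.le) hfin
  have hQ : Module.rank L (S.X₂ ⧸ LinearMap.ker S.g.hom) < Cardinal.aleph0 :=
    lt_of_le_of_lt (le_self_add.trans h2.le) hfin
  have hB : Module.rank L (LinearMap.range S.moduleCatToCycles) < Cardinal.aleph0 :=
    lt_of_le_of_lt (le_add_self.trans h1.le) hK
  have hH : Module.rank L (LinearMap.ker S.g.hom ⧸ LinearMap.range S.moduleCatToCycles) <
      Cardinal.aleph0 := lt_of_le_of_lt (le_self_add.trans h1.le) hK
  have f1 := congrArg Cardinal.toNat h1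
  have f2 := congrArg Cardinal.toNat h2
  rw [Cardinal.toNat_add hH hB] at f1
  rw [Cardinal.toNat_add hQ hK] at f2
  have e' : finrank L S.homology =
      finrank L (LinearMap.ker S.g.hom ⧸ LinearMap.range S.moduleCatToCycles) := e
  clear e
  change finrank L _ + finrank L _ = finrank L _ at f1 f2
  omega

theorem finrank_chainComplex_homology_add {L : Type w} [CommRing L] [IsDomain L]
    (C : ChainComplex (ModuleCat.{max w v} L) ℕ) (k : ℕ) [Module.Finite L (C.X k)] :
    finrank L (C.homology k) + finrank L (LinearMap.range (C.d (k + 1) k).hom) +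
      finrank L (LinearMap.range (C.d k (k - 1)).hom) = finrank L (C.X k) := by
  have : Module.Finite L (C.sc' (k + 1) k (k - 1)).X₂ := ‹Module.Finite L (C.X k)›
  have h := finrank_homology_add (C.sc' (k + 1) k (k - 1))
  -- In degree zero the successor index is zero itself, agreeing with truncated subtraction; the map
  -- there is zero.
  have hn : (ComplexShape.down ℕ).next k = k - 1 := by cases k <;> simp
  have e := (ShortComplex.homologyMapIso
    (C.isoSc' (k + 1) k (k - 1) (by simp) hn)).toLinearEquiv.finrank_eq
  refine Eq.trans ?_ h
  exact congrArg (fun n => n + finrank L (LinearMap.range (C.d (k + 1) k).hom) +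
    finrank L (LinearMap.range (C.d k (k - 1)).hom)) e

/-- The image of the extended map is the localization of the original image, and localizing at the
nonzero elements preserves rank. -/
theorem finrank_range_eq_of_isFractionRing {L K : Type*} [CommRing L] [IsDomain L] [Field K]
    [Algebra L K] [IsFractionRing L K] {M N M' N' : Type*} [AddCommGroup M] [AddCommGroup N]
    [AddCommGroup M'] [AddCommGroup N'] [Module L M] [Module L N] [Module L M'] [Module L N']
    [Module K M'] [Module K N'] [IsScalarTower L K M'] [IsScalarTower L K N'] {iM : M →ₗ[L] M'}
    {iN : N →ₗ[L] N'} (hM : IsBaseChange K iM) (hN : IsBaseChange K iN) (d : M →ₗ[L] N)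
    (d' : M' →ₗ[K] N') (h : ∀ x, d' (iM x) = iN (d x)) :
    finrank K (LinearMap.range d') = finrank L (LinearMap.range d) := by
  have : IsLocalizedModule (nonZeroDivisors L) iN :=
    (isLocalizedModule_iff_isBaseChange (nonZeroDivisors L) K iN).2 hN
  have e : LinearMap.range d' =
      (LinearMap.range d).localized' K (nonZeroDivisors L) iN := by
    rw [Submodule.localized'_eq_span]
    refine le_antisymm ?_ (Submodule.span_le.2 ?_)
    · rintro _ ⟨x, rfl⟩
      induction x using hM.inductionOn with
      | zero => simp
      | tmul m =>
        rw [h]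
        exact Submodule.subset_span ⟨_, ⟨m, rfl⟩, rfl⟩
      | smul s x hx =>
        rw [map_smul]
        exact Submodule.smul_mem _ _ hx
      | add x y hx hy =>
        rw [map_add]
        exact add_mem hx hy
    · rintro _ ⟨_, ⟨m, rfl⟩, rfl⟩
      exact ⟨iM m, h m⟩
  rw [e, IsLocalization.finrank_eq K (nonZeroDivisors L) le_rfl]
  exact IsLocalizedModule.finrank_eq (nonZeroDivisors L)
    (Submodule.toLocalized' K (nonZeroDivisors L) iN (LinearMap.range d)) le_rfl

end Ranks

/-! ### Minors -/

section Minors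

open Module Matrix

theorem exists_linearIndependent_cols {K : Type*} [Field K] {m n : Type*} [Fintype m] [Fintype n]
    (A : Matrix m n K) {s : ℕ} (hs : A.rank = s) :
    ∃ c : Fin s → n, LinearIndependent K fun i => A.col (c i) := by
  subst hs
  rw [rank_eq_finrank_span_cols]
  obtain ⟨f, hf, -, hli⟩ := Submodule.exists_fun_fin_finrank_span_eq K (Set.range A.col)
  choose c hc using hf
  refine ⟨c, ?_⟩
  simpa only [hc] using hli

/-- A matrix over a field has a nonzero minor whose size is its rank. -/
theorem exists_det_submatrix_ne_zero {K : Type*} [Field K] {m n : Type*} [Fintype m] [Fintype n]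
    (A : Matrix m n K) : ∃ (r : Fin A.rank → m) (c : Fin A.rank → n),
      (A.submatrix r c).det ≠ 0 := by
  obtain ⟨c, hc⟩ := exists_linearIndependent_cols A rfl
  have h1 : (A.submatrix id c)ᵀ.rank = A.rank := by
    have : LinearIndependent K (A.submatrix id c)ᵀ.row := hc
    rw [this.rank_matrix, Fintype.card_fin]
  obtain ⟨r, hr⟩ := exists_linearIndependent_cols (A.submatrix id c)ᵀ h1
  refine ⟨r, c, ?_⟩
  have h2 : LinearIndependent K (A.submatrix r c).row := hr
  rw [linearIndependent_rows_iff_isUnit, isUnit_iff_isUnit_det] at h2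
  exact h2.ne_zero

/-- A nonzero minor of maximal size over `K'` stays nonzero over `K`, so the rank over `K` is at
least as large. The bound on `s` keeps the list of minors finite. -/
theorem rank_map_le_rank_map {S K K' : Type*} [CommRing S] [Field K] [Field K'] {m n : Type*}
    [Fintype m] [Fintype n] (A : Matrix m n S) (f : S →+* K) (f' : S →+* K')
    (h : ∀ s ≤ Fintype.card n, ∀ (r : Fin s → m) (c : Fin s → n),
      f' (A.submatrix r c).det ≠ 0 → f (A.submatrix r c).det ≠ 0) :
    (A.map f').rank ≤ (A.map f).rank := by
  obtain ⟨r, c, hrc⟩ := exists_det_submatrix_ne_zero (A.map f')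
  have h1 : f (A.submatrix r c).det ≠ 0 := h _ (rank_le_card_width _) r c (by
    rw [RingHom.map_det]
    exact hrc)
  rw [RingHom.map_det] at h1
  have h2 := rank_of_det_ne_zero h1
  rw [Fintype.card_fin] at h2
  rw [← h2]
  exact rank_submatrix_le (A.map f) r c

end Minors

/-! ### Change of coefficients -/

section BaseChange

variable {X : Type u} [TopologicalSpace X] [T2Space X] [Topology.CWComplex (Set.univ : Set X)]
  {E : Type v} [TopologicalSpace E] {π : C(E, X)} {e₀ : E} {l : ℕ}
  {S K : Type w} [CommRing S] [CommRing K] [Algebra S K]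

/-- The change of coefficients of a representation. -/
abbrev extendRep {G : Type*} [Group G] (K : Type w) [CommRing K] [Algebra S K]
    (σ : G →* Matrix.GeneralLinearGroup (Fin l) S) : G →* Matrix.GeneralLinearGroup (Fin l) K :=
  (Matrix.GeneralLinearGroup.map (algebraMap S K)).comp σ

/-- The coordinatewise map of the free modules. -/
def coordMap (S K : Type w) [CommRing S] [CommRing K] [Algebra S K] (l : ℕ) :
    (Fin l → S) →ₗ[S] (Fin l → K) := (Algebra.linearMap S K).compLeft (Fin l)

theorem coordMap_mulVec {G : Type*} [Group G] (σ : G →* Matrix.GeneralLinearGroup (Fin l) S)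
    (g : G) (v : Fin l → S) :
    coordMap S K l ((σ g : Matrix (Fin l) (Fin l) S).mulVec v) =
      (extendRep K σ g : Matrix (Fin l) (Fin l) K).mulVec (coordMap S K l v) := by
  ext i
  exact RingHom.map_mulVec (algebraMap S K) _ _ i

theorem linearMap_ext_coordMap {N : Type*} [AddCommGroup N] [Module K N]
    {A B : (Fin l → K) →ₗ[K] N}
    (h : ∀ v, A (coordMap S K l v) = B (coordMap S K l v)) : A = B := by
  refine LinearMap.pi_ext' fun i => LinearMap.ext_ring ?_
  have hi : (Pi.single i 1 : Fin l → K) = coordMap S K l (Pi.single i 1) := by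
    ext j
    by_cases hj : j = i
    · subst hj
      simp [coordMap]
    · simp [coordMap, hj]
  change A (Pi.single i 1) = B (Pi.single i 1)
  rw [hi, h]

variable (σ : FundamentalGroup X (π e₀) →* Matrix.GeneralLinearGroup (Fin l) S)

theorem mk_tmul_cellMap (k : ℕ) {g : FundamentalGroup X (π e₀)} {T : C(E, E)}
    (hT : IsDeck π e₀ g T) (v : Fin l → S) (c : CellChains (liftedSkeleta π) k) :
    (twistedRel π e₀ σ k).mkQ (v ⊗ₜ[ℤ] cellMap T hT.mapsTo k c) =
      (twistedRel π e₀ σ k).mkQ ((σ g : Matrix (Fin l) (Fin l) S).mulVec v ⊗ₜ[ℤ] c) :=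
  (Submodule.Quotient.eq _).2 (Submodule.subset_span ⟨g, T, hT, v, c, rfl⟩)

variable (K)

/-- The map of twisted chains given by a change of coefficients. -/
def twistedExtend (k : ℕ) : TwistedChains π e₀ σ k →ₗ[S] TwistedChains π e₀ (extendRep K σ) k :=
  (twistedRel π e₀ σ k).liftQ (((twistedRel π e₀ (extendRep K σ) k).mkQ.restrictScalars S) ∘ₗ
    AlgebraTensorModule.map (coordMap S K l) LinearMap.id) (by
    refine Submodule.span_le.2 ?_
    rintro _ ⟨g, T, hT, v, c, rfl⟩
    rw [SetLike.mem_coe, LinearMap.mem_ker, map_sub, sub_eq_zero]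
    refine (mk_tmul_cellMap (extendRep K σ) k hT (coordMap S K l v) c).trans ?_
    rw [← coordMap_mulVec]
    rfl)

theorem twistedChains_induction {k : ℕ} {p : TwistedChains π e₀ σ k → Prop}
    (h : ∀ v c, p ((twistedRel π e₀ σ k).mkQ (v ⊗ₜ c))) (hadd : ∀ x y, p x → p y → p (x + y))
    (x : TwistedChains π e₀ σ k) : p x := by
  obtain ⟨x, rfl⟩ := Submodule.Quotient.mk_surjective _ x
  induction x using TensorProduct.induction_on with
  | zero => simpa using h 0 0
  | tmul v c => exact h v c
  | add x y hx hy => exact hadd _ _ hx hy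

theorem twistedD_twistedExtend (k : ℕ) (x : TwistedChains π e₀ σ (k + 1)) :
    twistedD π e₀ (extendRep K σ) k (twistedExtend K σ (k + 1) x) =
      twistedExtend K σ k (twistedD π e₀ σ k x) := by
  induction x using twistedChains_induction with
  | h v c => rfl
  | hadd x y hx hy => simp only [map_add, hx, hy]

/-- The map from the tensor product over the integers to the extension of scalars. -/
def untwist (k : ℕ) :
    ((Fin l → K) ⊗[ℤ] CellChains (liftedSkeleta π) k) →ₗ[K] K ⊗[S] TwistedChains π e₀ σ k :=
  AlgebraTensorModule.lift (∑ i : Fin l, (LinearMap.proj i : (Fin l → K) →ₗ[K] K).smulRight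
    ((((TensorProduct.mk S K (TwistedChains π e₀ σ k) 1).restrictScalars ℤ) ∘ₗ
      ((twistedRel π e₀ σ k).mkQ.restrictScalars ℤ)) ∘ₗ
        TensorProduct.mk ℤ (Fin l → S) (CellChains (liftedSkeleta π) k) (Pi.single i 1)))

theorem untwist_tmul (k : ℕ) (v : Fin l → K) (c : CellChains (liftedSkeleta π) k) :
    untwist K σ k (v ⊗ₜ c) = ∑ i, v i • ((1 : K) ⊗ₜ[S]
      (twistedRel π e₀ σ k).mkQ ((Pi.single i 1 : Fin l → S) ⊗ₜ[ℤ] c)) := by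
  simp only [untwist, AlgebraTensorModule.lift_apply, LinearMap.coe_sum, Finset.sum_apply,
    lift.tmul, LinearMap.coe_restrictScalars]
  rfl

theorem untwist_coordMap (k : ℕ) (v : Fin l → S) (c : CellChains (liftedSkeleta π) k) :
    untwist K σ k (coordMap S K l v ⊗ₜ c) =
      (1 : K) ⊗ₜ[S] (twistedRel π e₀ σ k).mkQ (v ⊗ₜ[ℤ] c) := by
  have hv : v = ∑ i, v i • (Pi.single i 1 : Fin l → S) := by
    ext j
    simp [Finset.sum_apply, Pi.single_apply]
  rw [untwist_tmul]
  conv_rhs => rw [hv]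
  rw [sum_tmul, map_sum, tmul_sum]
  refine Finset.sum_congr rfl fun i _ => ?_
  rw [← smul_tmul', map_smul, tmul_smul, coordMap]
  exact algebraMap_smul K (v i) _

/-- The twisted relations are linear in the vector, so over `K` they follow from those for vectors
coming from `S`. This makes `untwist` descend, and the descended map inverts the canonical one. -/
theorem isBaseChange_twistedExtend (k : ℕ) : IsBaseChange K (twistedExtend (e₀ := e₀) K σ k) := by
  have hrel : twistedRel π e₀ (extendRep K σ) k ≤ LinearMap.ker (untwist K σ k) := by
    refine Submodule.span_le.2 ?_
    rintro _ ⟨g, T, hT, v, c, rfl⟩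
    rw [SetLike.mem_coe, LinearMap.mem_ker, map_sub, sub_eq_zero]
    have h : (untwist K σ k ∘ₗ (AlgebraTensorModule.mk ℤ K (Fin l → K) _).flip
        (cellMap T hT.mapsTo k c)) =
          (untwist K σ k ∘ₗ (AlgebraTensorModule.mk ℤ K (Fin l → K) _).flip c) ∘ₗ
            (extendRep K σ g : Matrix (Fin l) (Fin l) K).mulVecLin := by
      refine linearMap_ext_coordMap (S := S) fun w => ?_
      change untwist K σ k (coordMap S K l w ⊗ₜ cellMap T hT.mapsTo k c) =
        untwist K σ k ((extendRep K σ g : Matrix (Fin l) (Fin l) K).mulVec _ ⊗ₜ c)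
      rw [← coordMap_mulVec, untwist_coordMap, untwist_coordMap, mk_tmul_cellMap σ k hT]
    exact LinearMap.congr_fun h v
  let f : K ⊗[S] TwistedChains π e₀ σ k →ₗ[K] TwistedChains π e₀ (extendRep K σ) k :=
    LinearMap.liftBaseChange K (twistedExtend K σ k)
  let g : TwistedChains π e₀ (extendRep K σ) k →ₗ[K] K ⊗[S] TwistedChains π e₀ σ k :=
    Submodule.liftQ _ (untwist K σ k) hrel
  have hf : ∀ (a : K) (v : Fin l → S) (c : CellChains (liftedSkeleta π) k),
      f (a ⊗ₜ (twistedRel π e₀ σ k).mkQ (v ⊗ₜ c)) =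
        a • (twistedRel π e₀ (extendRep K σ) k).mkQ (coordMap S K l v ⊗ₜ c) := fun a v c =>
    LinearMap.liftBaseChange_tmul ..
  refine IsBaseChange.of_equiv (LinearEquiv.ofLinearMap f g ?_ ?_) fun x => ?_
  · refine Submodule.linearMap_qext _ (AlgebraTensorModule.ext fun v c => ?_)
    have h : (f ∘ₗ untwist K σ k ∘ₗ (AlgebraTensorModule.mk ℤ K (Fin l → K) _).flip c) =
        (twistedRel π e₀ (extendRep K σ) k).mkQ ∘ₗ
          (AlgebraTensorModule.mk ℤ K (Fin l → K) _).flip c := by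
      refine linearMap_ext_coordMap (S := S) fun w => ?_
      change f (untwist K σ k (coordMap S K l w ⊗ₜ c)) = _
      rw [untwist_coordMap, hf, one_smul]
      rfl
    exact LinearMap.congr_fun h v
  · refine AlgebraTensorModule.ext fun a x => ?_
    change g (f (a ⊗ₜ x)) = a ⊗ₜ x
    induction x using twistedChains_induction with
    | h v c =>
      rw [hf, map_smul]
      change a • untwist K σ k (coordMap S K l v ⊗ₜ c) = _
      rw [untwist_coordMap, smul_tmul', smul_eq_mul, mul_one]
    | hadd x y hx hy => rw [tmul_add, map_add, map_add, hx, hy]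
  · change f (1 ⊗ₜ x) = _
    rw [LinearMap.liftBaseChange_tmul, one_smul]

end BaseChange

/-! ### The structure of the twisted chain modules -/

section TwistedStructure

variable {X : Type u} [TopologicalSpace X] [T2Space X] [Topology.CWComplex (Set.univ : Set X)]
  {E : Type v} [TopologicalSpace E] {π : C(E, X)} {e₀ : E} {l : ℕ} {S : Type w} [CommRing S]

/-- Tensoring an induced module over the group ring removes the group: `v ⊗ (j i h) · g` is
identified with `σ(g) v ⊗ h` in the `i`-th summand. The group `H` is arbitrary. -/
theorem exists_twistedChains_equiv [SimplyConnectedSpace E] (hπ : IsCoveringMap π)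
    (σ : FundamentalGroup X (π e₀) →* Matrix.GeneralLinearGroup (Fin l) S) {k : ℕ} {I H : Type*}
    [AddCommGroup H] (j : I → H →+ CellChains (liftedSkeleta π) k)
    (T : FundamentalGroup X (π e₀) → C(E, E)) (hT : ∀ g, IsDeck π e₀ g (T g))
    (hj : Function.Bijective (Finsupp.liftAddHom fun i : I × FundamentalGroup X (π e₀) =>
      (cellMap (T i.2) (hT i.2).mapsTo k).comp (j i.1))) :
    Nonempty (TwistedChains π e₀ σ k ≃ₗ[S] (I →₀ ((Fin l → S) ⊗[ℤ] H))) := by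
  classical
  let act : FundamentalGroup X (π e₀) → CellChains (liftedSkeleta π) k →+
    CellChains (liftedSkeleta π) k := fun g => cellMap (T g) (hT g).mapsTo k
  -- The order is reversed because deck transformations form a right action; `σ` then turns the
  -- relation into associativity of matrix multiplication.
  have hact : ∀ g h c, act g (act h c) = act (h * g) c := fun g h c => by
    have h1 := IsDeck.mul (hT h) (hT g)
    obtain h2 := IsDeck.unique hπ h1 (hT (h * g))
    have h3 := cellMap_comp (hT g).mapsTo (hT h).mapsTo h1.mapsTo k c
    rw [← h3]
    change _ = cellMap (T (h * g)) _ k c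
    congr 2
  let β : ((I × FundamentalGroup X (π e₀)) →₀ H) ≃+ CellChains (liftedSkeleta π) k :=
    AddEquiv.ofBijective _ hj
  have hβ : ∀ i g h, β (Finsupp.single (i, g) h) = act g (j i h) := fun i g h =>
    Finsupp.liftAddHom_apply_single _ _ _
  let W : ((I × FundamentalGroup X (π e₀)) →₀ ((Fin l → S) ⊗[ℤ] H)) →ₗ[S]
      (I →₀ ((Fin l → S) ⊗[ℤ] H)) :=
    Finsupp.lsum S fun i => Finsupp.lsingle i.1 ∘ₗ AlgebraTensorModule.map
      (σ i.2 : Matrix (Fin l) (Fin l) S).mulVecLin LinearMap.id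
  let q₀ : ((Fin l → S) ⊗[ℤ] CellChains (liftedSkeleta π) k) →ₗ[S] (I →₀ ((Fin l → S) ⊗[ℤ] H)) :=
    W ∘ₗ (TensorProduct.finsuppRight ℤ S (Fin l → S) H (I × FundamentalGroup X
      (π e₀))).toLinearMap ∘ₗ
      AlgebraTensorModule.map LinearMap.id β.symm.toAddMonoidHom.toIntLinearMap
  have hq₀ : ∀ v g i h, q₀ (v ⊗ₜ act g (j i h)) =
      Finsupp.single i ((σ g : Matrix (Fin l) (Fin l) S).mulVec v ⊗ₜ h) := fun v g i h => by
    rw [← hβ]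
    change W (TensorProduct.finsuppRight ℤ S (Fin l → S) H _ (v ⊗ₜ β.symm (β _))) = _
    rw [AddEquiv.symm_apply_apply, TensorProduct.finsuppRight_tmul_single]
    exact Finsupp.lsum_single ..
  have hind : ∀ {p : CellChains (liftedSkeleta π) k → Prop}, p 0 →
      (∀ x y, p x → p y → p (x + y)) → (∀ g i h, p (act g (j i h))) → ∀ c, p c := by
    intro p h0 hadd hs c
    obtain ⟨z, rfl⟩ := β.surjective c
    induction z using Finsupp.induction_linear with
    | zero => rwa [map_zero]
    | add x y hx hy =>
      rw [map_add]
      exact hadd _ _ hx hy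
    | single i h =>
      rw [← Prod.mk.eta (p := i), hβ]
      exact hs _ _ _
  let q : TwistedChains π e₀ σ k →ₗ[S] (I →₀ ((Fin l → S) ⊗[ℤ] H)) :=
    (twistedRel π e₀ σ k).liftQ q₀ (by
      refine Submodule.span_le.2 ?_
      rintro _ ⟨g, T', hT', v, c, rfl⟩
      obtain rfl := IsDeck.unique hπ hT' (hT g)
      rw [SetLike.mem_coe, LinearMap.mem_ker, map_sub, sub_eq_zero]
      change q₀ (v ⊗ₜ act g c) = q₀ (_ ⊗ₜ c)
      refine hind (p := fun c => q₀ (v ⊗ₜ act g c) = q₀ (_ ⊗ₜ c)) (by simp)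
        (fun x y hx hy => ?_) (fun g' i h => ?_) c
      · rw [map_add, tmul_add, tmul_add, map_add, map_add, hx, hy]
      · rw [hact, hq₀, hq₀, map_mul, Matrix.mulVec_mulVec]
        rfl)
  -- Inserting `act 1` makes `hq₀` apply directly; it is absorbed afterwards through `hact`.
  let p : (I →₀ ((Fin l → S) ⊗[ℤ] H)) →ₗ[S] TwistedChains π e₀ σ k :=
    Finsupp.lsum S fun i => (twistedRel π e₀ σ k).mkQ ∘ₗ AlgebraTensorModule.map LinearMap.id
      ((act 1).comp (j i)).toIntLinearMap
  have hp : ∀ i v h, p (Finsupp.single i (v ⊗ₜ h)) =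
      (twistedRel π e₀ σ k).mkQ (v ⊗ₜ act 1 (j i h)) := fun i v h => by
    refine (Finsupp.lsum_single ..).trans ?_
    rfl
  refine ⟨LinearEquiv.ofLinearMap q p ?_ ?_⟩
  · refine Finsupp.lhom_ext' fun i => AlgebraTensorModule.ext fun v h => ?_
    change q (p (Finsupp.single i (v ⊗ₜ h))) = Finsupp.single i (v ⊗ₜ h)
    rw [hp]
    change q₀ _ = _
    rw [hq₀, map_one, Units.val_one, Matrix.one_mulVec]
  · refine Submodule.linearMap_qext _ (AlgebraTensorModule.ext fun v c => ?_)
    change p (q₀ (v ⊗ₜ c)) = (twistedRel π e₀ σ k).mkQ (v ⊗ₜ c)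
    refine hind (p := fun c => p (q₀ (v ⊗ₜ c)) = (twistedRel π e₀ σ k).mkQ (v ⊗ₜ c)) (by simp)
      (fun x y hx hy => ?_) (fun g i h => ?_) c
    · rw [tmul_add, map_add, map_add, map_add, hx, hy]
    · rw [hq₀, hp]
      refine (mk_tmul_cellMap σ k (hT g) v _).symm.trans ?_
      change (twistedRel π e₀ σ k).mkQ (v ⊗ₜ act g (act 1 (j i h))) = _
      rw [hact, one_mul]

end TwistedStructure

section FiniteTwisted

variable {X : Type u} [TopologicalSpace X] [T2Space X] [Topology.CWComplex (Set.univ : Set X)]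
  [Topology.CWComplex.Finite (Set.univ : Set X)] [PathConnectedSpace X]
  {E : Type v} [TopologicalSpace E] [SimplyConnectedSpace E] [LocallyPathConnectedSpace E]
  {π : C(E, X)} {e₀ : E} {l : ℕ} {S : Type w} [CommRing S]

theorem exists_twistedChains_equiv_cells (hπ : IsCoveringMap π)
    (σ : FundamentalGroup X (π e₀) →* Matrix.GeneralLinearGroup (Fin l) S) (k : ℕ) :
    Nonempty (TwistedChains π e₀ σ k ≃ₗ[S] (Cell X k →₀ ((Fin l → S) ⊗[ℤ] BallHomology k))) := by
  obtain ⟨j, hj⟩ := exists_cellChains_basis hπ e₀ k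
  choose T hT using fun g : FundamentalGroup X (π e₀) => exists_isDeck hπ g
  exact exists_twistedChains_equiv hπ σ j T hT (hj T hT)

theorem twistedChains_finite (hπ : IsCoveringMap π)
    (σ : FundamentalGroup X (π e₀) →* Matrix.GeneralLinearGroup (Fin l) S) (k : ℕ) :
    Module.Finite S (TwistedChains π e₀ σ k) := by
  obtain ⟨e⟩ := exists_twistedChains_equiv_cells hπ σ k
  have : Module.Finite S ((Fin l → S) ⊗[ℤ] BallHomology k) :=
    Module.Finite.equiv (AlgebraTensorModule.cancelBaseChange ℤ S S (Fin l → S) (BallHomology k))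
  exact Module.Finite.equiv e.symm

/-- Tensoring with `BallHomology` over `ℤ` factors through its extension to `F`, which is a vector
space and hence free, whatever torsion the group might have. This is why coefficients are enlarged
from `R` to its fraction field. -/
theorem twistedChains_free (F : Type*) [Field F] [Algebra F S] (hπ : IsCoveringMap π)
    (σ : FundamentalGroup X (π e₀) →* Matrix.GeneralLinearGroup (Fin l) S) (k : ℕ) :
    Module.Free S (TwistedChains π e₀ σ k) := by
  obtain ⟨e⟩ := exists_twistedChains_equiv_cells hπ σ k
  have : Module.Free S ((Fin l → S) ⊗[ℤ] BallHomology k) :=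
    Module.Free.of_equiv
      (AlgebraTensorModule.cancelBaseChange ℤ F S (Fin l → S) (BallHomology k))
  exact Module.Free.of_equiv e.symm

end FiniteTwisted

/-! ### Comparison of twisted Betti numbers -/

section Minors

open Module

theorem finrank_range_eq_rank_map {S K : Type*} [CommRing S] [Field K] [Algebra S K]
    {M N M' N' m n : Type*} [AddCommGroup M] [AddCommGroup N] [AddCommGroup M'] [AddCommGroup N']
    [Module S M] [Module S N] [Module S M'] [Module S N'] [Module K M'] [Module K N']
    [IsScalarTower S K M'] [IsScalarTower S K N'] {iM : M →ₗ[S] M'} {iN : N →ₗ[S] N'}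
    (hM : IsBaseChange K iM) (hN : IsBaseChange K iN) {d : M →ₗ[S] N} {d' : M' →ₗ[K] N'}
    (h : ∀ x, d' (iM x) = iN (d x)) [Fintype m] [Fintype n] [DecidableEq n] (b : Basis n S M)
    (c : Basis m S N) : finrank K (LinearMap.range d') =
      ((LinearMap.toMatrix b c d).map (algebraMap S K)).rank := by
  have e : (LinearMap.toMatrix b c d).map (algebraMap S K) =
      LinearMap.toMatrix (hM.basis b) (hN.basis c) d' := by
    ext i j
    rw [Matrix.map_apply, LinearMap.toMatrix_apply, LinearMap.toMatrix_apply, hM.basis_apply, h,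
      hN.basis_repr_comp_apply]
  rw [e, Matrix.rank_eq_finrank_range_toLin _ (hN.basis c) (hM.basis b), Matrix.toLin_toMatrix]

/-- The rank of a map of free modules after a change of coefficients to a field depends only on the
vanishing of finitely many elements, and is semicontinuous. -/
theorem exists_finrank_range_le {S : Type*} [CommRing S] {M N : Type*} [AddCommGroup M]
    [AddCommGroup N] [Module S M] [Module S N] [Module.Free S M] [Module.Finite S M]
    [Module.Free S N] [Module.Finite S N] (d : M →ₗ[S] N) :
    ∃ s : Set S, s.Finite ∧ ∀ {K K' : Type w} [Field K] [Field K'] [Algebra S K] [Algebra S K']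
      {M₁ N₁ M₂ N₂ : Type (max v w)} [AddCommGroup M₁] [AddCommGroup N₁] [AddCommGroup M₂]
      [AddCommGroup N₂] [Module S M₁] [Module S N₁] [Module S M₂] [Module S N₂] [Module K M₁]
      [Module K N₁] [Module K' M₂] [Module K' N₂] [IsScalarTower S K M₁] [IsScalarTower S K N₁]
      [IsScalarTower S K' M₂] [IsScalarTower S K' N₂] {iM : M →ₗ[S] M₁} {iN : N →ₗ[S] N₁}
      {jM : M →ₗ[S] M₂} {jN : N →ₗ[S] N₂} {d₁ : M₁ →ₗ[K] N₁} {d₂ : M₂ →ₗ[K'] N₂},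
      IsBaseChange K iM → IsBaseChange K iN → IsBaseChange K' jM → IsBaseChange K' jN →
      (∀ x, d₁ (iM x) = iN (d x)) → (∀ x, d₂ (jM x) = jN (d x)) →
      (∀ m ∈ s, algebraMap S K m = 0 → algebraMap S K' m = 0) →
      finrank K' (LinearMap.range d₂) ≤ finrank K (LinearMap.range d₁) := by
  classical
  let b := Free.chooseBasis S M
  let c := Free.chooseBasis S N
  let A := LinearMap.toMatrix b c d
  -- The test elements are all minors of a matrix of `d`, with sizes up to the number of columns.
  refine ⟨⋃ t ∈ Set.Iic (Fintype.card (Free.ChooseBasisIndex S M)),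
    Set.range fun rc : (Fin t → Free.ChooseBasisIndex S N) × (Fin t → Free.ChooseBasisIndex S M) =>
      (A.submatrix rc.1 rc.2).det, (Set.finite_Iic _).biUnion fun t _ => Set.finite_range _, ?_⟩
  intro K K' _ _ _ _ M₁ N₁ M₂ N₂ _ _ _ _ _ _ _ _ _ _ _ _ _ _ _ _ iM iN jM jN d₁ d₂ hiM hiN hjM hjN
    h₁ h₂ hs
  rw [finrank_range_eq_rank_map hiM hiN h₁ b c, finrank_range_eq_rank_map hjM hjN h₂ b c]
  exact rank_map_le_rank_map A (algebraMap S K) (algebraMap S K') fun t ht r c hne h0 =>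
    hne (hs _ (Set.mem_biUnion ht ⟨(r, c), rfl⟩) h0)

end Minors

section Compare

open Module

variable {X : Type u} [TopologicalSpace X] [T2Space X] [Topology.CWComplex (Set.univ : Set X)]
  {E : Type v} [TopologicalSpace E] {π : C(E, X)} {e₀ : E} {l : ℕ} {S : Type w} [CommRing S]

/-- The outgoing differential of the twisted chain complex, zero in degree zero. -/
def twistedOut (σ : FundamentalGroup X (π e₀) →* Matrix.GeneralLinearGroup (Fin l) S) (k : ℕ) :
    TwistedChains π e₀ σ k →ₗ[S] TwistedChains π e₀ σ (k - 1) :=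
  ((twistedComplex π e₀ σ).d k (k - 1)).hom

theorem twistedComplex_d (σ : FundamentalGroup X (π e₀) →* Matrix.GeneralLinearGroup (Fin l) S)
    (k : ℕ) : (twistedComplex π e₀ σ).d (k + 1) k = ModuleCat.ofHom (twistedD π e₀ σ k) :=
  ChainComplex.of_d (fun k => ModuleCat.of S (TwistedChains π e₀ σ k))
    (fun k => ModuleCat.ofHom (twistedD π e₀ σ k)) k

theorem twistedOut_twistedExtend (K : Type w) [CommRing K] [Algebra S K]
    (σ : FundamentalGroup X (π e₀) →* Matrix.GeneralLinearGroup (Fin l) S) (k : ℕ)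
    (x : TwistedChains π e₀ σ k) :
    twistedOut (extendRep K σ) k (twistedExtend K σ k x) =
      twistedExtend K σ (k - 1) (twistedOut σ k x) := by
  cases k with
  | zero =>
    have h : ∀ {A : Type w} [CommRing A]
        (τ : FundamentalGroup X (π e₀) →* Matrix.GeneralLinearGroup (Fin l) A),
        twistedOut τ 0 = 0 := fun τ =>
      congrArg ModuleCat.Hom.hom ((twistedComplex π e₀ τ).shape 0 0 (by simp))
    rw [h, h, LinearMap.zero_apply, LinearMap.zero_apply, map_zero]
  | succ k =>
    have h : ∀ {A : Type w} [CommRing A]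
        (τ : FundamentalGroup X (π e₀) →* Matrix.GeneralLinearGroup (Fin l) A),
        twistedOut τ (k + 1) = twistedD π e₀ τ k := fun τ =>
      congrArg ModuleCat.Hom.hom (twistedComplex_d τ k)
    rw [h, h]
    exact twistedD_twistedExtend K σ k x

variable [Topology.CWComplex.Finite (Set.univ : Set X)] [PathConnectedSpace X]
  [SimplyConnectedSpace E] [LocallyPathConnectedSpace E]

theorem twistedRank_add (hπ : IsCoveringMap π) [IsDomain S]
    (σ : FundamentalGroup X (π e₀) →* Matrix.GeneralLinearGroup (Fin l) S) (k : ℕ) :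
    twistedRank π e₀ σ k + finrank S (LinearMap.range (twistedD π e₀ σ k)) +
      finrank S (LinearMap.range (twistedOut σ k)) = finrank S (TwistedChains π e₀ σ k) := by
  have : Module.Finite S ((twistedComplex π e₀ σ).X k) := twistedChains_finite hπ σ k
  have h := finrank_chainComplex_homology_add (twistedComplex π e₀ σ) k
  rw [twistedComplex_d] at h
  exact h

/-- The twisted Betti number over a domain is that over its field of fractions. -/
theorem twistedRank_extendRep_of_isFractionRing (hπ : IsCoveringMap π) [IsDomain S] (K : Type w)
    [Field K] [Algebra S K] [IsFractionRing S K]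
    (σ : FundamentalGroup X (π e₀) →* Matrix.GeneralLinearGroup (Fin l) S) (k : ℕ) :
    twistedRank π e₀ (extendRep K σ) k = twistedRank π e₀ σ k := by
  have hbc := isBaseChange_twistedExtend K σ
  have h1 := twistedRank_add hπ σ k
  have h2 := twistedRank_add hπ (extendRep K σ) k
  have : FaithfulSMul S K := (faithfulSMul_iff_algebraMap_injective S K).2
    (IsFractionRing.injective S K)
  rw [finrank_range_eq_of_isFractionRing (hbc _) (hbc _) _ _ (twistedD_twistedExtend K σ k),
    finrank_range_eq_of_isFractionRing (hbc _) (hbc _) _ _ (twistedOut_twistedExtend K σ k),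
    (hbc k).finrank_eq, ← h1] at h2
  omega

/-- The twisted Betti numbers over fields are semicontinuous with respect to the change of
coefficients. -/
theorem exists_twistedRank_le (F : Type*) [Field F] [Algebra F S] [Nontrivial S]
    (hπ : IsCoveringMap π)
    (σ : FundamentalGroup X (π e₀) →* Matrix.GeneralLinearGroup (Fin l) S) (k : ℕ) :
    ∃ s : Set S, s.Finite ∧ ∀ (K K' : Type w) [Field K] [Field K'] [Algebra S K] [Algebra S K'],
      (∀ m ∈ s, algebraMap S K m = 0 → algebraMap S K' m = 0) →
      twistedRank π e₀ (extendRep K σ) k ≤ twistedRank π e₀ (extendRep K' σ) k := by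
  have hfree := twistedChains_free F hπ σ
  have hfin := twistedChains_finite hπ σ
  obtain ⟨s, hs, h⟩ := exists_finrank_range_le.{v, w} (twistedD π e₀ σ k)
  obtain ⟨s', hs', h'⟩ := exists_finrank_range_le.{v, w} (twistedOut σ k)
  refine ⟨s ∪ s', hs.union hs', fun K K' _ _ _ _ hm => ?_⟩
  have hK := isBaseChange_twistedExtend (e₀ := e₀) K σ
  have hK' := isBaseChange_twistedExtend (e₀ := e₀) K' σ
  have h1 := h (hK _) (hK _) (hK' _) (hK' _) (twistedD_twistedExtend K σ k)
    (twistedD_twistedExtend K' σ k) (fun m hms => hm m (Or.inl hms))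
  have h2 := h' (hK _) (hK _) (hK' _) (hK' _) (twistedOut_twistedExtend K σ k)
    (twistedOut_twistedExtend K' σ k) (fun m hms => hm m (Or.inr hms))
  have h3 := twistedRank_add hπ (extendRep K σ) k
  have h4 := twistedRank_add hπ (extendRep K' σ) k
  have h5 : finrank K (TwistedChains π e₀ (extendRep K σ) k) =
      finrank K' (TwistedChains π e₀ (extendRep K' σ) k) := by
    rw [← (hK k).equiv.finrank_eq, ← (hK' k).equiv.finrank_eq, finrank_baseChange,
      finrank_baseChange]
  -- The chain modules have the same rank over both fields, so smaller ranks of the two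
  -- differentials mean larger homology.
  omega

end Compare

/-! ### Group rings and the Novikov ring -/

section GroupRing

theorem toNovikov_coeff {R : Type w} [CommRing R] {A : AddSubgroup ℝ} (x : AddMonoidAlgebra R A)
    (a : A) : (toNovikov R A x : HahnSeries Aᵒᵈ R).coeff (OrderDual.toDual a) = x.coeff a := by
  classical
  let f : AddMonoidAlgebra R A →+ R :=
    { toFun := fun x => (toNovikov R A x : HahnSeries Aᵒᵈ R).coeff (OrderDual.toDual a)
      map_zero' := by simp
      map_add' := by simp }
  let g : AddMonoidAlgebra R A →+ R :=
    { toFun := fun x => x.coeff a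
      map_zero' := by simp
      map_add' := by simp }
  have h : f = g := AddMonoidAlgebra.addMonoidHom_ext fun b r => by
    change (toNovikov R A (AddMonoidAlgebra.single b r) : HahnSeries Aᵒᵈ R).coeff
      (OrderDual.toDual a) = (AddMonoidAlgebra.single b r).coeff a
    rw [toNovikov, AddMonoidAlgebra.lift_single, AddMonoidAlgebra.coeff_single]
    change r • (HahnSeries.single (OrderDual.toDual b) (1 : R)).coeff (OrderDual.toDual a) = _
    by_cases hab : a = b
    · subst hab
      rw [HahnSeries.coeff_single_same, Finsupp.single_eq_same, smul_eq_mul, mul_one]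
    · rw [HahnSeries.coeff_single_of_ne (fun e => hab (OrderDual.toDual.injective e)),
        Finsupp.single_eq_of_ne hab, smul_zero]
  exact DFunLike.congr_fun h x

theorem toNovikov_injective (R : Type w) [CommRing R] (A : AddSubgroup ℝ) :
    Function.Injective (toNovikov R A) := fun x y h => by
  ext a
  rw [← toNovikov_coeff, ← toNovikov_coeff, h]

section FractionField

variable {R : Type w} [CommRing R] {F : Type w} [Field F] [Algebra R F] [IsFractionRing R F]
  {A : Type v} [AddCommGroup A]

/-- The support is finite, so one common denominator clears all coefficients. -/
theorem exists_smul_eq_mapRingHom [IsDomain R] (x : AddMonoidAlgebra F A) :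
    ∃ (d : R) (_ : d ≠ 0) (y : AddMonoidAlgebra R A),
      AddMonoidAlgebra.mapRingHom A (algebraMap R F) y = algebraMap R F d • x := by
  classical
  obtain ⟨d, hd⟩ := IsLocalization.exist_integer_multiples (nonZeroDivisors R) x.coeff.support
    x.coeff
  choose f hf using hd
  refine ⟨d, nonZeroDivisors.ne_zero d.2, AddMonoidAlgebra.ofCoeff (Finsupp.onFinset x.coeff.support
    (fun a => if h : a ∈ x.coeff.support then f a h else 0) fun a ha => ?_), ?_⟩
  · by_contra h
    exact ha (dif_neg h)
  · ext a
    rw [AddMonoidAlgebra.coeff_mapRingHom, AddMonoidAlgebra.coeff_smul_apply,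
      AddMonoidAlgebra.coeff_ofCoeff, Finsupp.onFinset_apply]
    split_ifs with h
    · rw [hf a h, Algebra.smul_def, smul_eq_mul]
    · rw [map_zero, Finsupp.notMem_support_iff.1 h, smul_zero]

variable (F) in
/-- An embedding of a group ring in a field extends to the group ring over the field of
fractions. -/
theorem exists_extend_mapRingHom [IsDomain R] {K : Type*} [Field K]
    (h : AddMonoidAlgebra R A →+* K) (hh : Function.Injective h) :
    ∃ f : AddMonoidAlgebra F A →+* K, Function.Injective f ∧
      f.comp (AddMonoidAlgebra.mapRingHom A (algebraMap R F)) = h := by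
  have h0 : Function.Injective (h.comp AddMonoidAlgebra.singleZeroRingHom) :=
    hh.comp fun r s e => by
      simpa using congrArg (fun z : AddMonoidAlgebra R A => z.coeff 0) e
  let _ : Algebra F K := (IsFractionRing.lift h0).toAlgebra
  let f : AddMonoidAlgebra F A →+* K := (AddMonoidAlgebra.lift F K A
    ((h : AddMonoidAlgebra R A →* K).comp (AddMonoidAlgebra.of R A))).toRingHom
  have hf : f.comp (AddMonoidAlgebra.mapRingHom A (algebraMap R F)) = h := by
    refine AddMonoidAlgebra.ringHom_ext (fun r => ?_) fun a => ?_
    · rw [RingHom.comp_apply, AddMonoidAlgebra.mapRingHom_single]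
      refine (AddMonoidAlgebra.lift_single _ _ _).trans ?_
      rw [Algebra.smul_def, ofAdd_zero, map_one, mul_one]
      exact IsFractionRing.lift_algebraMap h0 r
    · rw [RingHom.comp_apply, AddMonoidAlgebra.mapRingHom_single, map_one]
      refine (AddMonoidAlgebra.lift_single _ _ _).trans ?_
      rw [one_smul]
      rfl
  refine ⟨f, (injective_iff_map_eq_zero f).2 fun x hx => ?_, hf⟩
  obtain ⟨d, hd, y, hy⟩ := exists_smul_eq_mapRingHom (R := R) x
  have h1 : h y = 0 := by
    rw [← hf, RingHom.comp_apply, hy, Algebra.smul_def, map_mul, hx, mul_zero]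
  rw [(injective_iff_map_eq_zero h).1 hh y h1, map_zero] at hy
  exact (smul_eq_zero.1 hy.symm).resolve_left
    (fun e => hd ((IsFractionRing.injective R F) (e.trans (map_zero _).symm)))

end FractionField

/-- A relation between the values of two homomorphisms on the support of an element of a group
ring carries over to the vanishing of its images. -/
theorem mapDomain_eq_zero_of_support {F A B C : Type*} [Semiring F] {f : A → B} {g : A → C}
    {x : AddMonoidAlgebra F A}
    (h : ∀ a ∈ x.coeff.support, ∀ b ∈ x.coeff.support, f a = f b → g a = g b)
    (hx : AddMonoidAlgebra.mapDomain f x = 0) : AddMonoidAlgebra.mapDomain g x = 0 := by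
  classical
  by_cases hne : x.coeff.support.Nonempty
  swap
  · rw [Finset.not_nonempty_iff_eq_empty, Finsupp.support_eq_empty, AddMonoidAlgebra.coeff_eq_zero]
      at hne
    rw [hne, AddMonoidAlgebra.mapDomain_zero]
  obtain ⟨a₀, -⟩ := hne
  let r : B → C := fun b => if hb : ∃ a ∈ x.coeff.support, f a = b then g hb.choose else g a₀
  have hr : ∀ a ∈ x.coeff.support, g a = (r ∘ f) a := fun a ha => by
    have hb : ∃ a' ∈ x.coeff.support, f a' = f a := ⟨a, ha, rfl⟩
    rw [Function.comp_apply]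
    simp only [r]
    rw [dif_pos hb]
    exact h _ ha _ hb.choose_spec.1 hb.choose_spec.2.symm
  have h1 : AddMonoidAlgebra.mapDomain g x =
      AddMonoidAlgebra.mapDomain r (AddMonoidAlgebra.mapDomain f x) := by
    apply AddMonoidAlgebra.coeff_injective
    rw [AddMonoidAlgebra.coeff_mapDomain, AddMonoidAlgebra.coeff_mapDomain,
      AddMonoidAlgebra.coeff_mapDomain, ← Finsupp.mapDomain_comp]
    exact Finsupp.mapDomain_congr hr
  rw [h1, hx, AddMonoidAlgebra.mapDomain_zero]

end GroupRing

/-! ### Comparison of the Betti numbers -/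

section Comparison

variable {G : Type u} [Group G] {R : Type w} [CommRing R] {l : ℕ}

/-- Twisting is natural in the abelian group. -/
theorem twistRep_comp {A : Type v} [AddCommGroup A] {B : Type*} [AddCommGroup B]
    (ρ : G →* Matrix.GeneralLinearGroup (Fin l) R) (p : Additive G →+ A) (f : A →+ B) :
    twistRep ρ (f.comp p) = (Matrix.GeneralLinearGroup.map
      (AddMonoidAlgebra.mapDomainRingHom R f)).comp (twistRep ρ p) := by
  ext g i j : 3
  exact (AddMonoidAlgebra.mapDomain_single (f := f)).symm

variable (F : Type w) [Field F] [Algebra R F]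

/-- The representation `ρ ⊗ p` over the group ring with coefficients in a field. -/
abbrev fieldTwistRep {A : Type v} [AddCommGroup A]
    (ρ : G →* Matrix.GeneralLinearGroup (Fin l) R) (p : Additive G →+ A) :
    G →* Matrix.GeneralLinearGroup (Fin l) (AddMonoidAlgebra F A) :=
  (Matrix.GeneralLinearGroup.map (AddMonoidAlgebra.mapRingHom A (algebraMap R F))).comp
    (twistRep ρ p)

theorem map_comp_fieldTwistRep {A : Type v} [AddCommGroup A] {K : Type*} [CommRing K]
    (ρ : G →* Matrix.GeneralLinearGroup (Fin l) R) (p : Additive G →+ A)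
    (f : AddMonoidAlgebra F A →+* K) :
    (Matrix.GeneralLinearGroup.map f).comp (fieldTwistRep F ρ p) =
      (Matrix.GeneralLinearGroup.map
        (f.comp (AddMonoidAlgebra.mapRingHom A (algebraMap R F)))).comp (twistRep ρ p) := by
  rw [Matrix.GeneralLinearGroup.map_comp, MonoidHom.comp_assoc]

end Comparison

/-! ### Generic and Novikov Betti numbers as base changes of one complex -/

section Betti

variable {X : Type u} [TopologicalSpace X] [T2Space X] [Topology.CWComplex (Set.univ : Set X)]
  {E : Type v} [TopologicalSpace E]
  {π : C(E, X)} {e₀ : E} {R : Type w} [CommRing R] {l : ℕ}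
  [IsDomain R]

/-- The target field is unchanged; only the starting ring is enlarged to `F[ℤ ^ n]`, over which the
chains are free. -/
theorem genericBetti_eq (F : Type w) [Field F] [Algebra R F] [IsFractionRing R F]
    (ρ : FundamentalGroup X (π e₀) →* Matrix.GeneralLinearGroup (Fin l) R)
    {n : ℕ} (φ : Additive (FundamentalGroup X (π e₀)) →+ (Fin n → ℤ)) (k : ℕ) :
    ∃ f : AddMonoidAlgebra F (Fin n → ℤ) →+* FractionRing (AddMonoidAlgebra R (Fin n → ℤ)),
      Function.Injective f ∧ genericBetti π e₀ ρ φ k =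
        twistedRank π e₀ ((Matrix.GeneralLinearGroup.map f).comp (fieldTwistRep F ρ φ)) k := by
  obtain ⟨f, hf, hf'⟩ := exists_extend_mapRingHom F
    (algebraMap (AddMonoidAlgebra R (Fin n → ℤ))
      (FractionRing (AddMonoidAlgebra R (Fin n → ℤ))))
    (IsFractionRing.injective _ _)
  refine ⟨f, hf, ?_⟩
  rw [map_comp_fieldTwistRep F, hf']
  rfl

variable [Topology.CWComplex.Finite (Set.univ : Set X)] [PathConnectedSpace X]
  [SimplyConnectedSpace E] [LocallyPathConnectedSpace E]

/-- Passing to the fraction field of the Novikov ring preserves the rank. Since `F[A]` embeds there,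
the coefficient map kills exactly what the push-forward of exponents along `ξ` kills. -/
theorem novikovBetti_eq (F : Type w) [Field F] [Algebra R F] [IsFractionRing R F]
    (hπ : IsCoveringMap π)
    (ρ : FundamentalGroup X (π e₀) →* Matrix.GeneralLinearGroup (Fin l) R)
    {n : ℕ} {φ : Additive (FundamentalGroup X (π e₀)) →+ (Fin n → ℤ)}
    (hφ : Function.Surjective φ) (ξ : (Fin n → ℤ) →+ ℝ) (k : ℕ) :
    ∃ (K : Type w) (_ : Field K) (f : AddMonoidAlgebra F (Fin n → ℤ) →+* K),
      (∀ x, f x = 0 ↔ AddMonoidAlgebra.mapDomain ξ x = 0) ∧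
      novikovBetti π e₀ ρ (ξ.comp φ) k =
        twistedRank π e₀ ((Matrix.GeneralLinearGroup.map f).comp (fieldTwistRep F ρ φ)) k := by
  set A : AddSubgroup ℝ := (ξ.comp φ).range with hA
  let ζ : (Fin n → ℤ) →+ A := ξ.codRestrict A fun a => by
    obtain ⟨g, rfl⟩ := hφ a
    exact ⟨g, rfl⟩
  have hζ : (ξ.comp φ).rangeRestrict = ζ.comp φ := rfl
  let K := FractionRing (NovikovRing R A)
  let i : AddMonoidAlgebra R A →+* K :=
    (algebraMap (NovikovRing R A) K).comp (toNovikov R A).toRingHom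
  have hinj : Function.Injective i :=
    (IsFractionRing.injective (NovikovRing R A) K).comp (toNovikov_injective R A)
  obtain ⟨f, hf, hf'⟩ := exists_extend_mapRingHom F _ hinj
  refine ⟨K, inferInstance,
    f.comp (AddMonoidAlgebra.mapDomainRingHom _ ζ), fun x => ?_, ?_⟩
  · rw [RingHom.comp_apply, map_eq_zero_iff f hf]
    constructor
    · exact mapDomain_eq_zero_of_support fun a _ b _ h => congrArg Subtype.val h
    · exact mapDomain_eq_zero_of_support fun a _ b _ h => Subtype.ext h
  · have h1 := twistedRank_extendRep_of_isFractionRing (e₀ := e₀) hπ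
      K
      ((Matrix.GeneralLinearGroup.map (toNovikov R A).toRingHom).comp
        (twistRep ρ (ξ.comp φ).rangeRestrict)) k
    refine h1.symm.trans ?_
    congr 1
    rw [map_comp_fieldTwistRep F, RingHom.comp_assoc]
    have h2 : (AddMonoidAlgebra.mapDomainRingHom F ζ).comp
        (AddMonoidAlgebra.mapRingHom (Fin n → ℤ) (algebraMap R F)) =
        (AddMonoidAlgebra.mapRingHom A (algebraMap R F)).comp
          (AddMonoidAlgebra.mapDomainRingHom R ζ) := by
      refine AddMonoidAlgebra.ringHom_ext (fun r => ?_) fun a => ?_ <;> simp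
    rw [h2, ← RingHom.comp_assoc, hf', hζ, twistRep_comp, extendRep]
    simp only [i, Matrix.GeneralLinearGroup.map_comp, MonoidHom.comp_assoc]

/-- The twisted Novikov Betti numbers depend on the class `ξ` only through finitely many
relations, and decrease when relations are dropped. -/
theorem exists_finset_novikovBetti_le (F : Type w) [Field F] [Algebra R F] [IsFractionRing R F]
    (hπ : IsCoveringMap π)
    (ρ : FundamentalGroup X (π e₀) →* Matrix.GeneralLinearGroup (Fin l) R)
    {n : ℕ} {φ : Additive (FundamentalGroup X (π e₀)) →+ (Fin n → ℤ)}
    (hφ : Function.Surjective φ) (k : ℕ) :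
    ∃ T : Finset (Fin n → ℤ),
      (∀ ξ η : (Fin n → ℤ) →+ ℝ, (∀ a ∈ T, ∀ b ∈ T, ξ a = ξ b → η a = η b) →
        novikovBetti π e₀ ρ (ξ.comp φ) k ≤ novikovBetti π e₀ ρ (η.comp φ) k) ∧
      ∀ ξ : (Fin n → ℤ) →+ ℝ, Function.Injective ξ →
        novikovBetti π e₀ ρ (ξ.comp φ) k ≤ genericBetti π e₀ ρ φ k := by
  classical
  let S := AddMonoidAlgebra F (Fin n → ℤ)
  let σ : FundamentalGroup X (π e₀) →* Matrix.GeneralLinearGroup (Fin l) S := fieldTwistRep F ρ φ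
  obtain ⟨s, hs, h⟩ := exists_twistedRank_le (S := S) F (e₀ := e₀) hπ σ k
  -- `T` collects the exponents of all test elements: whether such an element dies under `ξ` depends
  -- only on the coincidences of `ξ` on its support.
  refine ⟨hs.toFinset.biUnion fun x => x.coeff.support, fun ξ η hξη => ?_, fun ξ hξ => ?_⟩
  · obtain ⟨K, _, f, hf, e⟩ := novikovBetti_eq F (e₀ := e₀) hπ ρ hφ ξ k
    obtain ⟨K', _, f', hf', e'⟩ := novikovBetti_eq F (e₀ := e₀) hπ ρ hφ η k
    rw [e, e']
    let _ := f.toAlgebra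
    let _ := f'.toAlgebra
    refine h K K' fun m hm hm0 => (hf' m).2 (mapDomain_eq_zero_of_support ?_ ((hf m).1 hm0))
    exact fun a ha b hb => hξη a (Finset.mem_biUnion.2 ⟨m, hs.mem_toFinset.2 hm, ha⟩)
      b (Finset.mem_biUnion.2 ⟨m, hs.mem_toFinset.2 hm, hb⟩)
  · obtain ⟨K, _, f, hf, e⟩ := novikovBetti_eq F (e₀ := e₀) hπ ρ hφ ξ k
    obtain ⟨f', hf', e'⟩ := genericBetti_eq F ρ φ k
    rw [e, e']
    let _ := f.toAlgebra
    let _ := f'.toAlgebra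
    -- An injective `ξ` merges no exponents, so only the zero test element dies.
    refine h K _ fun m hm hm0 => ?_
    have h0 : m = 0 := by
      have := (hf m).1 hm0
      have h1 := mapDomain_eq_zero_of_support (g := id) (fun a _ b _ e => hξ e) this
      have h2 := congrArg AddMonoidAlgebra.coeff h1
      rw [AddMonoidAlgebra.coeff_mapDomain, Finsupp.mapDomain_id] at h2
      exact AddMonoidAlgebra.coeff_injective h2
    rw [h0, map_zero]

end Betti

/-! ### Full subgroups -/

section Full

variable {n : ℕ}

/-- The homomorphisms to `ℤ` that vanish on a set. -/
def annihilator (D : Set (Fin n → ℤ)) : AddSubgroup ((Fin n → ℤ) →+ ℤ) where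
  carrier := {h | ∀ d ∈ D, h d = 0}
  zero_mem' _ _ := rfl
  add_mem' hx hy d hd := by rw [AddMonoidHom.add_apply, hx d hd, hy d hd, add_zero]
  neg_mem' hx d hd := by rw [AddMonoidHom.neg_apply, hx d hd, neg_zero]

/-- Dual systems for the homomorphisms that vanish on a set. -/
theorem exists_dual_system (D : Set (Fin n → ℤ)) :
    ∃ (ι : Type) (_ : Fintype ι) (b : ι → Fin n → ℤ) (h : ι → (Fin n → ℤ) →+ ℤ),
      (∀ i, h i ∈ annihilator D) ∧
      ∀ ξ : (Fin n → ℤ) →+ ℝ, (∀ d ∈ D, ξ d = 0) → ∀ x, ξ x = ∑ i, ξ (b i) * h i x := by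
  -- Vectors killed by every real class vanishing on `D`. The quotient is torsion-free since `ℝ` is,
  -- hence free; `b` lifts a basis of it and `h` consists of the coordinates. The span of `D` itself
  -- need not have this property.
  let N : Submodule ℤ (Fin n → ℤ) :=
    ⨅ ξ : {ξ : (Fin n → ℤ) →+ ℝ // ∀ d ∈ D, ξ d = 0}, LinearMap.ker ξ.1.toIntLinearMap
  have hN : ∀ x, x ∈ N ↔ ∀ ξ : (Fin n → ℤ) →+ ℝ, (∀ d ∈ D, ξ d = 0) → ξ x = 0 := fun x => by
    simp only [N, Submodule.mem_iInf, LinearMap.mem_ker, Subtype.forall,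
      AddMonoidHom.coe_toIntLinearMap]
  have htf : Module.IsTorsionFree ℤ ((Fin n → ℤ) ⧸ N) := by
    refine Module.isTorsionFree_iff_smul_eq_zero.2 fun m y hy => ?_
    obtain ⟨x, rfl⟩ := Submodule.Quotient.mk_surjective N y
    rw [← Submodule.Quotient.mk_smul, Submodule.Quotient.mk_eq_zero, hN] at hy
    refine or_iff_not_imp_left.2 fun hm => (Submodule.Quotient.mk_eq_zero N).2 ((hN x).2 ?_)
    intro ξ hξ
    have := hy ξ hξ
    rw [map_zsmul] at this
    exact (smul_eq_zero.1 this).resolve_left hm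
  have hfree : Module.Free ℤ ((Fin n → ℤ) ⧸ N) := Module.free_of_finite_type_torsion_free'
  let c := Module.Free.chooseBasis ℤ ((Fin n → ℤ) ⧸ N)
  choose b hb using fun i => Submodule.Quotient.mk_surjective N (c i)
  refine ⟨Module.Free.ChooseBasisIndex ℤ ((Fin n → ℤ) ⧸ N), inferInstance, b,
    fun i => ((c.coord i).comp N.mkQ).toAddMonoidHom, fun i d hd => ?_, fun ξ hξ x => ?_⟩
  · have h0 : N.mkQ d = 0 := (Submodule.Quotient.mk_eq_zero N).2 ((hN d).2 fun ξ hξ => hξ d hd)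
    change c.coord _ (N.mkQ d) = 0
    rw [h0, map_zero]
  · have hx : x - ∑ i, c.coord i (N.mkQ x) • b i ∈ N := by
      rw [← Submodule.Quotient.mk_eq_zero, Submodule.Quotient.mk_sub, sub_eq_zero]
      refine (c.sum_repr (N.mkQ x)).symm.trans ?_
      rw [← Submodule.mkQ_apply, map_sum]
      exact Finset.sum_congr rfl fun i _ => by rw [map_smul, ← hb]; rfl
    have h := (hN _).1 hx ξ hξ
    rw [map_sub, sub_eq_zero, map_sum] at h
    rw [h]
    exact Finset.sum_congr rfl fun i _ => by rw [map_zsmul, zsmul_eq_mul, mul_comm]; rfl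

/-- The subspace is rational: the dual system writes any real solution of these integral equations
as a real combination of integral solutions. -/
theorem mem_realSpan_annihilator {D : Set (Fin n → ℤ)} {ξ : (Fin n → ℤ) →+ ℝ} :
    ξ ∈ realSpan (annihilator D) ↔ ∀ d ∈ D, ξ d = 0 := by
  constructor
  · intro h d hd
    induction h using Submodule.span_induction with
    | mem x hx =>
      obtain ⟨h, hh, rfl⟩ := hx
      change ((h d : ℤ) : ℝ) = 0
      rw [hh d hd, Int.cast_zero]
    | zero => rfl
    | add x y _ _ hx hy => rw [AddMonoidHom.add_apply, hx, hy, add_zero]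
    | smul a x _ hx => rw [AddMonoidHom.smul_apply, hx, smul_zero]
  · intro hξ
    obtain ⟨ι, _, b, h, hh, e⟩ := exists_dual_system D
    have e' : ξ = ∑ i, ξ (b i) • (Int.castAddHom ℝ).comp (h i) := by
      refine AddMonoidHom.ext fun x => ?_
      rw [e ξ hξ x, AddMonoidHom.finsetSum_apply]
      rfl
    rw [e']
    exact Submodule.sum_mem _ fun i _ =>
      Submodule.smul_mem _ _ (Submodule.subset_span ⟨h i, hh i, rfl⟩)

/-- The dual system gives the projection `g ↦ ∑ i, g (b i) • h i` onto the annihilator, and the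
complement is its kernel. -/
theorem isFull_annihilator (D : Set (Fin n → ℤ)) : IsFull (annihilator D) := by
  obtain ⟨ι, _, b, h, hh, e⟩ := exists_dual_system D
  have e' : ∀ g ∈ annihilator D, ∀ x, g x = ∑ i, g (b i) * h i x := fun g hg x => by
    have := e ((Int.castAddHom ℝ).comp g) (fun d hd => by
      change ((g d : ℤ) : ℝ) = 0
      rw [hg d hd, Int.cast_zero]) x
    change ((g x : ℤ) : ℝ) = ∑ i, ((g (b i) : ℤ) : ℝ) * (h i x : ℤ) at this
    exact_mod_cast this
  let H' : AddSubgroup ((Fin n → ℤ) →+ ℤ) :=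
    { carrier := {g | ∀ x, ∑ i, g (b i) * h i x = 0}
      zero_mem' := fun x => by simp
      add_mem' := fun {g g'} hg hg' x => by
        simp only [AddMonoidHom.add_apply, add_mul, Finset.sum_add_distrib, hg x, hg' x, add_zero]
      neg_mem' := fun {g} hg x => by
        simp only [AddMonoidHom.neg_apply, neg_mul, Finset.sum_neg_distrib, hg x, neg_zero] }
  refine ⟨H', ?_, ?_⟩
  · rw [AddSubgroup.disjoint_def]
    intro g hg hg'
    refine AddMonoidHom.ext fun x => ?_
    rw [e' g hg x]
    exact hg' x
  · rw [codisjoint_iff, eq_top_iff]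
    intro g _
    let g' : (Fin n → ℤ) →+ ℤ := ∑ i, g (b i) • h i
    have hg' : ∀ x, g' x = ∑ i, g (b i) * h i x := fun x => by
      simp only [g', AddMonoidHom.finsetSum_apply, AddMonoidHom.smul_apply, smul_eq_mul]
    have hm : g' ∈ annihilator D := sum_mem fun i _ => zsmul_mem (hh i) _
    refine AddSubgroup.mem_sup.2 ⟨g', hm, g - g', fun x => ?_, add_sub_cancel _ _⟩
    simp only [AddMonoidHom.sub_apply, sub_mul, Finset.sum_sub_distrib]
    rw [← e' g' hm, hg', sub_self]

theorem subset_zero_of_annihilator_eq_top {D : Set (Fin n → ℤ)} (h : annihilator D = ⊤)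
    {d : Fin n → ℤ} (hd : d ∈ D) : d = 0 := by
  ext i
  have : Pi.evalAddMonoidHom (fun _ : Fin n => ℤ) i ∈ annihilator D := h ▸ AddSubgroup.mem_top _
  exact this d hd

/-- Send the standard basis to real numbers that are linearly independent over `ℚ`. -/
theorem exists_injective_addMonoidHom_real (n : ℕ) :
    ∃ ξ : (Fin n → ℤ) →+ ℝ, Function.Injective ξ := by
  have h : (n : Cardinal) ≤ Module.rank ℚ ℝ := by
    rw [Real.rank_rat_real]
    exact (Cardinal.natCast_lt_aleph0).le.trans Cardinal.aleph0_le_continuum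
  obtain ⟨f, hf⟩ := Module.le_rank_iff_exists_linearMap.1 h
  refine ⟨f.toAddMonoidHom.comp ((Int.castAddHom ℚ).compLeft (Fin n)), hf.comp ?_⟩
  exact Function.Injective.comp_left Int.cast_injective

/-- A condition on real classes which depends only on the relations between the values on a finite
set, is preserved when relations are added and fails for injective classes, is the membership in
a finite union of real subspaces spanned by proper full subgroups. -/
theorem exists_full_subgroups (T : Finset (Fin n → ℤ)) {P : ((Fin n → ℤ) →+ ℝ) → Prop}
    (hP : ∀ ξ η : (Fin n → ℤ) →+ ℝ, (∀ a ∈ T, ∀ b ∈ T, ξ a = ξ b → η a = η b) → P ξ → P η)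
    (hinj : ∀ ξ : (Fin n → ℤ) →+ ℝ, Function.Injective ξ → ¬ P ξ) :
    ∃ (N : ℕ) (H : Fin N → AddSubgroup ((Fin n → ℤ) →+ ℤ)),
      (∀ i, IsFull (H i) ∧ H i ≠ ⊤) ∧ ∀ ξ, P ξ ↔ ∃ i, ξ ∈ realSpan (H i) := by
  classical
  let rel : ((Fin n → ℤ) →+ ℝ) → Finset ((Fin n → ℤ) × (Fin n → ℤ)) := fun ξ =>
    (T ×ˢ T).filter fun p => ξ p.1 = ξ p.2
  -- The patterns of coincidences on `T` realised by some solution of `P`. There are finitely many,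
  -- and each contributes one subgroup.
  let C := (T ×ˢ T).powerset.filter fun r => ∃ ξ, P ξ ∧ rel ξ = r
  let D : Finset ((Fin n → ℤ) × (Fin n → ℤ)) → Set (Fin n → ℤ) := fun r =>
    (fun p => p.1 - p.2) '' (r : Set ((Fin n → ℤ) × (Fin n → ℤ)))
  have hD : ∀ ξ η : (Fin n → ℤ) →+ ℝ, (∀ d ∈ D (rel ξ), η d = 0) ↔
      ∀ a ∈ T, ∀ b ∈ T, ξ a = ξ b → η a = η b := fun ξ η => by
    constructor
    · intro h a ha b hb hab
      have := h (a - b) ⟨(a, b), by simp [rel, ha, hb, hab], rfl⟩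
      rwa [map_sub, sub_eq_zero] at this
    · rintro h _ ⟨p, hp, rfl⟩
      simp only [rel, Finset.mem_coe, Finset.mem_filter, Finset.mem_product] at hp
      rw [map_sub, sub_eq_zero]
      exact h _ hp.1.1 _ hp.1.2 hp.2
  refine ⟨C.card, fun i => annihilator (D (C.equivFin.symm i).1),
    fun i => ⟨isFull_annihilator _, fun htop => ?_⟩, fun ξ => ⟨fun hξ => ?_, ?_⟩⟩
  -- If the subgroup were everything, all differences in the pattern would be zero. An injective
  -- class would then satisfy the same relations and inherit `P`.
  · obtain ⟨ξ, hξ, e⟩ := (Finset.mem_filter.1 (C.equivFin.symm i).2).2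
    replace htop : annihilator (D (rel ξ)) = ⊤ := e ▸ htop
    obtain ⟨η, hη⟩ := exists_injective_addMonoidHom_real n
    refine hinj η hη (hP ξ η ((hD ξ η).1 fun d hd => ?_) hξ)
    rw [subset_zero_of_annihilator_eq_top htop hd, map_zero]
  · have hC : rel ξ ∈ C :=
      Finset.mem_filter.2 ⟨Finset.mem_powerset.2 (Finset.filter_subset _ _), ξ, hξ, rfl⟩
    refine ⟨C.equivFin ⟨rel ξ, hC⟩, ?_⟩
    beta_reduce
    rw [Equiv.symm_apply_apply, mem_realSpan_annihilator, hD]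
    exact fun _ _ _ _ h => h
  -- A class in this subspace satisfies all coincidences of a known solution, so `P` passes to it by
  -- monotonicity.
  · rintro ⟨i, hi⟩
    obtain ⟨η, hη, e⟩ := (Finset.mem_filter.1 (C.equivFin.symm i).2).2
    beta_reduce at hi
    rw [← e, mem_realSpan_annihilator, hD] at hi
    exact hP η ξ hi hη

end Full

end TwistedNovikov

end

/-! ### The jump loci -/

theorem mainTheorem9
    {X : Type u} [TopologicalSpace X] [T2Space X] [ConnectedSpace X]
    [Topology.CWComplex (Set.univ : Set X)] [Topology.CWComplex.Finite (Set.univ : Set X)]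
    {E : Type v} [TopologicalSpace E] [SimplyConnectedSpace E]
    (π : C(E, X)) (hπ : IsCoveringMap π) (e₀ : E)
    {R : Type w} [CommRing R] [IsDomain R] {l : ℕ}
    (ρ : FundamentalGroup X (π e₀) →* Matrix.GeneralLinearGroup (Fin l) R)
    {n : ℕ} (φ : Additive (FundamentalGroup X (π e₀)) →+ (Fin n → ℤ))
    (hφ : Function.Surjective φ)
    (hφ' : ∀ g : FundamentalGroup X (π e₀),
      φ (Additive.ofMul g) = 0 ↔ IsOfFinOrder (Abelianization.of g))
    (k q : ℕ) (hq : 0 < q) :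
    ∃ (N : ℕ) (H : Fin N → AddSubgroup ((Fin n → ℤ) →+ ℤ)),
      (∀ i, TwistedNovikov.IsFull (H i) ∧ H i ≠ ⊤) ∧
      ∀ (ξ : Additive (FundamentalGroup X (π e₀)) →+ ℝ) (ξ' : (Fin n → ℤ) →+ ℝ),
        ξ = ξ'.comp φ →
        (TwistedNovikov.genericBetti π e₀ ρ φ k + q ≤ TwistedNovikov.novikovBetti π e₀ ρ ξ k ↔
          ∃ i, ξ' ∈ TwistedNovikov.realSpan (H i)) := by
  have : LocallyPathConnectedSpace X := TwistedNovikov.locallyPathConnectedSpace_of_finite X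
  have : PathConnectedSpace X := pathConnectedSpace_iff_connectedSpace.2 inferInstance
  have : LocallyPathConnectedSpace E := hπ.isLocalHomeomorph.locallyPathConnectedSpace
  obtain ⟨T, hT, hinj⟩ :=
    TwistedNovikov.exists_finset_novikovBetti_le (e₀ := e₀) (FractionRing R) hπ ρ hφ k
  obtain ⟨N, H, hH, h⟩ := TwistedNovikov.exists_full_subgroups T
    (P := fun ξ => TwistedNovikov.genericBetti π e₀ ρ φ k + q ≤
      TwistedNovikov.novikovBetti π e₀ ρ (ξ.comp φ) k)
    (fun ξ η hξη hξ => hξ.trans (hT ξ η hξη))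
    -- For injective classes the Novikov number is at most the generic one, and `q > 0` then
    -- contradicts the inequality.
    (fun ξ hξ h => by
      have := hinj ξ hξ
      omega)
  refine ⟨N, H, hH, ?_⟩
  rintro _ ξ rfl
  exact h ξ
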